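/- Let $a,b,c$ be nonzero real numbers and $\epsilon_0,d,m,w>0$. Consider the system for $\psi=u+iv$ (complex valued) and $\varphi$ (real valued), functions of $(x,y,t)\in\mathbb R^3$: \[ i\psi_t+a\psi_{xx}+\epsilon_0\psi_{yy}=(b-wm)|\psi|^2\psi-w\,\psi\,\{m\partial_t+(mc-d)\partial_y\}\varphi, \] \[ \varphi_{xx}+(1-mc^2)\varphi_{yy}-m\varphi_{tt}-2mc\,\varphi_{yt}=\{m\partial_t+(mc-d)\partial_y\}|\psi|^2 . \] A Lie point symmetry is a smooth vector field on the space $\mathbb R^6$ of the variables $(x,y,t,u,v,\varphi)$ whose second prolongation annihilates the system at all second order jets that satisfy it. Put \[ X_1=\partial_t,\quad X_2=\partial_x,\quad X_3=\partial_y,\quad X_4=-v\partial_u+u\partial_v+\tfrac1{mw}\partial_\varphi, \] \[ X_5=t(-v\partial_u+u\partial_v)+\tfrac{t}{mw}\partial_\varphi,\quad X_6=t^2(-v\partial_u+u\partial_v)+\big(\tfrac{t^2}{mw}+\tfrac{x^2}{w}\big)\partial_\varphi . \] Then the Lie point symmetries form an infinite-dimensional real Lie algebra under the commutator of vector fields.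 It is described as follows, where $\zeta=my-(mc-d)t$. (A) If $m<d^2$, put $\alpha_0=\sqrt{m(d^2-m)}$, $P_A(F)=F(\alpha_0x-\zeta)\,\partial_\varphi$ and $Q_A(G)=G(\alpha_0x+\zeta)\,\partial_\varphi$. The symmetries are exactly the fields $\sum_{i=1}^6 k_iX_i+P_A(F)+Q_A(G)$ with $k_i\in\mathbb R$ and $F,G\in C^\infty(\mathbb R)$. Such a field vanishes only if all $k_i=0$ and $F=-G$ is constant. Moreover $[X_1,P_A(F)]=(mc-d)P_A(F')$, $[X_1,Q_A(G)]=(d-mc)Q_A(G')$, $[X_2,P_A(F)]=\alpha_0P_A(F')$, $[X_2,Q_A(G)]=\alpha_0Q_A(G')$, $[X_3,P_A(F)]=-mP_A(F')$, $[X_3,Q_A(G)]=mQ_A(G')$, $[X_2,X_6]=\frac1{w\alpha_0}\big(P_A(s)+Q_A(s)\big)$, where $s$ denotes the identity function. (B) If $m>d^2$, put $\sigma=\zeta/\sqrt{m(m-d^2)}$ and $P_B(H)=H(x,\sigma)\,\partial_\varphi$. The symmetries are exactly the fields $\sum_{i=1}^6k_iX_i+P_B(H)$ with $k_i\in\mathbb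 R$ and $H$ harmonic on $\mathbb R^2$; the $k_i$ and $H$ are unique. Moreover $[X_1,P_B(H)]=\frac{d-mc}{\sqrt{m(m-d^2)}}P_B(H_\sigma)$, $[X_2,P_B(H)]=P_B(H_x)$, $[X_3,P_B(H)]=\sqrt{\frac m{m-d^2}}\,P_B(H_\sigma)$, $[X_2,X_6]=P_B(2x/w)$. (C) If $m=d^2$, put $P_C(R)=x\,R(dy-(cd-1)t)\,\partial_\varphi$ and $Q_C(S)=S(dy-(cd-1)t)\,\partial_\varphi$. The symmetries are exactly the fields $\sum_{i=1}^6k_iX_i+P_C(R)+Q_C(S)$ with $k_i\in\mathbb R$ and $R,S\in C^\infty(\mathbb R)$; the $k_i$, $R$ and $S$ are unique. Moreover $[X_1,P_C(R)]=(1-cd)P_C(R')$, $[X_2,P_C(R)]=Q_C(R)$, $[X_3,P_C(R)]=d\,P_C(R')$, $[X_1,Q_C(S)]=(1-cd)Q_C(S')$, $[X_3,Q_C(S)]=d\,Q_C(S')$, $[X_2,X_6]=P_C(2/w)$. In all cases $[X_1,X_5]=X_4$ and $[X_1,X_6]=2X_5$, and all commutators between generators that are not listed, and do not follow from the listed ones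 by antisymmetry, are zero. -/

import Mathlib

open scoped ContDiff

namespace BRZR

noncomputable section

/-! Independent variables: `x, y, t` are numbered `0, 1, 2`.
Dependent variables: `u, v, φ` are numbered `0, 1, 2`, where `ψ = u + i v`. -/

/-- The space of independent and dependent variables `((x, y, t), (u, v, φ))`. -/
abbrev Jet0 := (Fin 3 → ℝ) × (Fin 3 → ℝ)

/-- First order jets; `z.2 α i` is the coordinate `∂ᵢ u^α`. -/
abbrev Jet1 := Jet0 × (Fin 3 → Fin 3 → ℝ)

/-- Second order jets; `z.2 α i j` is the coordinate `∂ⱼ ∂ᵢ u^α`. Genuine jets are those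
satisfying `IsSymm`. -/
abbrev Jet2 := Jet1 × (Fin 3 → Fin 3 → Fin 3 → ℝ)

/-- Equality of mixed second derivatives. -/
def IsSymm (z : Jet2) : Prop := ∀ α i j, z.2 α i j = z.2 α j i

/-- Total derivative `Dᵢ f = ∂f/∂xᵢ + ∑ u^α_i ∂f/∂u^α` of a function on `Jet0`. -/
def D0 (i : Fin 3) (f : Jet0 → ℝ) (z : Jet1) : ℝ :=
  fderiv ℝ f z.1 (Pi.single i 1, fun α => z.2 α i)

/-- Total derivative
`Dᵢ g = ∂g/∂xᵢ + ∑ u^α_i ∂g/∂u^α + ∑ u^α_{ki} ∂g/∂u^α_k` of a function on `Jet1`. -/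
def D1 (i : Fin 3) (g : Jet1 → ℝ) (z : Jet2) : ℝ :=
  fderiv ℝ g z.1 ((Pi.single i 1, fun α => z.1.2 α i), fun α k => z.2 α k i)

/-- The coefficient of `∂/∂u^α_i` in the prolongation of the vector field
`V = ∑ ξ^k ∂_{x_k} + ∑ η^α ∂_{u^α}`: it is `Dᵢ η^α - ∑ u^α_k Dᵢ ξ^k`. -/
def pr1 (V : Jet0 → Jet0) (α i : Fin 3) (z : Jet1) : ℝ :=
  D0 i (fun q => (V q).2 α) z - ∑ k, z.2 α k * D0 i (fun q => (V q).1 k) z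

/-- The coefficient of `∂/∂u^α_{ij}` in the second prolongation of `V`: it is
`Dⱼ η^α_i - ∑ u^α_{ik} Dⱼ ξ^k`, where `η^α_i` is the coefficient of `∂/∂u^α_i`. -/
def pr2 (V : Jet0 → Jet0) (α i j : Fin 3) (z : Jet2) : ℝ :=
  D1 j (pr1 V α i) z - ∑ k, z.2 α i k * D0 j (fun q => (V q).1 k) z.1

/-- The second prolongation of `V`, a vector field on the second order jets. -/
def prolong (V : Jet0 → Jet0) (z : Jet2) : Jet2 :=
  ((V z.1.1, fun α i => pr1 V α i z.1), fun α i j => pr2 V α i j z)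

/-- The real constants of the system. -/
structure Params where
  a : ℝ
  b : ℝ
  c : ℝ
  ε₀ : ℝ
  d : ℝ
  m : ℝ
  w : ℝ

/-- `ψ = u + i v`. -/
def psi (q : Jet0) : ℂ := ⟨q.2 0, q.2 1⟩

/-- `∂ᵢ ψ`. -/
def psi1 (i : Fin 3) (z : Jet2) : ℂ := ⟨z.1.2 0 i, z.1.2 1 i⟩

/-- `∂ⱼ ∂ᵢ ψ`. -/
def psi2 (i j : Fin 3) (z : Jet2) : ℂ := ⟨z.2 0 i j, z.2 1 i j⟩

/-- `m ∂_t + (m c - d) ∂_y`, applied to a function with gradient `g`. -/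
def dirDeriv (p : Params) (g : Fin 3 → ℝ) : ℝ := p.m * g 2 + (p.m * p.c - p.d) * g 1

/-- Left minus right hand side of
`i ψ_t + a ψ_xx + ε₀ ψ_yy = (b - w m) |ψ|² ψ - w ψ {m ∂_t + (m c - d) ∂_y} φ`. -/
def eqA (p : Params) (z : Jet2) : ℂ :=
  (Complex.I * psi1 2 z + p.a * psi2 0 0 z + p.ε₀ * psi2 1 1 z)
    - ((p.b - p.w * p.m : ℝ) * (Complex.normSq (psi z.1.1) : ℝ) * psi z.1.1
      - p.w * psi z.1.1 * (dirDeriv p (fun i => z.1.2 2 i) : ℝ))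

/-- Left minus right hand side of
`φ_xx + (1 - m c²) φ_yy - m φ_tt - 2 m c φ_yt = {m ∂_t + (m c - d) ∂_y} |ψ|²`. -/
def eqB (p : Params) (z : Jet2) : ℝ :=
  (z.2 2 0 0 + (1 - p.m * p.c ^ 2) * z.2 2 1 1 - p.m * z.2 2 2 2
      - 2 * p.m * p.c * z.2 2 1 2)
    - dirDeriv p (fun i => D0 i (fun q => Complex.normSq (psi q)) z.1)

/-- `V` is an infinitesimal Lie point symmetry of the system: it is a smooth vector field on the
space of independent and dependent variables whose second prolongation annihilates both equations
at all second order jets that satisfy them. -/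
def IsLieSymmetry (p : Params) (V : Jet0 → Jet0) : Prop :=
  ContDiff ℝ ∞ V ∧ ∀ z : Jet2, IsSymm z → eqA p z = 0 → eqB p z = 0 →
    fderiv ℝ (eqA p) z (prolong V z) = 0 ∧ fderiv ℝ (eqB p) z (prolong V z) = 0

theorem D0_add (i : Fin 3) {f g : Jet0 → ℝ} (hf : Differentiable ℝ f) (hg : Differentiable ℝ g)
    (z : Jet1) : D0 i (fun q => f q + g q) z = D0 i f z + D0 i g z := by
  unfold D0
  rw [fderiv_fun_add (hf _) (hg _)]
  rfl

theorem D0_const_mul (i : Fin 3) {f : Jet0 → ℝ} (hf : Differentiable ℝ f) (r : ℝ)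
    (z : Jet1) : D0 i (fun q => r * f q) z = r * D0 i f z := by
  unfold D0
  rw [fderiv_const_mul (hf _)]
  rfl

theorem contDiff_D0 (i : Fin 3) {f : Jet0 → ℝ} (hf : ContDiff ℝ ∞ f) :
    ContDiff ℝ ∞ (D0 i f) := by
  unfold D0
  have h1 : ContDiff ℝ ∞ (fun z : Jet1 => fderiv ℝ f z.1) :=
    (hf.fderiv_right (m := ∞) (by simp)).comp contDiff_fst
  refine h1.clm_apply (contDiff_const.prodMk ?_)
  fun_prop

theorem contDiff_pr1 {V : Jet0 → Jet0} (hV : ContDiff ℝ ∞ V) (α i : Fin 3) :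
    ContDiff ℝ ∞ (pr1 V α i) := by
  unfold pr1
  refine (contDiff_D0 i (by fun_prop)).sub (ContDiff.sum fun k _ => ?_)
  refine ContDiff.mul (by fun_prop) (contDiff_D0 i (by fun_prop))

theorem prolong_add {V W : Jet0 → Jet0} (hV : ContDiff ℝ ∞ V) (hW : ContDiff ℝ ∞ W)
    (z : Jet2) : prolong (V + W) z = prolong V z + prolong W z := by
  have dV := hV.differentiable (by simp)
  have dW := hW.differentiable (by simp)
  have h1 : ∀ i k z, D0 i (fun q => ((V + W) q).1 k) z
      = D0 i (fun q => (V q).1 k) z + D0 i (fun q => (W q).1 k) z := fun i k z =>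
    D0_add i (f := fun q => (V q).1 k) (g := fun q => (W q).1 k)
      (by fun_prop) (by fun_prop) z
  have h2 : ∀ i k z, D0 i (fun q => ((V + W) q).2 k) z
      = D0 i (fun q => (V q).2 k) z + D0 i (fun q => (W q).2 k) z := fun i k z =>
    D0_add i (f := fun q => (V q).2 k) (g := fun q => (W q).2 k)
      (by fun_prop) (by fun_prop) z
  have h3 : ∀ α i, pr1 (V + W) α i = fun z => pr1 V α i z + pr1 W α i z := by
    intro α i
    funext z
    simp only [pr1, h1, h2, mul_add, Finset.sum_add_distrib]
    ring
  have h4 : ∀ α i j, pr2 (V + W) α i j z = pr2 V α i j z + pr2 W α i j z := by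
    intro α i j
    simp only [pr2, h1, h3, D1, mul_add, Finset.sum_add_distrib]
    rw [fderiv_fun_add ((contDiff_pr1 hV α i).differentiable (by simp) _)
      ((contDiff_pr1 hW α i).differentiable (by simp) _)]
    simp only [add_apply]
    ring
  refine Prod.ext (Prod.ext rfl ?_) ?_
  · funext α i
    exact congrFun (h3 α i) z.1
  · funext α i j
    exact h4 α i j

theorem prolong_smul {V : Jet0 → Jet0} (hV : ContDiff ℝ ∞ V) (r : ℝ)
    (z : Jet2) : prolong (r • V) z = r • prolong V z := by
  have dV := hV.differentiable (by simp)
  have h1 : ∀ i k z, D0 i (fun q => ((r • V) q).1 k) z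
      = r * D0 i (fun q => (V q).1 k) z := fun i k z =>
    D0_const_mul i (f := fun q => (V q).1 k) (by fun_prop) r z
  have h2 : ∀ i k z, D0 i (fun q => ((r • V) q).2 k) z
      = r * D0 i (fun q => (V q).2 k) z := fun i k z =>
    D0_const_mul i (f := fun q => (V q).2 k) (by fun_prop) r z
  have h3 : ∀ α i, pr1 (r • V) α i = fun z => r * pr1 V α i z := by
    intro α i
    funext z
    simp only [pr1, h1, h2, mul_sub, Finset.mul_sum]
    congr 1
    exact Finset.sum_congr rfl fun k _ => by ring
  have h4 : ∀ α i j, pr2 (r • V) α i j z = r * pr2 V α i j z := by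
    intro α i j
    simp only [pr2, h1, h3, D1, mul_sub, Finset.mul_sum]
    rw [fderiv_const_mul ((contDiff_pr1 hV α i).differentiable (by simp) _)]
    congr 1
    exact Finset.sum_congr rfl fun k _ => by ring
  refine Prod.ext (Prod.ext rfl ?_) ?_
  · funext α i
    exact congrFun (h3 α i) z.1
  · funext α i j
    exact h4 α i j

/-- The real vector space of infinitesimal Lie point symmetries of the system. -/
def symmetryAlgebra (p : Params) : Submodule ℝ (Jet0 → Jet0) where
  carrier := {V | IsLieSymmetry p V}
  zero_mem' := by
    refine ⟨contDiff_const, fun z _ _ _ => ?_⟩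
    have h : prolong (0 : Jet0 → Jet0) z = 0 := by
      have := prolong_smul (V := 0) contDiff_const 0 z
      simpa using this
    simp [h]
  add_mem' := by
    rintro V W ⟨hV, hV'⟩ ⟨hW, hW'⟩
    refine ⟨hV.add hW, fun z hz hA hB => ?_⟩
    simp [prolong_add hV hW, hV' z hz hA hB, hW' z hz hA hB]
  smul_mem' := by
    rintro r V ⟨hV, hV'⟩
    refine ⟨contDiff_const.smul hV, fun z hz hA hB => ?_⟩
    simp [prolong_smul hV, hV' z hz hA hB]

/-- The vector field `h ∂_φ`. -/
def vert (h : Jet0 → ℝ) (q : Jet0) : Jet0 := (0, ![0, 0, h q])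

/-- The vector field `χ(t) (-v ∂_u + u ∂_v)`. -/
def rot (χ : ℝ → ℝ) (q : Jet0) : Jet0 := (0, ![-(χ (q.1 2) * q.2 1), χ (q.1 2) * q.2 0, 0])

/-- `∂_t`. -/
def X₁ : Jet0 → Jet0 := fun _ => (Pi.single 2 1, 0)

/-- `∂_x`. -/
def X₂ : Jet0 → Jet0 := fun _ => (Pi.single 0 1, 0)

/-- `∂_y`. -/
def X₃ : Jet0 → Jet0 := fun _ => (Pi.single 1 1, 0)

/-- `-v ∂_u + u ∂_v + 1/(m w) ∂_φ`. -/
def X₄ (p : Params) : Jet0 → Jet0 :=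
  rot (fun _ => 1) + vert (fun _ => 1 / (p.m * p.w))

/-- `t (-v ∂_u + u ∂_v) + t/(m w) ∂_φ`. -/
def X₅ (p : Params) : Jet0 → Jet0 :=
  rot (fun t => t) + vert (fun q => q.1 2 / (p.m * p.w))

/-- `t² (-v ∂_u + u ∂_v) + (t²/(m w) + x²/w) ∂_φ`. -/
def X₆ (p : Params) : Jet0 → Jet0 :=
  rot (fun t => t ^ 2) + vert (fun q => q.1 2 ^ 2 / (p.m * p.w) + q.1 0 ^ 2 / p.w)

/-- The six generators `X₁, …, X₆`, numbered from `0` to `5`. -/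
def X (p : Params) : Fin 6 → Jet0 → Jet0 := ![X₁, X₂, X₃, X₄ p, X₅ p, X₆ p]

/-- `F(√(m (d² - m)) x - m y + (m c - d) t) ∂_φ`. -/
def PA (p : Params) (F : ℝ → ℝ) : Jet0 → Jet0 := vert fun q =>
  F (√(p.m * (p.d ^ 2 - p.m)) * q.1 0 - p.m * q.1 1 + (p.m * p.c - p.d) * q.1 2)

/-- `G(√(m (d² - m)) x + m y - (m c - d) t) ∂_φ`. -/
def QA (p : Params) (G : ℝ → ℝ) : Jet0 → Jet0 := vert fun q =>
  G (√(p.m * (p.d ^ 2 - p.m)) * q.1 0 + p.m * q.1 1 - (p.m * p.c - p.d) * q.1 2)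

/-- `H(x, σ) ∂_φ` with `σ = (m y - (m c - d) t) / √(m (m - d²))`; the plane of the variables
`(x, σ)` is identified with `ℂ`. -/
def PB (p : Params) (H : ℂ → ℝ) : Jet0 → Jet0 := vert fun q =>
  H ⟨q.1 0, (p.m * q.1 1 - (p.m * p.c - p.d) * q.1 2) / √(p.m * (p.m - p.d ^ 2))⟩

/-- `H` is a harmonic function on the whole plane. -/
def IsHarmonic (H : ℂ → ℝ) : Prop := InnerProductSpace.HarmonicOnNhd H Set.univ

/-- The partial derivative `H_x`. -/
def derivX (H : ℂ → ℝ) (z : ℂ) : ℝ := deriv (fun s : ℝ => H ⟨s, z.im⟩) z.re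

/-- The partial derivative `H_σ`. -/
def derivσ (H : ℂ → ℝ) (z : ℂ) : ℝ := deriv (fun s : ℝ => H ⟨z.re, s⟩) z.im

/-- `x R(d y - (c d - 1) t) ∂_φ`. -/
def PC (p : Params) (R : ℝ → ℝ) : Jet0 → Jet0 := vert fun q =>
  q.1 0 * R (p.d * q.1 1 - (p.c * p.d - 1) * q.1 2)

/-- `S(d y - (c d - 1) t) ∂_φ`. -/
def QC (p : Params) (S : ℝ → ℝ) : Jet0 → Jet0 := vert fun q =>
  S (p.d * q.1 1 - (p.c * p.d - 1) * q.1 2)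

end

end BRZR

open scoped ContDiff
open VectorField

namespace BRZR

noncomputable section

/-! Write a symmetry as `ξ` (components along `x, y, t`) plus `η` (components along `u, v, φ`). The
equations contain the second order coordinates linearly with constant coefficients, the prolongation
is affine in them (`pr2_add_right`), and every first order jet lifts to a jet satisfying the system,
by solving for `ψ_xx` and `φ_tt` (`solJet`, since `a` and `m` are nonzero). The determining
equations can therefore be split with respect to all remaining jet coordinates.

Splitting in the second order coordinates (`principal_determining`, `principalRelations`) shows that
`ξ` does not depend on `u, v, φ`, that its `t`-component depends on `t` only, that the `φ`-component
of `η` does not depend on `ψ` nor its `ψ`-components on `φ`, and that `ξ` acts conformally on the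
symbol of the wave operator. The `ψ_t` terms (`cauchyRiemann`) force the parabolic scaling of the
Schrödinger part, which contradicts the equal scaling of `x` and `t` in the wave part unless both
vanish; the `φ_x` terms remove the remaining rotation because `d w` is nonzero. So `ξ` is constant
(`fderiv_ξ_eq_zero`). The `φ_t`, `ψ_x` and `ψ_y` terms make `η` complex linear in `ψ` with
coefficient `χ(t) + i θ(t)`, and make its `φ`-component a function `h(x, y, t)`
(`exists_eq_gaugeField`).

For such a field invariance amounts to `χ = 0`, `w (m ∂_t + (m c - d) ∂_y) h = θ'` and the
homogeneous wave equation for `h`. Subtracting `θ/(m w)` from `h` leaves a function constant along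
the transport direction, whose image under the wave operator is `θ''/w`; hence `θ''` is constant
(`exists_eq_phase`), which accounts for `X₄, X₅, X₆`. What is left is a function `K` of `x` and `ζ`
with `m K_xx + (m - d²) K_yy = 0` (`mul_wave_eq`): hyperbolic, elliptic or degenerate according to
the sign of `m - d²`. D'Alembert's formula, harmonic functions and functions affine in `x` give the
three families.

All symmetries have constant `ξ`, and rotations of `ψ` commute with each other, so a bracket only
differentiates phases and shifts along constant directions (`lieBracket_gaugeField`); this yields
closure and the commutator tables. Polynomial profiles give infinitely many independent symmetries.
-/

/-! ### Calculus on jets and the second prolongation in coordinates. -/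

/-- The partial derivative of a function on `Jet0` in the direction of the `i`-th independent
variable. -/
def dInd (f : Jet0 → ℝ) (q : Jet0) (i : Fin 3) : ℝ := fderiv ℝ f q (Pi.single i 1, 0)

/-- The partial derivative of a function on `Jet0` in the direction of the `α`-th dependent
variable. -/
def dDep (f : Jet0 → ℝ) (q : Jet0) (α : Fin 3) : ℝ := fderiv ℝ f q (0, Pi.single α 1)

/-- The second derivative of a function on `Jet0`. -/
def hess (f : Jet0 → ℝ) (q v w : Jet0) : ℝ := fderiv ℝ (fderiv ℝ f) q v w

/-- The direction of the `i`-th total derivative. -/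
def totDir (i : Fin 3) (g : Fin 3 → Fin 3 → ℝ) : Jet0 := (Pi.single i 1, fun α => g α i)

theorem fderiv_vertical (f : Jet0 → ℝ) (q : Jet0) (w : Fin 3 → ℝ) :
    fderiv ℝ f q (0, w) = ∑ α, w α * dDep f q α := by
  have h : ((0, w) : Jet0) = ∑ α, w α • ((0, Pi.single α 1) : Jet0) := by
    refine Prod.ext ?_ ?_
    · simp [Prod.fst_sum]
    · ext k
      simp [Prod.snd_sum, Finset.sum_apply, Pi.single_apply]
  rw [h, map_sum]
  simp only [map_smul, smul_eq_mul, dDep]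

theorem fderiv_horizontal (f : Jet0 → ℝ) (q : Jet0) (w : Fin 3 → ℝ) :
    fderiv ℝ f q (w, 0) = ∑ i, w i * dInd f q i := by
  have h : ((w, 0) : Jet0) = ∑ α, w α • ((Pi.single α 1, 0) : Jet0) := by
    refine Prod.ext ?_ ?_
    · ext k
      simp [Prod.fst_sum, Finset.sum_apply, Pi.single_apply]
    · simp [Prod.snd_sum]
  rw [h, map_sum]
  simp only [map_smul, smul_eq_mul, dInd]

theorem fderiv_eq_sum (f : Jet0 → ℝ) (q v : Jet0) :
    fderiv ℝ f q v = ∑ i, v.1 i * dInd f q i + ∑ α, v.2 α * dDep f q α := by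
  rw [← fderiv_vertical, ← fderiv_horizontal, ← map_add]
  simp

theorem D0_eq (i : Fin 3) (f : Jet0 → ℝ) (z : Jet1) :
    D0 i f z = dInd f z.1 i + ∑ α, z.2 α i * dDep f z.1 α := by
  unfold D0
  rw [← fderiv_vertical, dInd, ← map_add]
  simp

/-- `D0 i f` pairs `fderiv ℝ f` with a direction that itself depends on the jet, so the product rule
gives a Hessian term and a term from the moving direction. -/
theorem fderiv_D0 {f : Jet0 → ℝ} (hf : ContDiff ℝ ∞ f) (i : Fin 3) (z v : Jet1) :
    fderiv ℝ (D0 i f) z v = hess f z.1 v.1 (totDir i z.2)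
      + ∑ β, v.2 β i * dDep f z.1 β := by
  have h1 : HasFDerivAt (fun z : Jet1 => fderiv ℝ f z.1)
      ((fderiv ℝ (fderiv ℝ f) z.1).comp (ContinuousLinearMap.fst ℝ _ _)) z := by
    have : DifferentiableAt ℝ (fderiv ℝ f) z.1 :=
      (hf.fderiv_right (m := ∞) (by simp)).differentiable (by simp) _
    exact this.hasFDerivAt.comp z hasFDerivAt_fst
  have h2 : HasFDerivAt (fun z : Jet1 => ((Pi.single i 1, fun α => z.2 α i) : Jet0))
      ((0 : Jet1 →L[ℝ] (Fin 3 → ℝ)).prod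
        ((ContinuousLinearMap.pi fun α => (ContinuousLinearMap.proj i).comp
          (ContinuousLinearMap.proj (R := ℝ) (φ := fun _ : Fin 3 => Fin 3 → ℝ) α)).comp
            (ContinuousLinearMap.snd ℝ Jet0 (Fin 3 → Fin 3 → ℝ)))) z := by
    refine (hasFDerivAt_const _ _).prodMk ?_
    exact ContinuousLinearMap.hasFDerivAt (𝕜 := ℝ) ((ContinuousLinearMap.pi fun α => (ContinuousLinearMap.proj i).comp
          (ContinuousLinearMap.proj (R := ℝ) (φ := fun _ : Fin 3 => Fin 3 → ℝ) α)).comp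
            (ContinuousLinearMap.snd ℝ Jet0 (Fin 3 → Fin 3 → ℝ)))
  have h3 := (h1.clm_apply h2).fderiv
  have h4 : D0 i f = fun z : Jet1 => fderiv ℝ f z.1 (Pi.single i 1, fun α => z.2 α i) := rfl
  rw [h4, h3, ← fderiv_vertical]
  simp only [hess, totDir, add_apply, ContinuousLinearMap.comp_apply,
    ContinuousLinearMap.flip_apply, ContinuousLinearMap.prod_apply]
  rw [add_comm]
  rfl

/-- Expanding both total derivatives separates the Hessian terms, which see only the first order
jet, from the terms linear in the second order coordinates. The splitting of the determining
equations rests on this form. -/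
theorem pr2_eq {V : Jet0 → Jet0} (hV : ContDiff ℝ ∞ V) (α i j : Fin 3) (z : Jet2) :
    pr2 V α i j z =
      hess (fun q => (V q).2 α) z.1.1 (totDir j z.1.2) (totDir i z.1.2)
      + ∑ β, z.2 β i j * dDep (fun q => (V q).2 α) z.1.1 β
      - ∑ k, (z.1.2 α k * (hess (fun q => (V q).1 k) z.1.1 (totDir j z.1.2) (totDir i z.1.2)
            + ∑ β, z.2 β i j * dDep (fun q => (V q).1 k) z.1.1 β)
          + z.2 α k j * D0 i (fun q => (V q).1 k) z.1)
      - ∑ k, z.2 α i k * D0 j (fun q => (V q).1 k) z.1 := by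
  have hη : ∀ α, ContDiff ℝ ∞ (fun q => (V q).2 α) := fun α => by fun_prop
  have hξ : ∀ k, ContDiff ℝ ∞ (fun q => (V q).1 k) := fun k => by fun_prop
  have dη := fun α z => ((contDiff_D0 i (hη α)).differentiable (by simp)) z
  have dξ := fun k z => ((contDiff_D0 i (hξ k)).differentiable (by simp)) z
  unfold pr2
  congr 1
  have hp : pr1 V α i = fun z => D0 i (fun q => (V q).2 α) z
      - ∑ k, z.2 α k * D0 i (fun q => (V q).1 k) z := rfl
  have hc : ∀ k, DifferentiableAt ℝ (fun z : Jet1 => z.2 α k) z.1 := fun k => by fun_prop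
  have hc' : ∀ k v, fderiv ℝ (fun z : Jet1 => z.2 α k) z.1 v = v.2 α k := by
    intro k v
    have : (fun z : Jet1 => z.2 α k) = ((ContinuousLinearMap.proj k).comp
          (ContinuousLinearMap.proj (R := ℝ) (φ := fun _ : Fin 3 => Fin 3 → ℝ) α)).comp
            (ContinuousLinearMap.snd ℝ Jet0 (Fin 3 → Fin 3 → ℝ)) := rfl
    rw [this, ContinuousLinearMap.fderiv]
    rfl
  unfold D1
  rw [hp, fderiv_fun_sub (dη α _) (DifferentiableAt.fun_sum fun k _ => (hc k).fun_mul (dξ k _)),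
    fderiv_fun_sum (fun k _ => (hc k).fun_mul (dξ k _))]
  simp only [sub_apply, sum_apply]
  rw [fderiv_D0 (hη α)]
  congr 1
  refine Finset.sum_congr rfl fun k _ => ?_
  rw [fderiv_fun_mul (hc k) (dξ k _)]
  simp only [add_apply, smul_apply, smul_eq_mul, hc']
  rw [fderiv_D0 (hξ k)]
  simp only [totDir]
  ring

/-! ### The system in real coordinates and its linearisation. -/

theorem D0_normSq (i : Fin 3) (z : Jet1) :
    D0 i (fun q => Complex.normSq (psi q)) z = 2 * (z.1.2 0 * z.2 0 i + z.1.2 1 * z.2 1 i) := by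
  have h : ∀ α : Fin 3, HasFDerivAt (fun q : Jet0 => q.2 α)
      ((ContinuousLinearMap.proj α).comp (ContinuousLinearMap.snd ℝ (Fin 3 → ℝ) (Fin 3 → ℝ)))
        z.1 := fun α => ContinuousLinearMap.hasFDerivAt (𝕜 := ℝ)
      ((ContinuousLinearMap.proj α).comp (ContinuousLinearMap.snd ℝ (Fin 3 → ℝ) (Fin 3 → ℝ)))
  have h2 := (((h 0).fun_mul (h 0)).fun_add ((h 1).fun_mul (h 1))).fderiv
  have h3 : (fun q => Complex.normSq (psi q)) = fun q : Jet0 => q.2 0 * q.2 0 + q.2 1 * q.2 1 := by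
    funext q
    simp [Complex.normSq_apply, psi]
  rw [D0, h3, h2]
  simp
  ring

/-- The real part of `eqA`. -/
def eqRe (p : Params) (z : Jet2) : ℝ :=
  -z.1.2 1 2 + p.a * z.2 0 0 0 + p.ε₀ * z.2 0 1 1
    - ((p.b - p.w * p.m) * (z.1.1.2 0 ^ 2 + z.1.1.2 1 ^ 2) * z.1.1.2 0
      - p.w * z.1.1.2 0 * (p.m * z.1.2 2 2 + (p.m * p.c - p.d) * z.1.2 2 1))

/-- The imaginary part of `eqA`. -/
def eqIm (p : Params) (z : Jet2) : ℝ :=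
  z.1.2 0 2 + p.a * z.2 1 0 0 + p.ε₀ * z.2 1 1 1
    - ((p.b - p.w * p.m) * (z.1.1.2 0 ^ 2 + z.1.1.2 1 ^ 2) * z.1.1.2 1
      - p.w * z.1.1.2 1 * (p.m * z.1.2 2 2 + (p.m * p.c - p.d) * z.1.2 2 1))

theorem eqA_re (p : Params) (z : Jet2) : (eqA p z).re = eqRe p z := by
  simp [eqA, eqRe, psi, psi1, psi2, dirDeriv, Complex.normSq_apply, -mul_eq_mul_right_iff]
  ring

theorem eqA_im (p : Params) (z : Jet2) : (eqA p z).im = eqIm p z := by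
  simp [eqA, eqIm, psi, psi1, psi2, dirDeriv, Complex.normSq_apply, -mul_eq_mul_right_iff]
  ring

theorem eqB_eq (p : Params) (z : Jet2) : eqB p z =
    (z.2 2 0 0 + (1 - p.m * p.c ^ 2) * z.2 2 1 1 - p.m * z.2 2 2 2 - 2 * p.m * p.c * z.2 2 1 2)
    - (p.m * (2 * (z.1.1.2 0 * z.1.2 0 2 + z.1.1.2 1 * z.1.2 1 2))
      + (p.m * p.c - p.d) * (2 * (z.1.1.2 0 * z.1.2 0 1 + z.1.1.2 1 * z.1.2 1 1))) := by
  simp only [eqB, dirDeriv, D0_normSq]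

theorem contDiff_eqRe (p : Params) : ContDiff ℝ ∞ (eqRe p) := by
  unfold eqRe
  fun_prop

theorem contDiff_eqIm (p : Params) : ContDiff ℝ ∞ (eqIm p) := by
  unfold eqIm
  fun_prop

theorem contDiff_eqB (p : Params) : ContDiff ℝ ∞ (eqB p) := by
  have : eqB p = _ := funext (eqB_eq p)
  rw [this]
  fun_prop

theorem eqA_eq_zero_iff (p : Params) (z : Jet2) : eqA p z = 0 ↔ eqRe p z = 0 ∧ eqIm p z = 0 := by
  rw [Complex.ext_iff, eqA_re, eqA_im]
  simp

theorem fderiv_eqA_eq_zero_iff (p : Params) (z v : Jet2) :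
    fderiv ℝ (eqA p) z v = 0 ↔ fderiv ℝ (eqRe p) z v = 0 ∧ fderiv ℝ (eqIm p) z v = 0 := by
  have h : eqA p = fun z => Complex.equivRealProdCLM.symm (eqRe p z, eqIm p z) := by
    funext z
    apply Complex.ext
    · simp [eqA_re]
    · simp [eqA_im]
  have hd : HasFDerivAt (eqA p) ((Complex.equivRealProdCLM.symm : ℝ × ℝ →L[ℝ] ℂ).comp
      ((fderiv ℝ (eqRe p) z).prod (fderiv ℝ (eqIm p) z))) z := by
    rw [h]
    exact (ContinuousLinearEquiv.hasFDerivAt _).comp z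
      ((((contDiff_eqRe p).differentiable (by simp)) z).hasFDerivAt.prodMk
        (((contDiff_eqIm p).differentiable (by simp)) z).hasFDerivAt)
  rw [hd.fderiv, Complex.ext_iff]
  simp

/-- A function that is cubic along a line has the linear coefficient as directional derivative. -/
theorem fderiv_of_cubic {E : Type*} [NormedAddCommGroup E] [NormedSpace ℝ E] {f : E → ℝ} {z v : E}
    (hf : DifferentiableAt ℝ f z) {k l : ℝ} (c : ℝ)
    (h : ∀ s : ℝ, f (z + s • v) = f z + s * c + s ^ 2 * k + s ^ 3 * l) :
    fderiv ℝ f z v = c := by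
  have h1 : HasDerivAt (fun s : ℝ => f (z + s • v)) (fderiv ℝ f z v) 0 := by
    have hl : HasDerivAt (fun s : ℝ => z + s • v) v 0 := by
      simpa using ((hasDerivAt_id (0 : ℝ)).smul_const v).const_add z
    have hf' : HasFDerivAt f (fderiv ℝ f z) (z + (0 : ℝ) • v) := by simpa using hf.hasFDerivAt
    exact hf'.comp_hasDerivAt 0 hl
  have h2 : HasDerivAt (fun s : ℝ => f (z + s • v)) c 0 := by
    have : (fun s : ℝ => f (z + s • v)) = fun s => f z + s * c + s ^ 2 * k + s ^ 3 * l := funext h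
    rw [this]
    have h3 := ((((hasDerivAt_id (0 : ℝ)).mul_const c).const_add (f z)).fun_add
      ((hasDerivAt_pow 2 (0 : ℝ)).mul_const k)).fun_add ((hasDerivAt_pow 3 (0 : ℝ)).mul_const l)
    simpa using h3
  exact h1.unique h2

theorem fderiv_eqRe (p : Params) (z v : Jet2) : fderiv ℝ (eqRe p) z v =
    -v.1.2 1 2 + p.a * v.2 0 0 0 + p.ε₀ * v.2 0 1 1
    - ((p.b - p.w * p.m) * ((z.1.1.2 0 ^ 2 + z.1.1.2 1 ^ 2) * v.1.1.2 0
        + 2 * (z.1.1.2 0 * v.1.1.2 0 + z.1.1.2 1 * v.1.1.2 1) * z.1.1.2 0)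
      - p.w * v.1.1.2 0 * (p.m * z.1.2 2 2 + (p.m * p.c - p.d) * z.1.2 2 1)
      - p.w * z.1.1.2 0 * (p.m * v.1.2 2 2 + (p.m * p.c - p.d) * v.1.2 2 1)) := by
  -- `k` and `l` are the quadratic and cubic Taylor coefficients in direction `v`; they only have to
  -- exist.
  refine fderiv_of_cubic (((contDiff_eqRe p).differentiable (by simp)) z)
    (k := -((p.b - p.w * p.m) * ((v.1.1.2 0 ^ 2 + v.1.1.2 1 ^ 2) * z.1.1.2 0
        + 2 * (z.1.1.2 0 * v.1.1.2 0 + z.1.1.2 1 * v.1.1.2 1) * v.1.1.2 0)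
        - p.w * v.1.1.2 0 * (p.m * v.1.2 2 2 + (p.m * p.c - p.d) * v.1.2 2 1)))
    (l := -((p.b - p.w * p.m) * (v.1.1.2 0 ^ 2 + v.1.1.2 1 ^ 2) * v.1.1.2 0)) _ fun s => ?_
  simp only [eqRe, Prod.fst_add, Prod.snd_add, Prod.smul_fst, Prod.smul_snd, Pi.add_apply,
    Pi.smul_apply, smul_eq_mul]
  ring

theorem fderiv_eqIm (p : Params) (z v : Jet2) : fderiv ℝ (eqIm p) z v =
    v.1.2 0 2 + p.a * v.2 1 0 0 + p.ε₀ * v.2 1 1 1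
    - ((p.b - p.w * p.m) * ((z.1.1.2 0 ^ 2 + z.1.1.2 1 ^ 2) * v.1.1.2 1
        + 2 * (z.1.1.2 0 * v.1.1.2 0 + z.1.1.2 1 * v.1.1.2 1) * z.1.1.2 1)
      - p.w * v.1.1.2 1 * (p.m * z.1.2 2 2 + (p.m * p.c - p.d) * z.1.2 2 1)
      - p.w * z.1.1.2 1 * (p.m * v.1.2 2 2 + (p.m * p.c - p.d) * v.1.2 2 1)) := by
  refine fderiv_of_cubic (((contDiff_eqIm p).differentiable (by simp)) z)
    (k := -((p.b - p.w * p.m) * ((v.1.1.2 0 ^ 2 + v.1.1.2 1 ^ 2) * z.1.1.2 1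
        + 2 * (z.1.1.2 0 * v.1.1.2 0 + z.1.1.2 1 * v.1.1.2 1) * v.1.1.2 1)
        - p.w * v.1.1.2 1 * (p.m * v.1.2 2 2 + (p.m * p.c - p.d) * v.1.2 2 1)))
    (l := -((p.b - p.w * p.m) * (v.1.1.2 0 ^ 2 + v.1.1.2 1 ^ 2) * v.1.1.2 1)) _ fun s => ?_
  simp only [eqIm, Prod.fst_add, Prod.snd_add, Prod.smul_fst, Prod.smul_snd, Pi.add_apply,
    Pi.smul_apply, smul_eq_mul]
  ring

theorem fderiv_eqB (p : Params) (z v : Jet2) : fderiv ℝ (eqB p) z v =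
    (v.2 2 0 0 + (1 - p.m * p.c ^ 2) * v.2 2 1 1 - p.m * v.2 2 2 2 - 2 * p.m * p.c * v.2 2 1 2)
    - (p.m * (2 * (z.1.1.2 0 * v.1.2 0 2 + z.1.1.2 1 * v.1.2 1 2
        + v.1.1.2 0 * z.1.2 0 2 + v.1.1.2 1 * z.1.2 1 2))
      + (p.m * p.c - p.d) * (2 * (z.1.1.2 0 * v.1.2 0 1 + z.1.1.2 1 * v.1.2 1 1
        + v.1.1.2 0 * z.1.2 0 1 + v.1.1.2 1 * z.1.2 1 1))) := by
  refine fderiv_of_cubic (((contDiff_eqB p).differentiable (by simp)) z)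
    (k := - (p.m * (2 * (v.1.1.2 0 * v.1.2 0 2 + v.1.1.2 1 * v.1.2 1 2))
      + (p.m * p.c - p.d) * (2 * (v.1.1.2 0 * v.1.2 0 1 + v.1.1.2 1 * v.1.2 1 1))))
    (l := 0) _ fun s => ?_
  simp only [eqB_eq, Prod.fst_add, Prod.snd_add, Prod.smul_fst, Prod.smul_snd, Pi.add_apply,
    Pi.smul_apply, smul_eq_mul]
  ring

/-- The infinitesimal invariance conditions at a jet, in real coordinates. -/
def Invariant (p : Params) (V : Jet0 → Jet0) (z : Jet2) : Prop :=
  fderiv ℝ (eqRe p) z (prolong V z) = 0 ∧ fderiv ℝ (eqIm p) z (prolong V z) = 0 ∧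
    fderiv ℝ (eqB p) z (prolong V z) = 0

theorem isLieSymmetry_iff (p : Params) (V : Jet0 → Jet0) : IsLieSymmetry p V ↔
    ContDiff ℝ ∞ V ∧ ∀ z : Jet2, IsSymm z → eqRe p z = 0 → eqIm p z = 0 → eqB p z = 0 →
      Invariant p V z := by
  simp only [IsLieSymmetry, eqA_eq_zero_iff, fderiv_eqA_eq_zero_iff, Invariant, and_imp, and_assoc]

/-! ### Splitting with respect to the second order coordinates. -/

/-- The change of the prolongation coefficient `pr2` when the second order coordinates of the jet
change by `r`. -/
def pr2Lin (V : Jet0 → Jet0) (α i j : Fin 3) (z : Jet1) (r : Fin 3 → Fin 3 → Fin 3 → ℝ) : ℝ :=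
  ∑ β, r β i j * (dDep (fun q => (V q).2 α) z.1 β
      - ∑ k, z.2 α k * dDep (fun q => (V q).1 k) z.1 β)
    - ∑ k, (r α k j * D0 i (fun q => (V q).1 k) z + r α i k * D0 j (fun q => (V q).1 k) z)

theorem pr2_add_right {V : Jet0 → Jet0} (hV : ContDiff ℝ ∞ V) (α i j : Fin 3) (z : Jet1)
    (r s : Fin 3 → Fin 3 → Fin 3 → ℝ) :
    pr2 V α i j (z, r + s) = pr2 V α i j (z, r) + pr2Lin V α i j z s := by
  rw [pr2_eq hV, pr2_eq hV, pr2Lin]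
  simp only [Fin.sum_univ_three, Pi.add_apply]
  ring

/-- The symmetric matrix with entries `xx, yy, tt, xy, xt, yt`. -/
def symMat (xx yy tt xy xt yt : ℝ) : Fin 3 → Fin 3 → ℝ :=
  ![![xx, xy, xt], ![xy, yy, yt], ![xt, yt, tt]]

theorem symMat_symm (xx yy tt xy xt yt : ℝ) (i j : Fin 3) :
    symMat xx yy tt xy xt yt i j = symMat xx yy tt xy xt yt j i := by
  fin_cases i <;> fin_cases j <;> rfl

/-- The principal part of `eqB`. -/
def waveOp (p : Params) (s : Fin 3 → Fin 3 → ℝ) : ℝ :=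
  s 0 0 + (1 - p.m * p.c ^ 2) * s 1 1 - p.m * s 2 2 - 2 * p.m * p.c * s 1 2

/-- The second order coordinates of a jet above `z` that satisfies the system; only `ψ_xx` and
`φ_tt` are different from zero. -/
def solJet (p : Params) (z : Jet1) : Fin 3 → Fin 3 → Fin 3 → ℝ :=
  ![symMat (-eqRe p (z, 0) / p.a) 0 0 0 0 0, symMat (-eqIm p (z, 0) / p.a) 0 0 0 0 0,
    symMat 0 0 (eqB p (z, 0) / p.m) 0 0 0]

theorem solJet_spec (p : Params) (ha : p.a ≠ 0) (hm : p.m ≠ 0) (z : Jet1) :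
    IsSymm (z, solJet p z) ∧ eqRe p (z, solJet p z) = 0 ∧ eqIm p (z, solJet p z) = 0 ∧
      eqB p (z, solJet p z) = 0 := by
  unfold solJet
  refine ⟨?_, ?_, ?_, ?_⟩
  · intro α i j
    fin_cases α <;> exact symMat_symm ..
  · have : p.a * (-eqRe p (z, 0) / p.a) = -eqRe p (z, 0) := by field_simp
    simp only [eqRe, symMat, Matrix.cons_val_zero, Matrix.cons_val_one,
      Pi.zero_apply] at this ⊢
    linarith
  · have : p.a * (-eqIm p (z, 0) / p.a) = -eqIm p (z, 0) := by field_simp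
    simp only [eqIm, symMat, Matrix.cons_val_zero, Matrix.cons_val_one,
      Pi.zero_apply] at this ⊢
    linarith
  · have : p.m * (eqB p (z, 0) / p.m) = eqB p (z, 0) := by field_simp
    simp only [eqB_eq, symMat, Matrix.cons_val_zero, Matrix.cons_val_one, Matrix.cons_val,
      Pi.zero_apply] at this ⊢
    linarith

/-- The part of the determining equations that is linear in the second order coordinates. -/
theorem principal_determining {p : Params} (ha : p.a ≠ 0) (hm : p.m ≠ 0) {V : Jet0 → Jet0}
    (hV : IsLieSymmetry p V) (z : Jet1) (r : Fin 3 → Fin 3 → Fin 3 → ℝ)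
    (hr : ∀ α i j, r α i j = r α j i) (h0 : p.a * r 0 0 0 + p.ε₀ * r 0 1 1 = 0)
    (h1 : p.a * r 1 0 0 + p.ε₀ * r 1 1 1 = 0) (h2 : waveOp p (r 2) = 0) :
    p.a * pr2Lin V 0 0 0 z r + p.ε₀ * pr2Lin V 0 1 1 z r = 0 ∧
    p.a * pr2Lin V 1 0 0 z r + p.ε₀ * pr2Lin V 1 1 1 z r = 0 ∧
    waveOp p (fun i j => pr2Lin V 2 i j z r) = 0 := by
  obtain ⟨hs, e0, e1, e2⟩ := solJet_spec p ha hm z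
  set s := solJet p z
  rw [isLieSymmetry_iff] at hV
  obtain ⟨hV, hI⟩ := hV
  have i1 := hI (z, s) hs e0 e1 e2
  -- The equations are affine in the second order coordinates, so adding a solution `r` of the
  -- homogeneous principal part to a solution jet gives another one over the same first order jet.
  have i2 := hI (z, s + r) (fun α i j => by simpa using congrArg₂ (· + ·) (hs α i j) (hr α i j))
    (by simp only [eqRe, Pi.add_apply] at e0 ⊢; linarith)
    (by simp only [eqIm, Pi.add_apply] at e1 ⊢; linarith)
    (by simp only [eqB_eq, waveOp, Pi.add_apply] at e2 h2 ⊢; linarith)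
  simp only [Invariant, fderiv_eqRe, fderiv_eqIm, fderiv_eqB, prolong, pr2_add_right hV] at i1 i2
  obtain ⟨a1, a2, a3⟩ := i1
  obtain ⟨b1, b2, b3⟩ := i2
  simp only [waveOp]
  -- All terms that do not involve `r` agree in the two invariance conditions and cancel in their
  -- difference.
  refine ⟨?_, ?_, ?_⟩ <;> linarith

/-- The total derivative at `q` is an affine function of the free coordinates `g`, so each of its
coefficients must vanish; `g = 0` and a single nonzero row isolate them. -/
theorem eq_zero_of_D0_eq_zero {f : Jet0 → ℝ} {q : Jet0} {i : Fin 3}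
    (h : ∀ g, D0 i f (q, g) = 0) : dInd f q i = 0 ∧ ∀ α, dDep f q α = 0 := by
  have h0 := h 0
  simp only [D0_eq] at h h0
  have h0 : dInd f q i = 0 := by simpa using h0
  refine ⟨h0, fun α => ?_⟩
  have := h fun β _ => if β = α then 1 else 0
  simpa [h0] using this

/-- The first order consequences of `principal_determining` at a point. -/
structure PrincipalRelations (p : Params) (V : Jet0 → Jet0) (q : Jet0) : Prop where
  dep_ξ : ∀ k α, dDep (fun q => (V q).1 k) q α = 0
  t_x : dInd (fun q => (V q).1 2) q 0 = 0
  t_y : dInd (fun q => (V q).1 2) q 1 = 0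
  u_φ : dDep (fun q => (V q).2 0) q 2 = 0
  v_φ : dDep (fun q => (V q).2 1) q 2 = 0
  φ_u : dDep (fun q => (V q).2 2) q 0 = 0
  φ_v : dDep (fun q => (V q).2 2) q 1 = 0
  x_t : dInd (fun q => (V q).1 0) q 2 = -p.c * dInd (fun q => (V q).1 0) q 1
  y_x : dInd (fun q => (V q).1 1) q 0 = -dInd (fun q => (V q).1 0) q 1
  y_t : dInd (fun q => (V q).1 1) q 2 = 0
  x_x : dInd (fun q => (V q).1 0) q 0 = dInd (fun q => (V q).1 2) q 2
  y_y : dInd (fun q => (V q).1 1) q 1 = dInd (fun q => (V q).1 2) q 2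

/-- Each admissible `r` fed into `principal_determining` gives one relation, which is then split
again in the first order coordinates where needed. The relations between derivatives of `ξ` along
`x, y, t` are the conformal Killing equations of the wave operator, sharpened by the absence of
`ψ_tt`, `ψ_xt` and `ψ_yt` from the Schrödinger equation. -/
theorem principalRelations {p : Params} (ha : p.a ≠ 0) (hε : p.ε₀ ≠ 0) (hm : p.m ≠ 0)
    {V : Jet0 → Jet0} (hV : IsLieSymmetry p V) (q : Jet0) : PrincipalRelations p V q := by
  have key := fun g => principal_determining ha hm hV (q, g)
  have hsym : ∀ (x₁ x₂ x₃ x₄ x₅ x₆ y₁ y₂ y₃ y₄ y₅ y₆ z₁ z₂ z₃ z₄ z₅ z₆ : ℝ) (α i j : Fin 3),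
      (![symMat x₁ x₂ x₃ x₄ x₅ x₆, symMat y₁ y₂ y₃ y₄ y₅ y₆, symMat z₁ z₂ z₃ z₄ z₅ z₆] :
        Fin 3 → Fin 3 → Fin 3 → ℝ) α i j =
      (![symMat x₁ x₂ x₃ x₄ x₅ x₆, symMat y₁ y₂ y₃ y₄ y₅ y₆, symMat z₁ z₂ z₃ z₄ z₅ z₆] :
        Fin 3 → Fin 3 → Fin 3 → ℝ) α j i := by
    intros
    rename_i α i j
    fin_cases α <;> exact symMat_symm ..
  -- `r` has `u_xt = 1` only: the first equation contains `u_xx` but no `u_xt`, so the coefficient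
  -- `D_x ξ^t` must vanish.
  have hTx : ∀ g, D0 0 (fun q => (V q).1 2) (q, g) = 0 := fun g => by
    have h := (key g _ (hsym 0 0 0 0 1 0 0 0 0 0 0 0 0 0 0 0 0 0) (by simp [symMat])
      (by simp [symMat]) (by simp [symMat, waveOp])).1
    simpa [pr2Lin, Fin.sum_univ_three, symMat, waveOp, ha, hε, hm] using h
  have hTy : ∀ g, D0 1 (fun q => (V q).1 2) (q, g) = 0 := fun g => by
    have h := (key g _ (hsym 0 0 0 0 0 1 0 0 0 0 0 0 0 0 0 0 0 0) (by simp [symMat])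
      (by simp [symMat]) (by simp [symMat, waveOp])).1
    simpa [pr2Lin, Fin.sum_univ_three, symMat, waveOp, ha, hε, hm] using h
  obtain ⟨tx, tdep⟩ := eq_zero_of_D0_eq_zero hTx
  obtain ⟨ty, -⟩ := eq_zero_of_D0_eq_zero hTy
  -- `φ_xx = 1`, `φ_tt = 1/m` solves the homogeneous wave equation, and its trace in the first
  -- equation is the dependence of the `u`-component and of `ξ` on `φ`.
  have hU : ∀ g : Fin 3 → Fin 3 → ℝ, dDep (fun q => (V q).2 0) q 2
      - (g 0 0 * dDep (fun q => (V q).1 0) q 2 + g 0 1 * dDep (fun q => (V q).1 1) q 2) = 0 := fun g => by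
    have h := (key g _ (hsym 0 0 0 0 0 0 0 0 0 0 0 0 1 0 (1 / p.m) 0 0 0) (by simp [symMat])
      (by simp [symMat]) (by simp [symMat, waveOp, hm])).1
    simpa [pr2Lin, Fin.sum_univ_three, symMat, waveOp, ha, hε, hm, tdep] using h
  have hW : ∀ g : Fin 3 → Fin 3 → ℝ, dDep (fun q => (V q).2 1) q 2
      - (g 1 0 * dDep (fun q => (V q).1 0) q 2 + g 1 1 * dDep (fun q => (V q).1 1) q 2) = 0 := fun g => by
    have h := (key g _ (hsym 0 0 0 0 0 0 0 0 0 0 0 0 1 0 (1 / p.m) 0 0 0) (by simp [symMat])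
      (by simp [symMat]) (by simp [symMat, waveOp, hm])).2.1
    simpa [pr2Lin, Fin.sum_univ_three, symMat, waveOp, ha, hε, hm, tdep] using h
  have uφ := hU 0
  have vφ := hW 0
  have xφ := hU ![![1, 0, 0], 0, 0]
  have yφ := hU ![![0, 1, 0], 0, 0]
  simp at uφ vφ xφ yφ
  rw [uφ] at xφ yφ
  -- Coefficient of `u_xy`. It is affine in the first order coordinates; comparing with `g = 0`
  -- isolates the `ψ`-derivatives of `ξ^x` and `ξ^y`.
  have hXY : ∀ g, p.a * D0 0 (fun q => (V q).1 1) (q, g)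
      + p.ε₀ * D0 1 (fun q => (V q).1 0) (q, g) = 0 := fun g => by
    have h := (key g _ (hsym 0 0 0 1 0 0 0 0 0 0 0 0 0 0 0 0 0 0) (by simp [symMat])
      (by simp [symMat]) (by simp [symMat, waveOp])).1
    simp [pr2Lin, Fin.sum_univ_three, symMat] at h
    linarith
  simp only [D0_eq, Fin.sum_univ_three] at hXY
  have e0 := hXY 0
  simp at e0
  have xu := hXY ![![0, 1, 0], 0, 0]
  have xv := hXY ![0, ![0, 1, 0], 0]
  have yu := hXY ![![1, 0, 0], 0, 0]
  have yv := hXY ![0, ![1, 0, 0], 0]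
  simp [mul_add] at xu xv yu yv
  have xu : dDep (fun q => (V q).1 0) q 0 = 0 := (mul_eq_zero.1 (by linarith)).resolve_left hε
  have xv : dDep (fun q => (V q).1 0) q 1 = 0 := (mul_eq_zero.1 (by linarith)).resolve_left hε
  have yu : dDep (fun q => (V q).1 1) q 0 = 0 := (mul_eq_zero.1 (by linarith)).resolve_left ha
  have yv : dDep (fun q => (V q).1 1) q 1 = 0 := (mul_eq_zero.1 (by linarith)).resolve_left ha
  have dep : ∀ k α, dDep (fun q => (V q).1 k) q α = 0 := by
    intro k α
    fin_cases k <;> fin_cases α <;> simp_all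
  -- `u_tt` is unconstrained by the system, but would enter the wave equation through the
  -- `u`-dependence of the `φ`-component.
  have φu : dDep (fun q => (V q).2 2) q 0 = 0 :=  by
    have h := (key 0 _ (hsym 0 0 1 0 0 0 0 0 0 0 0 0 0 0 0 0 0 0) (by simp [symMat])
      (by simp [symMat]) (by simp [symMat, waveOp])).2.2
    simpa [pr2Lin, Fin.sum_univ_three, symMat, waveOp, ha, hε, hm] using h
  have φv : dDep (fun q => (V q).2 2) q 1 = 0 :=  by
    have h := (key 0 _ (hsym 0 0 0 0 0 0 0 0 1 0 0 0 0 0 0 0 0 0) (by simp [symMat])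
      (by simp [symMat]) (by simp [symMat, waveOp])).2.2
    simpa [pr2Lin, Fin.sum_univ_three, symMat, waveOp, ha, hε, hm] using h
  -- The following five choices span the solutions of `waveOp p s = 0`. In those with a nonzero
  -- diagonal part or with `φ_yt`, the entry `φ_tt` is chosen to balance the others.
  have bxt := (key 0 _ (hsym 0 0 0 0 0 0 0 0 0 0 0 0 0 0 0 0 1 0) (by simp [symMat])
      (by simp [symMat]) (by simp [symMat, waveOp])).2.2
  simp [pr2Lin, Fin.sum_univ_three, symMat, waveOp, D0_eq, dep, tx, ty] at bxt
  have bxy := (key 0 _ (hsym 0 0 0 0 0 0 0 0 0 0 0 0 0 0 0 1 0 0) (by simp [symMat])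
      (by simp [symMat]) (by simp [symMat, waveOp])).2.2
  simp [pr2Lin, Fin.sum_univ_three, symMat, waveOp, D0_eq, dep, tx, ty] at bxy
  have bxx := (key 0 _ (hsym 0 0 0 0 0 0 0 0 0 0 0 0 p.m 0 1 0 0 0) (by simp [symMat])
      (by simp [symMat]) (by simp [symMat, waveOp])).2.2
  simp [pr2Lin, Fin.sum_univ_three, symMat, waveOp, D0_eq, dep, tx, ty] at bxx
  have byt := (key 0 _ (hsym 0 0 0 0 0 0 0 0 0 0 0 0 0 0 (-(2 * p.c)) 0 0 1) (by simp [symMat])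
      (by simp [symMat]) (by simp [symMat, waveOp]; ring)).2.2
  simp [pr2Lin, Fin.sum_univ_three, symMat, waveOp, D0_eq, dep, tx, ty] at byt
  have byy := (key 0 _ (hsym 0 0 0 0 0 0 0 0 0 0 0 0 0 p.m (1 - p.m * p.c ^ 2) 0 0 0) (by simp [symMat])
      (by simp [symMat]) (by simp [symMat, waveOp]; ring)).2.2
  simp [pr2Lin, Fin.sum_univ_three, symMat, waveOp, D0_eq, dep, tx, ty] at byy
  have xt : dInd (fun q => (V q).1 0) q 2 = -p.c * dInd (fun q => (V q).1 0) q 1 := mul_left_cancel₀ hm (by linarith)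
  have yt : dInd (fun q => (V q).1 1) q 2 = p.c * (dInd (fun q => (V q).1 2) q 2 - dInd (fun q => (V q).1 1) q 1) :=
    mul_left_cancel₀ hm (by linarith)
  -- Once `yt` is inserted into `byy`, the terms in `c²` cancel and a multiple of `ξ^t_t - ξ^y_y` by
  -- `m` remains.
  have yy : dInd (fun q => (V q).1 1) q 1 = dInd (fun q => (V q).1 2) q 2 := by
    refine mul_left_cancel₀ hm ?_
    rw [yt] at byy
    linarith
  have xx : dInd (fun q => (V q).1 0) q 0 = dInd (fun q => (V q).1 2) q 2 := mul_left_cancel₀ hm (by linarith)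
  refine ⟨dep, tx, ty, uφ, vφ, φu, φv, xt, ?_, by rw [yt, yy]; ring, xx, yy⟩
  rw [xt] at bxy
  linarith

/-! ### Splitting with respect to the first order coordinates. -/

theorem apply_add_of_fderiv_eq_zero {E : Type*} [NormedAddCommGroup E] [NormedSpace ℝ E]
    {f : E → ℝ} (hf : Differentiable ℝ f) {w : E} (h : ∀ q, fderiv ℝ f q w = 0) (q : E) :
    f (q + w) = f q := by
  have hd : ∀ s : ℝ, HasDerivAt (fun s : ℝ => f (q + s • w)) 0 s := by
    intro s
    have hl : HasDerivAt (fun s : ℝ => q + s • w) w s := by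
      simpa using ((hasDerivAt_id s).smul_const w).const_add q
    have := (hf (q + s • w)).hasFDerivAt.comp_hasDerivAt s hl
    rwa [h] at this
  have := is_const_of_deriv_eq_zero (fun s => (hd s).differentiableAt) (fun s => (hd s).deriv) 1 0
  simpa using this

theorem hess_eq_fderiv {f : Jet0 → ℝ} (hf : ContDiff ℝ ∞ f) (q v w : Jet0) :
    hess f q v w = fderiv ℝ (fun q => fderiv ℝ f q w) q v := by
  have hd : DifferentiableAt ℝ (fderiv ℝ f) q :=
    (hf.fderiv_right (m := ∞) (by simp)).differentiable (by simp) q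
  rw [fderiv_clm_apply hd (differentiableAt_const w)]
  simp [hess]

theorem hess_comm {f : Jet0 → ℝ} (hf : ContDiff ℝ ∞ f) (q v w : Jet0) :
    hess f q v w = hess f q w v :=
  (hf.contDiffAt.isSymmSndFDerivAt (by
    simp only [minSmoothness_of_isRCLikeNormedField]
    exact WithTop.coe_le_coe.2 (le_top : (2 : ℕ∞) ≤ ⊤))) v w

/-- Differentiates an identity `∂_w f = 0` that holds at every point. -/
theorem hess_eq_zero_right {f : Jet0 → ℝ} (hf : ContDiff ℝ ∞ f) {w : Jet0}
    (h : ∀ q, fderiv ℝ f q w = 0) (q v : Jet0) : hess f q v w = 0 := by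
  rw [hess_eq_fderiv hf, show (fun q => fderiv ℝ f q w) = fun _ => 0 from funext h]
  simp

theorem hess_add_left (f : Jet0 → ℝ) (q v v' w : Jet0) :
    hess f q (v + v') w = hess f q v w + hess f q v' w := by simp [hess]

theorem hess_add_right (f : Jet0 → ℝ) (q v w w' : Jet0) :
    hess f q v (w + w') = hess f q v w + hess f q v w' := by simp [hess]

theorem hess_add_self {f : Jet0 → ℝ} (hf : ContDiff ℝ ∞ f) (q v w : Jet0) :
    hess f q (v + w) (v + w) = hess f q v v + 2 * hess f q v w + hess f q w w := by
  rw [hess_add_left, hess_add_right, hess_add_right, hess_comm hf q w v]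
  ring

/-- Makes the first order coordinates free parameters: the second order ones are supplied by
`solJet`. -/
theorem invariant_solJet {p : Params} (ha : p.a ≠ 0) (hm : p.m ≠ 0) {V : Jet0 → Jet0}
    (hV : IsLieSymmetry p V) (z : Jet1) : Invariant p V (z, solJet p z) := by
  obtain ⟨h, e0, e1, e2⟩ := solJet_spec p ha hm z
  exact ((isLieSymmetry_iff p V).1 hV).2 _ h e0 e1 e2

/-- The real part of the first determining equation on the jets of `solJet`. -/
theorem determining_re {p : Params} (ha : p.a ≠ 0) (hm : p.m ≠ 0) {V : Jet0 → Jet0}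
    (hV : IsLieSymmetry p V) {q : Jet0} (P : PrincipalRelations p V q) (g : Fin 3 → Fin 3 → ℝ) :
    -pr1 V 1 2 (q, g)
    + p.a * (hess (fun q => (V q).2 0) q (totDir 0 g) (totDir 0 g)
      - ∑ k, g 0 k * hess (fun q => (V q).1 k) q (totDir 0 g) (totDir 0 g))
    + p.ε₀ * (hess (fun q => (V q).2 0) q (totDir 1 g) (totDir 1 g)
      - ∑ k, g 0 k * hess (fun q => (V q).1 k) q (totDir 1 g) (totDir 1 g))
    - eqRe p ((q, g), 0) *
      (dDep (fun q => (V q).2 0) q 0 - 2 * dInd (fun q => (V q).1 0) q 0)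
    - eqIm p ((q, g), 0) * dDep (fun q => (V q).2 0) q 1
    - ((p.b - p.w * p.m) * ((q.2 0 ^ 2 + q.2 1 ^ 2) * (V q).2 0
        + 2 * (q.2 0 * (V q).2 0 + q.2 1 * (V q).2 1) * q.2 0)
      - p.w * (V q).2 0 * (p.m * g 2 2 + (p.m * p.c - p.d) * g 2 1)
      - p.w * q.2 0 * (p.m * pr1 V 2 2 (q, g) + (p.m * p.c - p.d) * pr1 V 2 1 (q, g))) = 0 := by
  have h := (invariant_solJet ha hm hV (q, g)).1
  rw [fderiv_eqRe] at h
  simp only [prolong, pr2_eq hV.1, solJet, symMat] at h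
  generalize hR : eqRe p ((q, g), 0) = R at h ⊢
  generalize hI : eqIm p ((q, g), 0) = I at h ⊢
  -- `solJet` stores `u_xx = -R/a`; naming the quotient removes the division and keeps the final
  -- identity polynomial.
  have hR' : R = p.a * (R / p.a) := by field_simp
  have hI' : I = p.a * (I / p.a) := by field_simp
  generalize hR2 : R / p.a = R' at hR'
  generalize hI2 : I / p.a = I' at hI'
  simp [Fin.sum_univ_three, P.dep_ξ, D0_eq, neg_div, hI2, hR2] at h ⊢
  rw [hR', hI']
  linarith

/-- The imaginary part of the first determining equation on the jets of `solJet`. -/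
theorem determining_im {p : Params} (ha : p.a ≠ 0) (hm : p.m ≠ 0) {V : Jet0 → Jet0}
    (hV : IsLieSymmetry p V) {q : Jet0} (P : PrincipalRelations p V q) (g : Fin 3 → Fin 3 → ℝ) :
    pr1 V 0 2 (q, g)
    + p.a * (hess (fun q => (V q).2 1) q (totDir 0 g) (totDir 0 g)
      - ∑ k, g 1 k * hess (fun q => (V q).1 k) q (totDir 0 g) (totDir 0 g))
    + p.ε₀ * (hess (fun q => (V q).2 1) q (totDir 1 g) (totDir 1 g)
      - ∑ k, g 1 k * hess (fun q => (V q).1 k) q (totDir 1 g) (totDir 1 g))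
    - eqIm p ((q, g), 0) *
      (dDep (fun q => (V q).2 1) q 1 - 2 * dInd (fun q => (V q).1 0) q 0)
    - eqRe p ((q, g), 0) * dDep (fun q => (V q).2 1) q 0
    - ((p.b - p.w * p.m) * ((q.2 0 ^ 2 + q.2 1 ^ 2) * (V q).2 1
        + 2 * (q.2 0 * (V q).2 0 + q.2 1 * (V q).2 1) * q.2 1)
      - p.w * (V q).2 1 * (p.m * g 2 2 + (p.m * p.c - p.d) * g 2 1)
      - p.w * q.2 1 * (p.m * pr1 V 2 2 (q, g) + (p.m * p.c - p.d) * pr1 V 2 1 (q, g))) = 0 := by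
  have h := (invariant_solJet ha hm hV (q, g)).2.1
  rw [fderiv_eqIm] at h
  simp only [prolong, pr2_eq hV.1, solJet, symMat] at h
  generalize hR : eqRe p ((q, g), 0) = R at h ⊢
  generalize hI : eqIm p ((q, g), 0) = I at h ⊢
  have hR' : R = p.a * (R / p.a) := by field_simp
  have hI' : I = p.a * (I / p.a) := by field_simp
  generalize hR2 : R / p.a = R' at hR'
  generalize hI2 : I / p.a = I' at hI'
  simp [Fin.sum_univ_three, P.dep_ξ, D0_eq, neg_div, hI2, hR2] at h ⊢
  rw [hR', hI']
  linarith

/-- Compares the coefficients of `u_t` and `v_t`. The real and imaginary equations contain `ξ^t_t -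
2 ξ^x_x` with opposite signs but the difference of the two diagonal derivatives with the same sign,
so both vanish. -/
theorem cauchyRiemann {p : Params} (ha : p.a ≠ 0) (hε : p.ε₀ ≠ 0) (hm : p.m ≠ 0)
    {V : Jet0 → Jet0} (hV : IsLieSymmetry p V) (q : Jet0) :
    dDep (fun q => (V q).2 1) q 1 = dDep (fun q => (V q).2 0) q 0 ∧
    dDep (fun q => (V q).2 1) q 0 = -dDep (fun q => (V q).2 0) q 1 ∧
    dInd (fun q => (V q).1 2) q 2 = 2 * dInd (fun q => (V q).1 0) q 0 := by
  have P := principalRelations ha hε hm hV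
  have hVs := hV.1
  have hx : ∀ v, hess (fun q => (V q).1 2) q v (Pi.single 0 1, 0) = 0 :=
    hess_eq_zero_right (by fun_prop) (fun q => (P q).t_x) q
  have hy : ∀ v, hess (fun q => (V q).1 2) q v (Pi.single 1 1, 0) = 0 :=
    hess_eq_zero_right (by fun_prop) (fun q => (P q).t_y) q
  -- Only `ψ_t` is nonzero in these jets, so `D_x` and `D_y` reduce to `∂_x` and `∂_y` and the
  -- Hessian terms do not depend on `s₀, s₁`.
  have t : ∀ s₀ s₁ : ℝ, ∀ i : Fin 3, i ≠ 2 →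
      totDir i ![![0, 0, s₀], ![0, 0, s₁], 0] = (Pi.single i 1, 0) := by
    intro s₀ s₁ i hi
    refine Prod.ext rfl ?_
    ext α
    fin_cases α <;> fin_cases i <;> simp [totDir] at hi ⊢
  have kr := fun s₀ s₁ => determining_re ha hm hV (P q) ![![0, 0, s₀], ![0, 0, s₁], 0]
  have ki := fun s₀ s₁ => determining_im ha hm hV (P q) ![![0, 0, s₀], ![0, 0, s₁], 0]
  simp [t, hx, hy, pr1, D0_eq, Fin.sum_univ_three, (P q).dep_ξ, (P q).φ_u, (P q).φ_v,
    (P q).u_φ, (P q).v_φ, eqRe, eqIm] at kr ki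
  have r0 := kr 0 0
  have r1 := kr 1 0
  have r2 := kr 0 1
  have i0 := ki 0 0
  have i1 := ki 1 0
  simp only [zero_mul, one_mul, neg_zero] at r0 r1 r2 i0 i1
  refine ⟨?_, ?_, ?_⟩ <;> linarith

/-- Transports information along the fibres: `∂_y ξ^x` is first found only where `u = 1`. -/
theorem dInd_eq_of_dDep_eq_zero {f : Jet0 → ℝ} (hf : ContDiff ℝ ∞ f)
    (h : ∀ q α, dDep f q α = 0) (x w w' : Fin 3 → ℝ) (i : Fin 3) :
    dInd f (x, w) i = dInd f (x, w') i := by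
  have h1 : ∀ q, fderiv ℝ f q (0, w' - w) = 0 := fun q => by simp [fderiv_vertical, h]
  have h2 : (fun q => f (q + (0, w' - w))) = f :=
    funext (apply_add_of_fderiv_eq_zero (hf.differentiable (by simp)) h1)
  have h3 : fderiv ℝ f (x, w) = fderiv ℝ f ((x, w) + (0, w' - w)) := by
    rw [← fderiv_comp_add_right, h2]
  have h4 : ((x, w) + (0, w' - w) : Jet0) = (x, w') := by simp
  rw [dInd, h3, h4, dInd]

/-- After `principalRelations` only a scaling `ξ^t_t` and a rotation `ξ^x_y` survive. The first is
excluded by the Schrödinger part, the second by the direction of the coupling term `m ∂_t + (m c -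
d) ∂_y`. -/
theorem fderiv_ξ_eq_zero {p : Params} (ha : p.a ≠ 0) (hε : p.ε₀ ≠ 0) (hm : p.m ≠ 0)
    (hd : p.d ≠ 0) (hw : p.w ≠ 0) {V : Jet0 → Jet0} (hV : IsLieSymmetry p V) (k : Fin 3)
    (q : Jet0) : fderiv ℝ (fun q => (V q).1 k) q = 0 := by
  have P := principalRelations ha hε hm hV
  have hVs := hV.1
  -- Coefficient of `φ_x` in the real equation. It carries the factor `u`, whence the normalisation
  -- `u = 1`.
  have xy_aux : ∀ q : Jet0, q.2 0 = 1 → dInd (fun q => (V q).1 0) q 1 = 0 := by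
    intro q hq
    have hU : ∀ v, hess (fun q => (V q).2 0) q v (0, Pi.single 2 1) = 0 :=
      hess_eq_zero_right (by fun_prop) (fun q => (P q).u_φ) q
    have t0 : ∀ s : ℝ, totDir 0 ![0, 0, ![s, 0, 0]]
        = (Pi.single 0 1, 0) + s • (0, Pi.single 2 1) := by
      intro s
      refine Prod.ext (by simp [totDir]) ?_
      ext α
      fin_cases α <;> simp [totDir]
    have t1 : ∀ s : ℝ, totDir 1 ![0, 0, ![s, 0, 0]] = (Pi.single 1 1, 0) := by
      intro s
      refine Prod.ext (by simp [totDir]) ?_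
      ext α
      fin_cases α <;> simp [totDir]
    have hH : ∀ s : ℝ, hess (fun q => (V q).2 0) q (totDir 0 ![0, 0, ![s, 0, 0]])
        (totDir 0 ![0, 0, ![s, 0, 0]])
          = hess (fun q => (V q).2 0) q (Pi.single 0 1, 0) (Pi.single 0 1, 0) := by
      intro s
      have hs : ∀ v, hess (fun q => (V q).2 0) q v (s • (0, Pi.single 2 1)) = 0 := by
        intro v
        have := hU v
        rw [hess] at this ⊢
        rw [map_smul, this, smul_zero]
      rw [t0, hess_add_self (by fun_prop), hs, hs]
      ring
    have kr := fun s => determining_re ha hm hV (P q) ![0, 0, ![s, 0, 0]]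
    simp only [hH, t1] at kr
    simp [pr1, D0_eq, Fin.sum_univ_three, (P q).dep_ξ, (P q).φ_u, (P q).φ_v,
      (P q).t_y, (P q).v_φ, eqRe, eqIm, hq] at kr
    have r0 := kr 0
    have r1 := kr 1
    simp only [zero_mul, one_mul, (P q).x_t] at r0 r1
    -- By `x_t`, the coefficient `m ξ^x_t + (m c - d) ξ^x_y` equals `-d ξ^x_y`.
    have : p.w * p.d * dInd (fun q => (V q).1 0) q 1 = 0 := by linarith
    simpa [hd, hw] using this
  have xy : ∀ q : Jet0, dInd (fun q => (V q).1 0) q 1 = 0 := by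
    intro q
    have h := dInd_eq_of_dDep_eq_zero (f := fun q => (V q).1 0) (by fun_prop)
      (fun q => (P q).dep_ξ 0) q.1 q.2 (fun _ => 1) 1
    exact h.trans (xy_aux _ rfl)
  -- `ξ^t_t = 2 ξ^x_x` and `ξ^x_x = ξ^t_t` are compatible only if both vanish.
  have hT : dInd (fun q => (V q).1 2) q 2 = 0 := by
    have h := (cauchyRiemann ha hε hm hV q).2.2
    rw [(P q).x_x] at h
    linarith
  have all : ∀ i, dInd (fun q => (V q).1 k) q i = 0 := by
    intro i
    have := P q
    fin_cases k <;> fin_cases i <;>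
      simp [this.t_x, this.t_y, hT, this.x_x, this.x_t, this.y_y, this.y_x, this.y_t, xy]
  ext v
  · simp [fderiv_eq_sum, all, (P q).dep_ξ]
  · simp [fderiv_eq_sum, all, (P q).dep_ξ]

theorem hess_smul_left (f : Jet0 → ℝ) (q v w : Jet0) (s : ℝ) :
    hess f q (s • v) w = s * hess f q v w := by
  simp [hess]

theorem hess_smul_right (f : Jet0 → ℝ) (q v w : Jet0) (s : ℝ) :
    hess f q v (s • w) = s * hess f q v w := by
  simp [hess]

theorem contDiff_dDep {f : Jet0 → ℝ} (hf : ContDiff ℝ ∞ f) (α : Fin 3) :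
    ContDiff ℝ ∞ (fun q => dDep f q α) := by
  unfold dDep
  exact (hf.fderiv_right (m := ∞) (by simp)).clm_apply contDiff_const

/-- A function whose derivative sees only the `t`-direction is a function of `t`. -/
theorem eq_apply_time {f : Jet0 → ℝ} (hf : Differentiable ℝ f) (h0 : ∀ q, dInd f q 0 = 0)
    (h1 : ∀ q, dInd f q 1 = 0) (h : ∀ q α, dDep f q α = 0) (q : Jet0) :
    f q = f (Pi.single 2 (q.1 2), 0) := by
  have := apply_add_of_fderiv_eq_zero hf (w := (Pi.single 2 (q.1 2), 0) - q)
    (fun q' => by rw [fderiv_eq_sum]; simp [Fin.sum_univ_three, h0, h1, h]) q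
  rw [← this]
  simp

theorem eq_apply_independent {f : Jet0 → ℝ} (hf : Differentiable ℝ f)
    (h : ∀ q α, dDep f q α = 0) (q : Jet0) : f q = f (q.1, 0) := by
  have := apply_add_of_fderiv_eq_zero hf (w := (q.1, 0) - q)
    (fun q' => by rw [fderiv_eq_sum]; simp [h]) q
  rw [← this]
  simp

theorem dInd_ξ_eq_zero {p : Params} (ha : p.a ≠ 0) (hε : p.ε₀ ≠ 0) (hm : p.m ≠ 0)
    (hd : p.d ≠ 0) (hw : p.w ≠ 0) {V : Jet0 → Jet0} (hV : IsLieSymmetry p V)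
    (k i : Fin 3) (q : Jet0) : dInd (fun q => (V q).1 k) q i = 0 := by
  simp [dInd, fderiv_ξ_eq_zero ha hε hm hd hw hV]

theorem hess_ξ_eq_zero {p : Params} (ha : p.a ≠ 0) (hε : p.ε₀ ≠ 0) (hm : p.m ≠ 0)
    (hd : p.d ≠ 0) (hw : p.w ≠ 0) {V : Jet0 → Jet0} (hV : IsLieSymmetry p V)
    (k : Fin 3) (q v w : Jet0) : hess (fun q => (V q).1 k) q v w = 0 := by
  have h : fderiv ℝ (fun q => (V q).1 k) = fun _ => 0 :=
    funext (fderiv_ξ_eq_zero ha hε hm hd hw hV k)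
  simp [hess, h]

/-- Comparison of the coefficients of `φ_t`. -/
theorem euler_relations {p : Params} (ha : p.a ≠ 0) (hε : p.ε₀ ≠ 0) (hm : p.m ≠ 0)
    (hd : p.d ≠ 0) (hw : p.w ≠ 0) {V : Jet0 → Jet0} (hV : IsLieSymmetry p V)
    (q : Jet0) :
    (V q).2 0 = q.2 0 * dDep (fun q => (V q).2 0) q 0 + q.2 1 * dDep (fun q => (V q).2 0) q 1
      - q.2 0 * dDep (fun q => (V q).2 2) q 2 ∧
    (V q).2 1 = q.2 0 * dDep (fun q => (V q).2 1) q 0 + q.2 1 * dDep (fun q => (V q).2 1) q 1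
      - q.2 1 * dDep (fun q => (V q).2 2) q 2 := by
  have P := principalRelations ha hε hm hV q
  have dI := dInd_ξ_eq_zero ha hε hm hd hw hV
  have hI := hess_ξ_eq_zero ha hε hm hd hw hV
  have t : ∀ s : ℝ, ∀ i : Fin 3, i ≠ 2 → totDir i ![0, 0, ![0, 0, s]] = (Pi.single i 1, 0) := by
    intro s i hi
    refine Prod.ext rfl ?_
    ext α
    fin_cases α <;> fin_cases i <;> simp [totDir] at hi ⊢
  have kr := fun s => determining_re ha hm hV P ![0, 0, ![0, 0, s]]
  have ki := fun s => determining_im ha hm hV P ![0, 0, ![0, 0, s]]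
  simp [t, pr1, D0_eq, Fin.sum_univ_three, P.dep_ξ, dI, hI, P.u_φ, P.v_φ, eqRe, eqIm] at kr ki
  have r0 := kr 0
  have r1 := kr 1
  have i0 := ki 0
  have i1 := ki 1
  simp only [zero_mul, one_mul, mul_zero, mul_one] at r0 r1 i0 i1
  have hmw : p.m * p.w ≠ 0 := mul_ne_zero hm hw
  constructor
  · refine mul_left_cancel₀ hmw ?_
    linarith
  · refine mul_left_cancel₀ hmw ?_
    linarith

/-- The components of `∂_ψ` in `V` are affine in `ψ`, with slope independent of `x` and `y`. -/
theorem hess_ψ_eq_zero {p : Params} (ha : p.a ≠ 0) (hε : p.ε₀ ≠ 0) (hm : p.m ≠ 0)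
    (hd : p.d ≠ 0) (hw : p.w ≠ 0) {V : Jet0 → Jet0} (hV : IsLieSymmetry p V)
    (q : Jet0) (s₀ s₁ : ℝ) :
    (hess (fun q => (V q).2 0) q (0, ![s₀, s₁, 0]) (0, ![s₀, s₁, 0]) = 0 ∧
      hess (fun q => (V q).2 0) q (Pi.single 0 1, 0) (0, ![s₀, s₁, 0]) = 0 ∧
      hess (fun q => (V q).2 0) q (Pi.single 1 1, 0) (0, ![s₀, s₁, 0]) = 0) ∧
    hess (fun q => (V q).2 1) q (0, ![s₀, s₁, 0]) (0, ![s₀, s₁, 0]) = 0 ∧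
      hess (fun q => (V q).2 1) q (Pi.single 0 1, 0) (0, ![s₀, s₁, 0]) = 0 ∧
      hess (fun q => (V q).2 1) q (Pi.single 1 1, 0) (0, ![s₀, s₁, 0]) = 0 := by
  have P := principalRelations ha hε hm hV q
  have dI := dInd_ξ_eq_zero ha hε hm hd hw hV
  have hI := hess_ξ_eq_zero ha hε hm hd hw hV
  have hVs := hV.1
  have hx : ∀ r : ℝ, totDir 0 ![![r * s₀, 0, 0], ![r * s₁, 0, 0], 0]
      = (Pi.single 0 1, 0) + r • (0, ![s₀, s₁, 0]) ∧
      totDir 1 ![![r * s₀, 0, 0], ![r * s₁, 0, 0], 0] = (Pi.single 1 1, 0) := by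
    intro r
    constructor <;>
    · refine Prod.ext (by simp [totDir]) ?_
      ext α
      fin_cases α <;> simp [totDir]
  have hy : ∀ r : ℝ, totDir 1 ![![0, r * s₀, 0], ![0, r * s₁, 0], 0]
      = (Pi.single 1 1, 0) + r • (0, ![s₀, s₁, 0]) ∧
      totDir 0 ![![0, r * s₀, 0], ![0, r * s₁, 0], 0] = (Pi.single 0 1, 0) := by
    intro r
    constructor <;>
    · refine Prod.ext (by simp [totDir]) ?_
      ext α
      fin_cases α <;> simp [totDir]
  have hη : ∀ α, ContDiff ℝ ∞ (fun q => (V q).2 α) := fun α => by fun_prop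
  have xr := fun r => determining_re ha hm hV P ![![r * s₀, 0, 0], ![r * s₁, 0, 0], 0]
  have xi := fun r => determining_im ha hm hV P ![![r * s₀, 0, 0], ![r * s₁, 0, 0], 0]
  have yr := fun r => determining_re ha hm hV P ![![0, r * s₀, 0], ![0, r * s₁, 0], 0]
  have yi := fun r => determining_im ha hm hV P ![![0, r * s₀, 0], ![0, r * s₁, 0], 0]
  simp only [(hx _).1, (hx _).2, hess_add_self (hη _), hess_smul_left, hess_smul_right] at xr xi
  simp only [(hy _).1, (hy _).2, hess_add_self (hη _), hess_smul_left, hess_smul_right] at yr yi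
  simp [pr1, D0_eq, Fin.sum_univ_three, P.dep_ξ, dI, hI, P.φ_u, P.φ_v, eqRe, eqIm]
    at xr xi yr yi
  -- The conditions are quadratic in `r`. The values `0, 1, -1` isolate the coefficient of `r²`, the
  -- Hessian in the `ψ` directions; the odd part is the mixed derivative with `x`, and likewise with
  -- `y` below.
  have xr0 := xr 0
  have xr1 := xr 1
  have xr2 := xr (-1)
  have xi0 := xi 0
  have xi1 := xi 1
  have xi2 := xi (-1)
  have yr0 := yr 1
  have yr1 := yr (-1)
  have yi0 := yi 1
  have yi1 := yi (-1)
  norm_num at xr0 xr1 xr2 xi0 xi1 xi2 yr0 yr1 yi0 yi1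
  refine ⟨⟨?_, ?_, ?_⟩, ?_, ?_, ?_⟩
  · exact (mul_eq_zero.1 (by linarith : p.a * _ = 0)).resolve_left ha
  · exact (mul_eq_zero.1 (by linarith : p.a * _ = 0)).resolve_left ha
  · exact (mul_eq_zero.1 (by linarith : p.ε₀ * _ = 0)).resolve_left hε
  · exact (mul_eq_zero.1 (by linarith : p.a * _ = 0)).resolve_left ha
  · exact (mul_eq_zero.1 (by linarith : p.a * _ = 0)).resolve_left ha
  · exact (mul_eq_zero.1 (by linarith : p.ε₀ * _ = 0)).resolve_left hε

theorem hess_ψ_single_eq_zero {p : Params} (ha : p.a ≠ 0) (hε : p.ε₀ ≠ 0) (hm : p.m ≠ 0)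
    (hd : p.d ≠ 0) (hw : p.w ≠ 0) {V : Jet0 → Jet0} (hV : IsLieSymmetry p V)
    (α β : Fin 3) (hα : α ≠ 2) (hβ : β ≠ 2) (q : Jet0) :
    dInd (fun q => dDep (fun q => (V q).2 α) q β) q 0 = 0 ∧
    dInd (fun q => dDep (fun q => (V q).2 α) q β) q 1 = 0 ∧
    ∀ γ, dDep (fun q => dDep (fun q => (V q).2 α) q β) q γ = 0 := by
  have P := principalRelations ha hε hm hV
  have H := hess_ψ_eq_zero ha hε hm hd hw hV q
  have hVs := hV.1
  have hη : ContDiff ℝ ∞ (fun q => (V q).2 α) := by fun_prop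
  have hself : ∀ s₀ s₁ : ℝ, hess (fun q => (V q).2 α) q (0, ![s₀, s₁, 0]) (0, ![s₀, s₁, 0]) = 0 ∧
      hess (fun q => (V q).2 α) q (Pi.single 0 1, 0) (0, ![s₀, s₁, 0]) = 0 ∧
      hess (fun q => (V q).2 α) q (Pi.single 1 1, 0) (0, ![s₀, s₁, 0]) = 0 := by
    intro s₀ s₁
    fin_cases α
    · exact (H s₀ s₁).1
    · exact (H s₀ s₁).2
    · simp at hα
  have e0 : (Pi.single 0 1 : Fin 3 → ℝ) = ![1, 0, 0] := by ext i; fin_cases i <;> rfl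
  have e1 : (Pi.single 1 1 : Fin 3 → ℝ) = ![0, 1, 0] := by ext i; fin_cases i <;> rfl
  have hc : ∀ v, fderiv ℝ (fun q => dDep (fun q => (V q).2 α) q β) q v
      = hess (fun q => (V q).2 α) q v (0, Pi.single β 1) := fun v => (hess_eq_fderiv hη q v _).symm
  -- Polarisation of the quadratic form that vanishes on all `(s₀, s₁)`.
  have h01 : hess (fun q => (V q).2 α) q (0, ![1, 0, 0]) (0, ![0, 1, 0]) = 0 := by
    have h1 := (hself 1 1).1
    have : ((0, ![1, 1, 0]) : Jet0) = (0, ![1, 0, 0]) + (0, ![0, 1, 0]) := by simp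
    rw [this, hess_add_self hη, (hself 1 0).1, (hself 0 1).1] at h1
    linarith
  have hφ : hess (fun q => (V q).2 α) q (0, Pi.single β 1) (0, Pi.single 2 1) = 0 := by
    refine hess_eq_zero_right hη (fun q => ?_) q _
    fin_cases α
    · exact (P q).u_φ
    · exact (P q).v_φ
    · simp at hα
  have hβ' : β = 0 ∨ β = 1 := by
    fin_cases β <;> simp at hβ ⊢
  refine ⟨?_, ?_, fun γ => ?_⟩
  · rw [dInd, hc]
    rcases hβ' with rfl | rfl
    · rw [e0]; exact e0 ▸ (hself 1 0).2.1
    · rw [e1]; exact (hself 0 1).2.1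
  · rw [dInd, hc]
    rcases hβ' with rfl | rfl
    · rw [e0]; exact (hself 1 0).2.2
    · rw [e1]; exact e1 ▸ (hself 0 1).2.2
  · rw [dDep, hc]
    rcases hβ' with rfl | rfl <;> fin_cases γ
    · simp only [e0, Fin.zero_eta]; exact (hself 1 0).1
    · rw [hess_comm hη]; simp only [e0, e1, Fin.mk_one]; exact h01
    · rw [hess_comm hη]; exact hφ
    · simp only [e0, e1, Fin.zero_eta]; exact h01
    · simp only [e1, Fin.mk_one]; exact (hself 0 1).1
    · rw [hess_comm hη]; exact hφ

/-- Differentiating the first of the `euler_relations` with respect to `u` reproduces `U_u` on both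
sides, where `U` is the `u`-component; all second derivatives involved vanish, so only `-∂_φ` of the
`φ`-component remains. -/
theorem dDep_φ_eq_zero {p : Params} (ha : p.a ≠ 0) (hε : p.ε₀ ≠ 0) (hm : p.m ≠ 0)
    (hd : p.d ≠ 0) (hw : p.w ≠ 0) {V : Jet0 → Jet0} (hV : IsLieSymmetry p V) (q : Jet0)
    (α : Fin 3) : dDep (fun q => (V q).2 2) q α = 0 := by
  have P := principalRelations ha hε hm hV
  have hVs := hV.1
  have hη : ∀ α, ContDiff ℝ ∞ (fun q => (V q).2 α) := fun α => by fun_prop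
  have h2 : dDep (fun q => (V q).2 2) q 2 = 0 := by
    have hE : (fun q => (V q).2 0) = fun q => q.2 0 * (dDep (fun q => (V q).2 0) q 0
        - dDep (fun q => (V q).2 2) q 2) + q.2 1 * dDep (fun q => (V q).2 0) q 1 := by
      funext q
      rw [(euler_relations ha hε hm hd hw hV q).1]
      ring
    have hc : ∀ β, HasFDerivAt (fun q : Jet0 => q.2 β) ((ContinuousLinearMap.proj β).comp
        (ContinuousLinearMap.snd ℝ (Fin 3 → ℝ) (Fin 3 → ℝ))) q := fun β =>
      ContinuousLinearMap.hasFDerivAt (𝕜 := ℝ) ((ContinuousLinearMap.proj β).comp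
        (ContinuousLinearMap.snd ℝ (Fin 3 → ℝ) (Fin 3 → ℝ)))
    have hD : ∀ α β, HasFDerivAt (fun q => dDep (fun q => (V q).2 α) q β)
        (fderiv ℝ (fun q => dDep (fun q => (V q).2 α) q β) q) q := fun α β =>
      ((contDiff_dDep (hη α) β).differentiable (by simp) q).hasFDerivAt
    have hF := (((hc 0).fun_mul ((hD 0 0).fun_sub (hD 2 2))).fun_add
      ((hc 1).fun_mul (hD 0 1))).fderiv
    have hU : dDep (fun q => (V q).2 0) q 0 = _ := congrArg (fun f => dDep f q 0) hE
    have z0 : fderiv ℝ (fun q => dDep (fun q => (V q).2 0) q 0) q (0, Pi.single 0 1) = 0 :=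
      (hess_ψ_single_eq_zero ha hε hm hd hw hV 0 0 (by decide) (by decide) q).2.2 0
    have z1 : fderiv ℝ (fun q => dDep (fun q => (V q).2 0) q 1) q (0, Pi.single 0 1) = 0 :=
      (hess_ψ_single_eq_zero ha hε hm hd hw hV 0 1 (by decide) (by decide) q).2.2 0
    have z2 : fderiv ℝ (fun q => dDep (fun q => (V q).2 2) q 2) q (0, Pi.single 0 1) = 0 := by
      have : hess (fun q => (V q).2 2) q (0, Pi.single 2 1) (0, Pi.single 0 1) = 0 :=
        hess_eq_zero_right (hη 2) (fun q => (P q).φ_u) q _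
      rw [hess_comm (hη 2), hess_eq_fderiv (hη 2)] at this
      exact this
    have hR : ∀ f : Jet0 → ℝ, dDep f q 0 = fderiv ℝ f q (0, Pi.single 0 1) := fun f => rfl
    rw [hR (fun q => q.2 0 * _ + _), hF] at hU
    simp [z0, z1, z2] at hU
    linarith
  fin_cases α
  · exact (P q).φ_u
  · exact (P q).φ_v
  · exact h2

/-! ### Invariance conditions for fields with constant base part. -/

/-- The vector field with constant components `ξ` in the independent variables, acting on `ψ` by
multiplication with `χ(t) + i θ(t)` and on `φ` by translation with `h(x, y, t)`. -/
def gaugeField (ξ : Fin 3 → ℝ) (χ θ : ℝ → ℝ) (h : (Fin 3 → ℝ) → ℝ) (q : Jet0) : Jet0 :=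
  (ξ, ![χ (q.1 2) * q.2 0 - θ (q.1 2) * q.2 1, θ (q.1 2) * q.2 0 + χ (q.1 2) * q.2 1, h q.1])

/-- With `dDep_φ_eq_zero`, the `euler_relations` say that the `ψ`-components equal their own linear
parts; the coefficients depend on `t` alone by `hess_ψ_single_eq_zero`, and `cauchyRiemann` makes
the matrix a complex number. -/
theorem exists_eq_gaugeField {p : Params} (ha : p.a ≠ 0) (hε : p.ε₀ ≠ 0) (hm : p.m ≠ 0)
    (hd : p.d ≠ 0) (hw : p.w ≠ 0) {V : Jet0 → Jet0} (hV : IsLieSymmetry p V) :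
    ∃ ξ χ θ h, ContDiff ℝ ∞ χ ∧ ContDiff ℝ ∞ θ ∧ ContDiff ℝ ∞ h ∧ V = gaugeField ξ χ θ h := by
  have hVs := hV.1
  have hη : ∀ α, ContDiff ℝ ∞ (fun q => (V q).2 α) := fun α => by fun_prop
  have hξ : ∀ k, ContDiff ℝ ∞ (fun q => (V q).1 k) := fun k => by fun_prop
  have hl : ContDiff ℝ ∞ (fun s : ℝ => ((Pi.single 2 s, 0) : Jet0)) := by
    refine ContDiff.prodMk ?_ contDiff_const
    exact (ContinuousLinearMap.single ℝ (fun _ : Fin 3 => ℝ) 2).contDiff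
  have ht : ∀ α β : Fin 3, α ≠ 2 → β ≠ 2 → ∀ q, dDep (fun q => (V q).2 α) q β
      = dDep (fun q => (V q).2 α) (Pi.single 2 (q.1 2), 0) β := by
    intro α β hα hβ
    have H := hess_ψ_single_eq_zero ha hε hm hd hw hV α β hα hβ
    exact eq_apply_time ((contDiff_dDep (hη α) β).differentiable (by simp))
      (fun q => (H q).1) (fun q => (H q).2.1) (fun q => (H q).2.2)
  refine ⟨(V 0).1, fun s => dDep (fun q => (V q).2 0) (Pi.single 2 s, 0) 0,
    fun s => dDep (fun q => (V q).2 1) (Pi.single 2 s, 0) 0, fun x => (V (x, 0)).2 2,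
    (contDiff_dDep (hη 0) 0).comp hl, (contDiff_dDep (hη 1) 0).comp hl,
    (hη 2).comp (contDiff_id.prodMk contDiff_const), ?_⟩
  funext q
  have CR := cauchyRiemann ha hε hm hV q
  have E := euler_relations ha hε hm hd hw hV q
  rw [dDep_φ_eq_zero ha hε hm hd hw hV, CR.1, CR.2.1] at E
  refine Prod.ext ?_ ?_
  · funext k
    exact is_const_of_fderiv_eq_zero ((hξ k).differentiable (by simp))
      (fderiv_ξ_eq_zero ha hε hm hd hw hV k) q 0
  · have h1 := ht 0 0 (by decide) (by decide) q
    have h2 := ht 1 0 (by decide) (by decide) q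
    funext α
    fin_cases α
    · simp only [gaugeField, ← h1, ← h2, CR.2.1]
      simp
      linarith [E.1]
    · simp only [gaugeField, ← h1, ← h2, CR.2.1]
      simp
      linarith [E.2]
    · exact eq_apply_independent ((hη 2).differentiable (by simp))
        (dDep_φ_eq_zero ha hε hm hd hw hV) q

/-- The second derivative of a function of the independent variables. -/
def indHess (h : (Fin 3 → ℝ) → ℝ) (x v w : Fin 3 → ℝ) : ℝ := fderiv ℝ (fderiv ℝ h) x v w

theorem contDiff_gaugeField (ξ : Fin 3 → ℝ) {χ θ : ℝ → ℝ} {h : (Fin 3 → ℝ) → ℝ}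
    (hχ : ContDiff ℝ ∞ χ) (hθ : ContDiff ℝ ∞ θ) (hh : ContDiff ℝ ∞ h) :
    ContDiff ℝ ∞ (gaugeField ξ χ θ h) := by
  unfold gaugeField
  refine contDiff_const.prodMk (contDiff_pi.2 fun α => ?_)
  fin_cases α
  · simp
    fun_prop
  · simp
    fun_prop
  · simp
    fun_prop

theorem pr1_gaugeField_const (ξ : Fin 3 → ℝ) (χ θ : ℝ → ℝ) (h : (Fin 3 → ℝ) → ℝ)
    (α i : Fin 3) (z : Jet1) :
    pr1 (gaugeField ξ χ θ h) α i z = D0 i (fun q => (gaugeField ξ χ θ h q).2 α) z := by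
  simp [pr1, gaugeField, D0]

theorem fderiv_mul_dep {θ : ℝ → ℝ} (hθ : Differentiable ℝ θ) (α : Fin 3) (q v : Jet0) :
    fderiv ℝ (fun q : Jet0 => θ (q.1 2) * q.2 α) q v
      = v.1 2 * deriv θ (q.1 2) * q.2 α + θ (q.1 2) * v.2 α := by
  have hc : HasFDerivAt (fun q : Jet0 => q.2 α) ((ContinuousLinearMap.proj α).comp
      (ContinuousLinearMap.snd ℝ (Fin 3 → ℝ) (Fin 3 → ℝ))) q :=
    ContinuousLinearMap.hasFDerivAt (𝕜 := ℝ) ((ContinuousLinearMap.proj α).comp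
      (ContinuousLinearMap.snd ℝ (Fin 3 → ℝ) (Fin 3 → ℝ)))
  have ht : HasFDerivAt (fun q : Jet0 => q.1 2) ((ContinuousLinearMap.proj 2).comp
      (ContinuousLinearMap.fst ℝ (Fin 3 → ℝ) (Fin 3 → ℝ))) q :=
    ContinuousLinearMap.hasFDerivAt (𝕜 := ℝ) ((ContinuousLinearMap.proj 2).comp
      (ContinuousLinearMap.fst ℝ (Fin 3 → ℝ) (Fin 3 → ℝ)))
  have hd := (((hθ (q.1 2)).hasDerivAt.comp_hasFDerivAt q ht).fun_mul hc).fderiv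
  simp only [Function.comp_def] at hd
  rw [hd]
  simp
  ring

/-- Total derivative of a function of `t` times a dependent variable. -/
theorem D0_mul_dep {χ : ℝ → ℝ} (hχ : Differentiable ℝ χ) (α i : Fin 3) (z : Jet1) :
    D0 i (fun q => χ (q.1 2) * q.2 α) z
      = (Pi.single i 1 : Fin 3 → ℝ) 2 * deriv χ (z.1.1 2) * z.1.2 α + χ (z.1.1 2) * z.2 α i :=
  fderiv_mul_dep hχ α z.1 _

theorem D0_indep {h : (Fin 3 → ℝ) → ℝ} (hh : Differentiable ℝ h) (i : Fin 3) (z : Jet1) :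
    D0 i (fun q => h q.1) z = fderiv ℝ h z.1.1 (Pi.single i 1) := by
  have hd := ((hh z.1.1).hasFDerivAt.comp z.1 (hasFDerivAt_fst (𝕜 := ℝ) (p := z.1))).fderiv
  simp only [Function.comp_def] at hd
  rw [D0, hd]
  simp

/-- Total derivative of a function of `t` times a first order coordinate, except in direction `t`.-/
theorem D1_mul_dep {χ : ℝ → ℝ} (hχ : Differentiable ℝ χ) (α i j : Fin 3) (hj : j ≠ 2) (z : Jet2) :
    D1 j (fun y => χ (y.1.1 2) * y.2 α i) z = χ (z.1.1.1 2) * z.2 α i j := by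
  have hc : HasFDerivAt (fun y : Jet1 => y.2 α i) (((ContinuousLinearMap.proj i).comp
          (ContinuousLinearMap.proj (R := ℝ) (φ := fun _ : Fin 3 => Fin 3 → ℝ) α)).comp
            (ContinuousLinearMap.snd ℝ Jet0 (Fin 3 → Fin 3 → ℝ))) z.1 :=
    ContinuousLinearMap.hasFDerivAt (𝕜 := ℝ) (((ContinuousLinearMap.proj i).comp
          (ContinuousLinearMap.proj (R := ℝ) (φ := fun _ : Fin 3 => Fin 3 → ℝ) α)).comp
            (ContinuousLinearMap.snd ℝ Jet0 (Fin 3 → Fin 3 → ℝ)))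
  have ht : HasFDerivAt (fun y : Jet1 => y.1.1 2) (((ContinuousLinearMap.proj 2).comp
      (ContinuousLinearMap.fst ℝ (Fin 3 → ℝ) (Fin 3 → ℝ))).comp
        (ContinuousLinearMap.fst ℝ Jet0 (Fin 3 → Fin 3 → ℝ))) z.1 :=
    ContinuousLinearMap.hasFDerivAt (𝕜 := ℝ) (((ContinuousLinearMap.proj 2).comp
      (ContinuousLinearMap.fst ℝ (Fin 3 → ℝ) (Fin 3 → ℝ))).comp
        (ContinuousLinearMap.fst ℝ Jet0 (Fin 3 → Fin 3 → ℝ)))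
  have hd := (((hχ (z.1.1.1 2)).hasDerivAt.comp_hasFDerivAt z.1 ht).fun_mul hc).fderiv
  simp only [Function.comp_def] at hd
  rw [D1, hd]
  simp [hj.symm]

theorem fderiv_fderiv_apply {E : Type*} [NormedAddCommGroup E] [NormedSpace ℝ E] {h : E → ℝ}
    (hh : ContDiff ℝ ∞ h) (x v w : E) :
    fderiv ℝ (fun x => fderiv ℝ h x w) x v = fderiv ℝ (fderiv ℝ h) x v w := by
  have hd : DifferentiableAt ℝ (fderiv ℝ h) x :=
    (hh.fderiv_right (m := ∞) (by simp)).differentiable (by simp) x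
  rw [fderiv_clm_apply hd (differentiableAt_const w)]
  simp

theorem D1_indep {h : (Fin 3 → ℝ) → ℝ} (hh : ContDiff ℝ ∞ h) (i j : Fin 3) (z : Jet2) :
    D1 j (fun y => fderiv ℝ h y.1.1 (Pi.single i 1)) z
      = indHess h z.1.1.1 (Pi.single j 1) (Pi.single i 1) := by
  have hd : DifferentiableAt ℝ (fun x => fderiv ℝ h x (Pi.single i 1)) z.1.1.1 :=
    ((hh.fderiv_right (m := ∞) (by simp)).clm_apply contDiff_const).differentiable (by simp) _
  have hd := (hd.hasFDerivAt.comp z.1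
    ((hasFDerivAt_fst (𝕜 := ℝ)).comp z.1 (hasFDerivAt_fst (𝕜 := ℝ)))).fderiv
  simp only [Function.comp_def] at hd
  rw [D1, hd, indHess, ← fderiv_fderiv_apply hh]
  simp

theorem pr1_gaugeField_zero {ξ : Fin 3 → ℝ} {χ θ : ℝ → ℝ} {h : (Fin 3 → ℝ) → ℝ}
    (hχ : ContDiff ℝ ∞ χ) (hθ : ContDiff ℝ ∞ θ) (i : Fin 3) (z : Jet1) :
    pr1 (gaugeField ξ χ θ h) 0 i z =
    (Pi.single i 1 : Fin 3 → ℝ) 2 * (deriv χ (z.1.1 2) * z.1.2 0 - deriv θ (z.1.1 2) * z.1.2 1)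
      + (χ (z.1.1 2) * z.2 0 i - θ (z.1.1 2) * z.2 1 i) := by
  have dχ := hχ.differentiable (by simp)
  have dθ := hθ.differentiable (by simp)
  rw [pr1_gaugeField_const]
  have := D0_add i (f := fun q => χ (q.1 2) * q.2 0) (g := fun q => -1 * (θ (q.1 2) * q.2 1))
    (by fun_prop) (by fun_prop) z
  rw [D0_const_mul i (by fun_prop), D0_mul_dep dχ, D0_mul_dep dθ] at this
  simp only [gaugeField, Matrix.cons_val_zero, sub_eq_add_neg, ← neg_one_mul (θ _ * _)]
  rw [this]
  ring

theorem pr1_gaugeField_one {ξ : Fin 3 → ℝ} {χ θ : ℝ → ℝ} {h : (Fin 3 → ℝ) → ℝ}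
    (hχ : ContDiff ℝ ∞ χ) (hθ : ContDiff ℝ ∞ θ) (i : Fin 3) (z : Jet1) :
    pr1 (gaugeField ξ χ θ h) 1 i z =
    (Pi.single i 1 : Fin 3 → ℝ) 2 * (deriv θ (z.1.1 2) * z.1.2 0 + deriv χ (z.1.1 2) * z.1.2 1)
      + (θ (z.1.1 2) * z.2 0 i + χ (z.1.1 2) * z.2 1 i) := by
  have dχ := hχ.differentiable (by simp)
  have dθ := hθ.differentiable (by simp)
  rw [pr1_gaugeField_const]
  have := D0_add i (f := fun q => θ (q.1 2) * q.2 0) (g := fun q => χ (q.1 2) * q.2 1)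
    (by fun_prop) (by fun_prop) z
  rw [D0_mul_dep dχ, D0_mul_dep dθ] at this
  simp only [gaugeField, Matrix.cons_val_one, Matrix.cons_val_zero]
  rw [this]
  ring

theorem pr1_gaugeField_two (ξ : Fin 3 → ℝ) (χ θ : ℝ → ℝ) {h : (Fin 3 → ℝ) → ℝ}
    (hh : ContDiff ℝ ∞ h) (i : Fin 3) (z : Jet1) :
    pr1 (gaugeField ξ χ θ h) 2 i z = fderiv ℝ h z.1.1 (Pi.single i 1) := by
  rw [pr1_gaugeField_const]
  exact D0_indep (hh.differentiable (by simp)) i z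

theorem pr2_gaugeField_const (ξ : Fin 3 → ℝ) (χ θ : ℝ → ℝ) (h : (Fin 3 → ℝ) → ℝ)
    (α i j : Fin 3) (z : Jet2) :
    pr2 (gaugeField ξ χ θ h) α i j z = D1 j (pr1 (gaugeField ξ χ θ h) α i) z := by
  simp [pr2, gaugeField, D0]

theorem pr2_gaugeField_zero {ξ : Fin 3 → ℝ} {χ θ : ℝ → ℝ} {h : (Fin 3 → ℝ) → ℝ}
    (hχ : ContDiff ℝ ∞ χ) (hθ : ContDiff ℝ ∞ θ) (i j : Fin 3) (hi : i ≠ 2) (hj : j ≠ 2)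
    (z : Jet2) : pr2 (gaugeField ξ χ θ h) 0 i j z
      = χ (z.1.1.1 2) * z.2 0 i j - θ (z.1.1.1 2) * z.2 1 i j := by
  have dχ := hχ.differentiable (by simp)
  have dθ := hθ.differentiable (by simp)
  have h1 : pr1 (gaugeField ξ χ θ h) 0 i
      = fun y => χ (y.1.1 2) * y.2 0 i - θ (y.1.1 2) * y.2 1 i := by
    funext y
    rw [pr1_gaugeField_zero hχ hθ]
    simp [hi.symm]
  rw [pr2_gaugeField_const, h1, ← D1_mul_dep dχ 0 i j hj, ← D1_mul_dep dθ 1 i j hj]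
  unfold D1
  rw [fderiv_fun_sub (by fun_prop) (by fun_prop)]
  rfl

theorem pr2_gaugeField_one {ξ : Fin 3 → ℝ} {χ θ : ℝ → ℝ} {h : (Fin 3 → ℝ) → ℝ}
    (hχ : ContDiff ℝ ∞ χ) (hθ : ContDiff ℝ ∞ θ) (i j : Fin 3) (hi : i ≠ 2) (hj : j ≠ 2)
    (z : Jet2) : pr2 (gaugeField ξ χ θ h) 1 i j z
      = θ (z.1.1.1 2) * z.2 0 i j + χ (z.1.1.1 2) * z.2 1 i j := by
  have dχ := hχ.differentiable (by simp)
  have dθ := hθ.differentiable (by simp)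
  have h1 : pr1 (gaugeField ξ χ θ h) 1 i
      = fun y => θ (y.1.1 2) * y.2 0 i + χ (y.1.1 2) * y.2 1 i := by
    funext y
    rw [pr1_gaugeField_one hχ hθ]
    simp [hi.symm]
  rw [pr2_gaugeField_const, h1, ← D1_mul_dep dχ 1 i j hj, ← D1_mul_dep dθ 0 i j hj]
  unfold D1
  rw [fderiv_fun_add (by fun_prop) (by fun_prop)]
  rfl

theorem pr2_gaugeField_two (ξ : Fin 3 → ℝ) (χ θ : ℝ → ℝ) {h : (Fin 3 → ℝ) → ℝ}
    (hh : ContDiff ℝ ∞ h) (i j : Fin 3) (z : Jet2) :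
    pr2 (gaugeField ξ χ θ h) 2 i j z
      = indHess h z.1.1.1 (Pi.single j 1) (Pi.single i 1) := by
  rw [pr2_gaugeField_const, ← D1_indep hh]
  exact congrArg (fun f => D1 j f z) (funext fun y => pr1_gaugeField_two ξ χ θ hh i y)

theorem indHess_comm {h : (Fin 3 → ℝ) → ℝ} (hh : ContDiff ℝ ∞ h) (x v w : Fin 3 → ℝ) :
    indHess h x v w = indHess h x w v :=
  (hh.contDiffAt.isSymmSndFDerivAt (by
    simp only [minSmoothness_of_isRCLikeNormedField]
    exact WithTop.coe_le_coe.2 (le_top : (2 : ℕ∞) ≤ ⊤))) v w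

/-- `m ∂_t + (m c - d) ∂_y` on functions of the independent variables. -/
def transport (p : Params) (h : (Fin 3 → ℝ) → ℝ) (x : Fin 3 → ℝ) : ℝ :=
  dirDeriv p fun i => fderiv ℝ h x (Pi.single i 1)

/-- The left hand side of the second equation on functions of the independent variables. -/
def wave (p : Params) (h : (Fin 3 → ℝ) → ℝ) (x : Fin 3 → ℝ) : ℝ :=
  waveOp p fun i j => indHess h x (Pi.single i 1) (Pi.single j 1)

/-- The linear action of `χ + i θ` reproduces the equations up to this factor. On solution jets only
the derivatives of `χ, θ`, the transport of `h` and the non-homogeneity of the cubic term are left.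
-/
theorem fderiv_eqRe_gaugeField (p : Params) {ξ : Fin 3 → ℝ} {χ θ : ℝ → ℝ} {h : (Fin 3 → ℝ) → ℝ}
    (hχ : ContDiff ℝ ∞ χ) (hθ : ContDiff ℝ ∞ θ) (hh : ContDiff ℝ ∞ h) (z : Jet2) :
    fderiv ℝ (eqRe p) z (prolong (gaugeField ξ χ θ h) z) =
      χ (z.1.1.1 2) * eqRe p z - θ (z.1.1.1 2) * eqIm p z - deriv χ (z.1.1.1 2) * z.1.1.2 1
      + z.1.1.2 0 * (p.w * transport p h z.1.1.1 - deriv θ (z.1.1.1 2)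
        - 2 * (p.b - p.w * p.m) * χ (z.1.1.1 2) * (z.1.1.2 0 ^ 2 + z.1.1.2 1 ^ 2)) := by
  rw [fderiv_eqRe]
  simp only [prolong, pr1_gaugeField_one hχ hθ, pr1_gaugeField_two ξ χ θ hh,
    pr2_gaugeField_zero hχ hθ 0 0 (by decide) (by decide),
    pr2_gaugeField_zero hχ hθ 1 1 (by decide) (by decide)]
  simp [gaugeField, eqRe, eqIm, transport, dirDeriv]
  ring

theorem fderiv_eqIm_gaugeField (p : Params) {ξ : Fin 3 → ℝ} {χ θ : ℝ → ℝ} {h : (Fin 3 → ℝ) → ℝ}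
    (hχ : ContDiff ℝ ∞ χ) (hθ : ContDiff ℝ ∞ θ) (hh : ContDiff ℝ ∞ h) (z : Jet2) :
    fderiv ℝ (eqIm p) z (prolong (gaugeField ξ χ θ h) z) =
      θ (z.1.1.1 2) * eqRe p z + χ (z.1.1.1 2) * eqIm p z + deriv χ (z.1.1.1 2) * z.1.1.2 0
      + z.1.1.2 1 * (p.w * transport p h z.1.1.1 - deriv θ (z.1.1.1 2)
        - 2 * (p.b - p.w * p.m) * χ (z.1.1.1 2) * (z.1.1.2 0 ^ 2 + z.1.1.2 1 ^ 2)) := by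
  rw [fderiv_eqIm]
  simp only [prolong, pr1_gaugeField_zero hχ hθ, pr1_gaugeField_two ξ χ θ hh,
    pr2_gaugeField_one hχ hθ 0 0 (by decide) (by decide),
    pr2_gaugeField_one hχ hθ 1 1 (by decide) (by decide)]
  simp [gaugeField, eqRe, eqIm, transport, dirDeriv]
  ring

theorem fderiv_eqB_gaugeField (p : Params) {ξ : Fin 3 → ℝ} {χ θ : ℝ → ℝ} {h : (Fin 3 → ℝ) → ℝ}
    (hχ : ContDiff ℝ ∞ χ) (hθ : ContDiff ℝ ∞ θ) (hh : ContDiff ℝ ∞ h) (z : Jet2) :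
    fderiv ℝ (eqB p) z (prolong (gaugeField ξ χ θ h) z) = wave p h z.1.1.1
      - 2 * p.m * deriv χ (z.1.1.1 2) * (z.1.1.2 0 ^ 2 + z.1.1.2 1 ^ 2)
      - 4 * χ (z.1.1.1 2) * (p.m * (z.1.1.2 0 * z.1.2 0 2 + z.1.1.2 1 * z.1.2 1 2)
        + (p.m * p.c - p.d) * (z.1.1.2 0 * z.1.2 0 1 + z.1.1.2 1 * z.1.2 1 1)) := by
  rw [fderiv_eqB]
  simp only [prolong, pr1_gaugeField_zero hχ hθ, pr1_gaugeField_one hχ hθ,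
    pr2_gaugeField_two ξ χ θ hh]
  rw [indHess_comm hh z.1.1.1 (Pi.single 2 1) (Pi.single 1 1)]
  simp [gaugeField, wave, waveOp]
  ring

theorem isLieSymmetry_gaugeField {p : Params} {ξ : Fin 3 → ℝ} {θ : ℝ → ℝ}
    {h : (Fin 3 → ℝ) → ℝ} (hθ : ContDiff ℝ ∞ θ) (hh : ContDiff ℝ ∞ h)
    (h1 : ∀ x, p.w * transport p h x = deriv θ (x 2)) (h2 : ∀ x, wave p h x = 0) :
    IsLieSymmetry p (gaugeField ξ 0 θ h) := by
  have h0 : ContDiff ℝ ∞ (0 : ℝ → ℝ) := contDiff_const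
  refine (isLieSymmetry_iff p _).2 ⟨contDiff_gaugeField ξ h0 hθ hh, fun z _ hr hi _ => ?_⟩
  refine ⟨?_, ?_, ?_⟩
  · rw [fderiv_eqRe_gaugeField p h0 hθ hh, h1, hr, hi]
    simp
  · rw [fderiv_eqIm_gaugeField p h0 hθ hh, h1, hr, hi]
    simp
  · rw [fderiv_eqB_gaugeField p h0 hθ hh, h2]
    simp

theorem eq_zero_of_isLieSymmetry_gaugeField {p : Params} (ha : p.a ≠ 0) (hm : p.m ≠ 0)
    {ξ : Fin 3 → ℝ} {χ θ : ℝ → ℝ} {h : (Fin 3 → ℝ) → ℝ} (hχ : ContDiff ℝ ∞ χ)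
    (hθ : ContDiff ℝ ∞ θ) (hh : ContDiff ℝ ∞ h) (hV : IsLieSymmetry p (gaugeField ξ χ θ h)) :
    χ = 0 ∧ (∀ x, p.w * transport p h x = deriv θ (x 2)) ∧ ∀ x, wave p h x = 0 := by
  have key : ∀ z : Jet1, _ := fun z => invariant_solJet ha hm hV z
  have e := fun z : Jet1 => solJet_spec p ha hm z
  have hw : ∀ x, wave p h x = 0 := by
    intro x
    have := (key ((x, 0), 0)).2.2
    rw [fderiv_eqB_gaugeField p hχ hθ hh] at this
    simpa using this
  -- At `u = 1`, `v = 0` the imaginary equation retains only `χ'`.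
  have hχ' : ∀ x : Fin 3 → ℝ, deriv χ (x 2) = 0 := by
    intro x
    have := (key ((x, ![1, 0, 0]), 0)).2.1
    rw [fderiv_eqIm_gaugeField p hχ hθ hh, (e _).2.1, (e _).2.2.1] at this
    simpa using this
  -- Setting `u_t = 1` as well exposes `-4 m χ`: rescaling `ψ` changes the source `|ψ|²`, and no
  -- rescaling of `φ` is available to compensate.
  have hχ0 : ∀ x : Fin 3 → ℝ, χ (x 2) = 0 := by
    intro x
    have := (key ((x, ![1, 0, 0]), ![![0, 0, 1], 0, 0])).2.2
    rw [fderiv_eqB_gaugeField p hχ hθ hh, hw, hχ'] at this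
    simpa [hm] using this
  refine ⟨funext fun s => hχ0 (fun _ => s), fun x => ?_, hw⟩
  have := (key ((x, ![1, 0, 0]), 0)).1
  rw [fderiv_eqRe_gaugeField p hχ hθ hh, (e _).2.1, (e _).2.2.1] at this
  simp [hχ0] at this
  linarith

theorem isLieSymmetry_iff_gaugeField {p : Params} (ha : p.a ≠ 0) (hε : p.ε₀ ≠ 0) (hm : p.m ≠ 0)
    (hd : p.d ≠ 0) (hw : p.w ≠ 0) (V : Jet0 → Jet0) : IsLieSymmetry p V ↔
    ∃ ξ θ h, ContDiff ℝ ∞ θ ∧ ContDiff ℝ ∞ h ∧ (∀ x, p.w * transport p h x = deriv θ (x 2)) ∧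
      (∀ x, wave p h x = 0) ∧ V = gaugeField ξ 0 θ h := by
  constructor
  · intro hV
    obtain ⟨ξ, χ, θ, h, hχ, hθ, hh, rfl⟩ := exists_eq_gaugeField ha hε hm hd hw hV
    obtain ⟨rfl, h1, h2⟩ := eq_zero_of_isLieSymmetry_gaugeField ha hm hχ hθ hh hV
    exact ⟨ξ, θ, h, hθ, hh, h1, h2, rfl⟩
  · rintro ⟨ξ, θ, h, hθ, hh, h1, h2, rfl⟩
    exact isLieSymmetry_gaugeField hθ hh h1 h2

/-! ### The transport and wave equations for the shift of `φ`. -/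

/-- The direction of the transport operator `m ∂_t + (m c - d) ∂_y`. -/
def flowDir (p : Params) : Fin 3 → ℝ := ![0, p.m * p.c - p.d, p.m]

theorem eq_sum_single (v : Fin 3 → ℝ) :
    v = v 0 • Pi.single 0 1 + v 1 • Pi.single 1 1 + v 2 • Pi.single 2 1 := by
  ext i
  fin_cases i <;> simp

theorem transport_eq (p : Params) (h : (Fin 3 → ℝ) → ℝ) (x : Fin 3 → ℝ) :
    transport p h x = fderiv ℝ h x (flowDir p) := by
  rw [eq_sum_single (flowDir p)]
  simp only [map_add, map_smul, transport, dirDeriv, flowDir]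
  simp
  ring

theorem differentiable_fderiv {E : Type*} [NormedAddCommGroup E] [NormedSpace ℝ E] {h : E → ℝ}
    (hh : ContDiff ℝ ∞ h) : Differentiable ℝ (fderiv ℝ h) :=
  (hh.fderiv_right (m := ∞) (by simp)).differentiable (by simp)

theorem indHess_add {f g : (Fin 3 → ℝ) → ℝ} (hf : ContDiff ℝ ∞ f) (hg : ContDiff ℝ ∞ g)
    (x v w : Fin 3 → ℝ) :
    indHess (fun x => f x + g x) x v w = indHess f x v w + indHess g x v w := by
  have h1 : fderiv ℝ (fun x => f x + g x) = fun x => fderiv ℝ f x + fderiv ℝ g x :=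
    funext fun x => fderiv_fun_add (hf.differentiable (by simp) x) (hg.differentiable (by simp) x)
  rw [indHess, h1, fderiv_fun_add (differentiable_fderiv hf x) (differentiable_fderiv hg x)]
  rfl

theorem indHess_sub {f g : (Fin 3 → ℝ) → ℝ} (hf : ContDiff ℝ ∞ f) (hg : ContDiff ℝ ∞ g)
    (x v w : Fin 3 → ℝ) :
    indHess (fun x => f x - g x) x v w = indHess f x v w - indHess g x v w := by
  have h1 : fderiv ℝ (fun x => f x - g x) = fun x => fderiv ℝ f x - fderiv ℝ g x :=
    funext fun x => fderiv_fun_sub (hf.differentiable (by simp) x) (hg.differentiable (by simp) x)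
  rw [indHess, h1, fderiv_fun_sub (differentiable_fderiv hf x) (differentiable_fderiv hg x)]
  rfl

theorem transport_add (p : Params) {f g : (Fin 3 → ℝ) → ℝ} (hf : ContDiff ℝ ∞ f)
    (hg : ContDiff ℝ ∞ g) (x : Fin 3 → ℝ) :
    transport p (fun x => f x + g x) x = transport p f x + transport p g x := by
  simp [transport_eq, fderiv_fun_add (hf.differentiable (by simp) x)
    (hg.differentiable (by simp) x)]

theorem transport_sub (p : Params) {f g : (Fin 3 → ℝ) → ℝ} (hf : ContDiff ℝ ∞ f)
    (hg : ContDiff ℝ ∞ g) (x : Fin 3 → ℝ) :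
    transport p (fun x => f x - g x) x = transport p f x - transport p g x := by
  simp [transport_eq, fderiv_fun_sub (hf.differentiable (by simp) x)
    (hg.differentiable (by simp) x)]

theorem wave_add (p : Params) {f g : (Fin 3 → ℝ) → ℝ} (hf : ContDiff ℝ ∞ f)
    (hg : ContDiff ℝ ∞ g) (x : Fin 3 → ℝ) :
    wave p (fun x => f x + g x) x = wave p f x + wave p g x := by
  simp only [wave, waveOp, indHess_add hf hg]
  ring

theorem wave_sub (p : Params) {f g : (Fin 3 → ℝ) → ℝ} (hf : ContDiff ℝ ∞ f)
    (hg : ContDiff ℝ ∞ g) (x : Fin 3 → ℝ) :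
    wave p (fun x => f x - g x) x = wave p f x - wave p g x := by
  simp only [wave, waveOp, indHess_sub hf hg]
  ring

theorem fderiv_comp_clm {E F : Type*} [NormedAddCommGroup E] [NormedSpace ℝ E]
    [NormedAddCommGroup F] [NormedSpace ℝ F] {g : F → ℝ} (hg : Differentiable ℝ g) (L : E →L[ℝ] F)
    (x v : E) : fderiv ℝ (fun x => g (L x)) x v = fderiv ℝ g (L x) (L v) := by
  have := ((hg (L x)).hasFDerivAt.comp x L.hasFDerivAt).fderiv
  simp only [Function.comp_def] at this
  rw [this]
  rfl

theorem fderiv_fderiv_comp_clm {E F : Type*} [NormedAddCommGroup E] [NormedSpace ℝ E]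
    [NormedAddCommGroup F] [NormedSpace ℝ F] {g : F → ℝ} (hg : ContDiff ℝ ∞ g) (L : E →L[ℝ] F)
    (x v w : E) : fderiv ℝ (fderiv ℝ (fun x => g (L x))) x v w
      = fderiv ℝ (fderiv ℝ g) (L x) (L v) (L w) := by
  have hgL : ContDiff ℝ ∞ (fun x => g (L x)) := hg.comp L.contDiff
  rw [← fderiv_fderiv_apply hgL, ← fderiv_fderiv_apply hg]
  simp only [fderiv_comp_clm (hg.differentiable (by simp))]
  exact fderiv_comp_clm (g := fun y => fderiv ℝ g y (L w))
    ((differentiable_fderiv hg).clm_apply (differentiable_const _)) L x v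

theorem fderiv_comp_functional {g : ℝ → ℝ} (hg : ContDiff ℝ ∞ g) (L : (Fin 3 → ℝ) →L[ℝ] ℝ)
    (x v : Fin 3 → ℝ) : fderiv ℝ (fun x => g (L x)) x v = deriv g (L x) * L v := by
  rw [fderiv_comp_clm (hg.differentiable (by simp)), fderiv_eq_smul_deriv]
  simp [mul_comm]

theorem contDiff_deriv {g : ℝ → ℝ} (hg : ContDiff ℝ ∞ g) : ContDiff ℝ ∞ (deriv g) :=
  ContDiff.iterate_deriv 1 hg

theorem indHess_comp_functional {g : ℝ → ℝ} (hg : ContDiff ℝ ∞ g) (L : (Fin 3 → ℝ) →L[ℝ] ℝ)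
    (x v w : Fin 3 → ℝ) :
    indHess (fun x => g (L x)) x v w = deriv (deriv g) (L x) * L v * L w := by
  have hgL : ContDiff ℝ ∞ (fun x => g (L x)) := hg.comp L.contDiff
  rw [indHess, ← fderiv_fderiv_apply hgL]
  simp only [fderiv_comp_functional hg]
  have hd : DifferentiableAt ℝ (fun x => deriv g (L x)) x :=
    ((contDiff_deriv hg).comp L.contDiff).differentiable (by simp) x
  rw [fderiv_mul_const hd]
  simp only [smul_apply, smul_eq_mul]
  rw [fderiv_comp_functional (contDiff_deriv hg)]
  ring

/-- `K` is a function of `x` and `m y - (m c - d) t` that is annihilated by the wave operator. -/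
structure IsSol (p : Params) (K : (Fin 3 → ℝ) → ℝ) : Prop where
  contDiff : ContDiff ℝ ∞ K
  flow : ∀ x, fderiv ℝ K x (flowDir p) = 0
  wave : ∀ x, p.m * indHess K x (Pi.single 0 1) (Pi.single 0 1)
    + (p.m - p.d ^ 2) * indHess K x (Pi.single 1 1) (Pi.single 1 1) = 0

/-- Constancy along `flowDir` expresses `K_yt` and `K_tt` through `K_yy`. In the resulting
coefficient of `K_yy` everything containing `c` cancels and `m - d²` is left, which governs the type
of the equation. -/
theorem mul_wave_eq (p : Params) {K : (Fin 3 → ℝ) → ℝ} (hK : ContDiff ℝ ∞ K)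
    (hf : ∀ x, fderiv ℝ K x (flowDir p) = 0) (x : Fin 3 → ℝ) :
    p.m * wave p K x = p.m * indHess K x (Pi.single 0 1) (Pi.single 0 1)
      + (p.m - p.d ^ 2) * indHess K x (Pi.single 1 1) (Pi.single 1 1) := by
  have h : ∀ v, indHess K x v (flowDir p) = 0 := by
    intro v
    rw [indHess, ← fderiv_fderiv_apply hK]
    simp [hf]
  have h1 := h (Pi.single 1 1)
  have h2 := h (Pi.single 2 1)
  rw [eq_sum_single (flowDir p)] at h1 h2
  simp [flowDir, indHess] at h1 h2
  have h3 := indHess_comm hK x (Pi.single 1 1) (Pi.single 2 1)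
  simp only [wave, waveOp, indHess] at h3 ⊢
  rw [← h3] at h2
  linear_combination -p.m * h2 + (-p.m * p.c - p.d) * h1

theorem isSol_iff {p : Params} (hm : p.m ≠ 0) (K : (Fin 3 → ℝ) → ℝ) : IsSol p K ↔
    ContDiff ℝ ∞ K ∧ (∀ x, transport p K x = 0) ∧ ∀ x, wave p K x = 0 := by
  constructor
  · intro h
    refine ⟨h.contDiff, fun x => (transport_eq p K x).trans (h.flow x), fun x => ?_⟩
    have := mul_wave_eq p h.contDiff h.flow x
    rw [h.wave] at this
    simpa [hm] using this
  · rintro ⟨h1, h2, h3⟩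
    have hf : ∀ x, fderiv ℝ K x (flowDir p) = 0 := fun x => (transport_eq p K x).symm.trans (h2 x)
    refine ⟨h1, hf, fun x => ?_⟩
    rw [← mul_wave_eq p h1 hf, h3, mul_zero]

/-- The coefficient of `-v ∂_u + u ∂_v` in `∑ kᵢ Xᵢ`. -/
def phase (k : Fin 6 → ℝ) (t : ℝ) : ℝ := k 3 + k 4 * t + k 5 * t ^ 2

/-- The coefficient of `∂_φ` in `∑ kᵢ Xᵢ`. -/
def shift (p : Params) (k : Fin 6 → ℝ) (x : Fin 3 → ℝ) : ℝ :=
  phase k (x 2) / (p.m * p.w) + k 5 * x 0 ^ 2 / p.w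

theorem sum_X_add_vert (p : Params) (k : Fin 6 → ℝ) (K : (Fin 3 → ℝ) → ℝ) :
    (∑ i, k i • X p i) + vert (fun q => K q.1)
      = gaugeField ![k 1, k 2, k 0] 0 (phase k) (fun x => shift p k x + K x) := by
  funext q
  simp only [Fin.sum_univ_six, X]
  refine Prod.ext ?_ ?_
  · ext i
    fin_cases i <;> simp [X₁, X₂, X₃, X₄, X₅, X₆, rot, vert, gaugeField]
  · ext i
    fin_cases i
    · simp [X₁, X₂, X₃, X₄, X₅, X₆, rot, vert, gaugeField, phase]
      ring
    · simp [X₁, X₂, X₃, X₄, X₅, X₆, rot, vert, gaugeField, phase]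
      ring
    · simp [X₁, X₂, X₃, X₄, X₅, X₆, rot, vert, gaugeField, phase, shift]
      ring

theorem contDiff_phase (k : Fin 6 → ℝ) : ContDiff ℝ ∞ (phase k) := by
  unfold phase
  fun_prop

theorem deriv_phase (k : Fin 6 → ℝ) : deriv (phase k) = fun t => k 4 + 2 * k 5 * t := by
  funext t
  have h := (((hasDerivAt_id t).const_mul (k 4)).const_add (k 3)).fun_add
    ((hasDerivAt_pow 2 t).const_mul (k 5))
  refine (h.deriv : deriv (phase k) t = _).trans ?_
  simp
  ring

theorem contDiff_shift (p : Params) (k : Fin 6 → ℝ) : ContDiff ℝ ∞ (shift p k) := by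
  unfold shift phase
  fun_prop

/-- The coordinate functions as continuous linear functionals. -/
abbrev coord (i : Fin 3) : (Fin 3 → ℝ) →L[ℝ] ℝ := ContinuousLinearMap.proj i

theorem wave_time (p : Params) {g : ℝ → ℝ} (hg : ContDiff ℝ ∞ g) (x : Fin 3 → ℝ) :
    wave p (fun x => g (x 2)) x = -p.m * deriv (deriv g) (x 2) := by
  have := indHess_comp_functional hg (coord 2) x
  simp only [ContinuousLinearMap.proj_apply] at this
  simp [wave, waveOp, this]

theorem transport_time (p : Params) {g : ℝ → ℝ} (hg : ContDiff ℝ ∞ g) (x : Fin 3 → ℝ) :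
    transport p (fun x => g (x 2)) x = p.m * deriv g (x 2) := by
  have := fderiv_comp_functional hg (coord 2) x
  simp only [ContinuousLinearMap.proj_apply] at this
  simp [transport_eq, flowDir, this]
  ring

theorem wave_space (p : Params) {g : ℝ → ℝ} (hg : ContDiff ℝ ∞ g) (x : Fin 3 → ℝ) :
    wave p (fun x => g (x 0)) x = deriv (deriv g) (x 0) := by
  have := indHess_comp_functional hg (coord 0) x
  simp only [ContinuousLinearMap.proj_apply] at this
  simp [wave, waveOp, this]

theorem transport_space (p : Params) {g : ℝ → ℝ} (hg : ContDiff ℝ ∞ g) (x : Fin 3 → ℝ) :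
    transport p (fun x => g (x 0)) x = 0 := by
  have := fderiv_comp_functional hg (coord 0) x
  simp only [ContinuousLinearMap.proj_apply] at this
  simp [transport_eq, flowDir, this]

theorem deriv_mul_sq (r : ℝ) : deriv (fun s : ℝ => r * s ^ 2) = fun s => 2 * r * s := by
  funext s
  rw [((hasDerivAt_pow 2 s).const_mul r).deriv]
  simp
  ring

theorem shift_eq (p : Params) (k : Fin 6 → ℝ) : shift p k = fun x =>
    (fun t => phase k t / (p.m * p.w)) (x 2) + (fun s => k 5 / p.w * s ^ 2) (x 0) := by
  funext x
  simp only [shift]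
  ring

theorem transport_shift {p : Params} (hm : p.m ≠ 0) (hw : p.w ≠ 0) (k : Fin 6 → ℝ)
    (x : Fin 3 → ℝ) : p.w * transport p (shift p k) x = deriv (phase k) (x 2) := by
  have h1 : ContDiff ℝ ∞ (fun t => phase k t / (p.m * p.w)) := (contDiff_phase k).div_const _
  have h2 : ContDiff ℝ ∞ (fun s => k 5 / p.w * s ^ 2) := by fun_prop
  have h1' : ContDiff ℝ ∞ (fun x : Fin 3 → ℝ => (fun t => phase k t / (p.m * p.w)) (x 2)) :=
    h1.comp (contDiff_apply ℝ ℝ 2)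
  rw [shift_eq, transport_add p h1' (by fun_prop), transport_time p h1,
    transport_space p h2, deriv_div_const]
  field_simp
  ring

/-- The term `x²/w` in `X₆` is there to cancel `-2/w`, the image of `t²/(m w)` under the wave
operator. -/
theorem wave_shift {p : Params} (hm : p.m ≠ 0) (hw : p.w ≠ 0) (k : Fin 6 → ℝ)
    (x : Fin 3 → ℝ) : wave p (shift p k) x = 0 := by
  have h1 : ContDiff ℝ ∞ (fun t => phase k t / (p.m * p.w)) := (contDiff_phase k).div_const _
  have h2 : ContDiff ℝ ∞ (fun s => k 5 / p.w * s ^ 2) := by fun_prop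
  have h1' : ContDiff ℝ ∞ (fun x : Fin 3 → ℝ => (fun t => phase k t / (p.m * p.w)) (x 2)) :=
    h1.comp (contDiff_apply ℝ ℝ 2)
  have h3 : deriv (fun t => phase k t / (p.m * p.w))
      = fun t => (k 4 + 2 * k 5 * t) / (p.m * p.w) := by
    funext t
    rw [deriv_div_const, deriv_phase]
  have h4 : ∀ t : ℝ, deriv (fun t => (k 4 + 2 * k 5 * t) / (p.m * p.w)) t
      = 2 * k 5 / (p.m * p.w) := by
    intro t
    rw [((((hasDerivAt_id' t).const_mul (2 * k 5)).const_add (k 4)).div_const (p.m * p.w)).deriv]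
    simp
  have h5 : ∀ s : ℝ, deriv (fun s => 2 * (k 5 / p.w) * s) s = 2 * (k 5 / p.w) := by
    intro s
    rw [((hasDerivAt_id' s).const_mul (2 * (k 5 / p.w))).deriv]
    simp
  rw [shift_eq, wave_add p h1' (by fun_prop), wave_time p h1,
    wave_space p h2, h3, deriv_mul_sq, h4, h5]
  field_simp
  ring

theorem indHess_add_flow {K : (Fin 3 → ℝ) → ℝ} {l : Fin 3 → ℝ} (hK : ContDiff ℝ ∞ K)
    (hf : ∀ x, fderiv ℝ K x l = 0) (x v w : Fin 3 → ℝ) :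
    indHess K (x + l) v w = indHess K x v w := by
  have h1 : (fun x => K (x + l)) = K :=
    funext (apply_add_of_fderiv_eq_zero (hK.differentiable (by simp)) hf)
  have h2 : (fun x => fderiv ℝ K (x + l)) = fderiv ℝ K := by
    funext x
    rw [← fderiv_comp_add_right, h1]
  rw [indHess, ← fderiv_comp_add_right, h2, indHess]

/-- The phase of a symmetry is a quadratic polynomial in `t`. -/
theorem exists_eq_phase {p : Params} (hm : p.m ≠ 0) (hw : p.w ≠ 0) {θ : ℝ → ℝ}
    {h : (Fin 3 → ℝ) → ℝ} (hθ : ContDiff ℝ ∞ θ) (hh : ContDiff ℝ ∞ h)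
    (h1 : ∀ x, p.w * transport p h x = deriv θ (x 2)) (h2 : ∀ x, wave p h x = 0) :
    ∃ r₀ r₁ r₂ : ℝ, ∀ t, θ t = r₀ + r₁ * t + r₂ * t ^ 2 := by
  have hg : ContDiff ℝ ∞ (fun t => θ t / (p.m * p.w)) := hθ.div_const _
  have hgt : ContDiff ℝ ∞ (fun x : Fin 3 → ℝ => θ (x 2) / (p.m * p.w)) := by fun_prop
  have hd1 : deriv (fun t => θ t / (p.m * p.w)) = fun t => deriv θ t / (p.m * p.w) :=
    funext fun t => deriv_div_const _
  -- A particular solution of the transport equation is subtracted; the remainder is constant along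
  -- `flowDir`.
  set K : (Fin 3 → ℝ) → ℝ := fun x => h x - θ (x 2) / (p.m * p.w) with hK
  have cK : ContDiff ℝ ∞ K := hh.sub hgt
  have fK : ∀ x, transport p K x = 0 := by
    intro x
    have e := transport_sub p hh hgt x
    rw [transport_time p hg, hd1] at e
    rw [hK, e]
    have := h1 x
    field_simp
    linarith
  have wK : ∀ x, wave p K x = deriv (deriv θ) (x 2) / p.w := by
    intro x
    have e := wave_sub p hh hgt x
    rw [wave_time p hg, hd1, deriv_div_const, h2] at e
    rw [hK, e]
    field_simp
    ring
  -- `wave p K` is also constant along `flowDir`, but it equals `θ''(t)/w`, and `t` varies along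
  -- this direction because `m ≠ 0`.
  have const : ∀ t, deriv (deriv θ) t = deriv (deriv θ) 0 := by
    intro t
    have hf : ∀ x, fderiv ℝ K x ((t / p.m) • flowDir p) = 0 := fun x => by
      rw [map_smul, ← transport_eq, fK, smul_zero]
    have e : wave p K (0 + (t / p.m) • flowDir p) = wave p K 0 := by
      simp only [wave, indHess_add_flow cK hf]
    rw [wK, wK] at e
    have e2 : (0 + (t / p.m) • flowDir p) 2 = t := by
      simp [flowDir]
      field_simp
    rw [e2] at e
    have := mul_left_injective₀ (inv_ne_zero hw) e
    simpa using this
  set r := deriv (deriv θ) 0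
  have dθ := hθ.differentiable (by simp)
  have ddθ := (contDiff_deriv hθ).differentiable (by simp)
  have s1 : ∀ t, deriv θ t = deriv θ 0 + r * t := by
    intro t
    have hz : ∀ t, HasDerivAt (fun t => deriv θ t - r * t) 0 t := by
      intro t
      have := (ddθ t).hasDerivAt.fun_sub ((hasDerivAt_id t).const_mul r)
      rw [const t] at this
      simpa using this
    have := is_const_of_deriv_eq_zero (fun t => (hz t).differentiableAt) (fun t => (hz t).deriv) t 0
    simp only [mul_zero, sub_zero] at this
    linarith
  refine ⟨θ 0, deriv θ 0, r / 2, fun t => ?_⟩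
  have hz : ∀ t, HasDerivAt (fun t => θ t - (deriv θ 0 * t + r / 2 * t ^ 2)) 0 t := by
    intro t
    have := (dθ t).hasDerivAt.fun_sub (((hasDerivAt_id' t).const_mul (deriv θ 0)).fun_add
      ((hasDerivAt_pow 2 t).const_mul (r / 2)))
    rw [s1 t] at this
    refine this.congr_deriv ?_
    simp
    ring
  have := is_const_of_deriv_eq_zero (fun t => (hz t).differentiableAt) (fun t => (hz t).deriv) t 0
  simp at this
  linarith

/-- The symmetries, up to the description of the solutions `K` of a wave equation. -/
theorem mem_symmetryAlgebra_iff {p : Params} (ha : p.a ≠ 0) (hε : p.ε₀ ≠ 0) (hm : p.m ≠ 0)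
    (hd : p.d ≠ 0) (hw : p.w ≠ 0) (V : Jet0 → Jet0) : V ∈ symmetryAlgebra p ↔
    ∃ (k : Fin 6 → ℝ) (K : (Fin 3 → ℝ) → ℝ), IsSol p K ∧
      V = (∑ i, k i • X p i) + vert (fun q => K q.1) := by
  refine (isLieSymmetry_iff_gaugeField ha hε hm hd hw V).trans ?_
  simp only [isSol_iff hm, sum_X_add_vert]
  constructor
  · rintro ⟨ξ, θ, h, hθ, hh, h1, h2, rfl⟩
    obtain ⟨r₀, r₁, r₂, hr⟩ := exists_eq_phase hm hw hθ hh h1 h2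
    -- `X₁ = ∂_t` comes first among the generators while `t` is the last coordinate, hence the order
    -- of the entries.
    set k : Fin 6 → ℝ := ![ξ 2, ξ 0, ξ 1, r₀, r₁, r₂] with hk
    have hθk : θ = phase k := by
      funext t
      simp [hr, phase, hk]
    refine ⟨k, fun x => h x - shift p k x, ⟨hh.sub (contDiff_shift p k), fun x => ?_, fun x => ?_⟩,
      ?_⟩
    · have e := transport_shift hm hw k x
      rw [← hθk, ← h1 x] at e
      rw [transport_sub p hh (contDiff_shift p k), mul_left_cancel₀ hw e, sub_self]
    · rw [wave_sub p hh (contDiff_shift p k), h2, wave_shift hm hw, sub_zero]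
    · rw [← hθk]
      congr 1
      · ext i
        fin_cases i <;> simp [hk]
      · funext x
        ring
  · rintro ⟨k, K, ⟨cK, fK, wK⟩, rfl⟩
    refine ⟨_, _, _, contDiff_phase k, (contDiff_shift p k).add cK, fun x => ?_, fun x => ?_, rfl⟩
    · rw [transport_add p (contDiff_shift p k) cK, fK, add_zero, transport_shift hm hw]
    · rw [wave_add p (contDiff_shift p k) cK, wK, add_zero, wave_shift hm hw]

/-! ### Solutions in the hyperbolic, elliptic and degenerate cases. -/

/-- Harmonicity assumes only two continuous derivatives; smoothness comes from analyticity of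
harmonic functions. -/
theorem isHarmonic_iff (H : ℂ → ℝ) : IsHarmonic H ↔ ContDiff ℝ ∞ H ∧ ∀ z,
    fderiv ℝ (fderiv ℝ H) z 1 1 + fderiv ℝ (fderiv ℝ H) z Complex.I Complex.I = 0 := by
  have hL : ∀ z, Laplacian.laplacian H z = fderiv ℝ (fderiv ℝ H) z 1 1
      + fderiv ℝ (fderiv ℝ H) z Complex.I Complex.I := by
    intro z
    rw [InnerProductSpace.laplacian_eq_iteratedFDeriv_complexPlane]
    simp [iteratedFDeriv_two_apply]
  constructor
  · intro h
    refine ⟨contDiff_iff_contDiffAt.2 fun z => (HarmonicAt.analyticAt (h z trivial)).contDiffAt,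
      fun z => ?_⟩
    rw [← hL]
    exact (h z trivial).2.eq_of_nhds
  · rintro ⟨h1, h2⟩ z -
    exact ⟨(h1.of_le (WithTop.coe_le_coe.2 (le_top : (2 : ℕ∞) ≤ ⊤))).contDiffAt,
      Filter.Eventually.of_forall fun y => (hL y).trans (h2 y)⟩

/-- d'Alembert's formula: a function with vanishing mixed derivative splits. -/
theorem apply_add_of_mixed_eq_zero {E : Type*} [NormedAddCommGroup E] [NormedSpace ℝ E]
    {K : E → ℝ} (hK : ContDiff ℝ ∞ K) {d₁ d₂ : E}
    (h : ∀ x, fderiv ℝ (fderiv ℝ K) x d₂ d₁ = 0) : K (d₁ + d₂) = K d₁ + K d₂ - K 0 := by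
  have hd := hK.differentiable (by simp)
  have h1 : ∀ y, fderiv ℝ K (y + d₂) d₁ = fderiv ℝ K y d₁ := by
    refine apply_add_of_fderiv_eq_zero
      ((differentiable_fderiv hK).clm_apply (differentiable_const d₁)) fun y => ?_
    rw [fderiv_fderiv_apply hK]
    exact h y
  have ht : Differentiable ℝ (fun y => K (y + d₂)) := hd.comp (differentiable_id.add_const d₂)
  have h2 : ∀ y, fderiv ℝ (fun y => K (y + d₂) - K y) y d₁ = 0 := by
    intro y
    rw [fderiv_fun_sub (ht y) (hd y), fderiv_comp_add_right]
    simp [h1]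
  have hd' : Differentiable ℝ (fun y => K (y + d₂) - K y) := ht.sub hd
  have := apply_add_of_fderiv_eq_zero hd' h2 0
  simp only [zero_add] at this
  linarith

theorem IsSol.apply_eq {p : Params} {K : (Fin 3 → ℝ) → ℝ} (hK : IsSol p K)
    {x y : Fin 3 → ℝ} (s : ℝ) (h : x = y + s • flowDir p) : K x = K y := by
  rw [h]
  refine apply_add_of_fderiv_eq_zero (hK.contDiff.differentiable (by simp)) (fun x => ?_) y
  rw [map_smul, hK.flow, smul_zero]

/-- The functional `r x + s (m y - (m c - d) t)`. -/
def phaseFun (p : Params) (r s : ℝ) : (Fin 3 → ℝ) →L[ℝ] ℝ :=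
  r • coord 0 + s • (p.m • coord 1 - (p.m * p.c - p.d) • coord 2)

theorem phaseFun_apply (p : Params) (r s : ℝ) (x : Fin 3 → ℝ) :
    phaseFun p r s x = r * x 0 + s * (p.m * x 1 - (p.m * p.c - p.d) * x 2) := by
  simp [phaseFun]

theorem IsSol.add {p : Params} {f g : (Fin 3 → ℝ) → ℝ} (hf : IsSol p f) (hg : IsSol p g) :
    IsSol p (fun x => f x + g x) := by
  refine ⟨hf.contDiff.add hg.contDiff, fun x => ?_, fun x => ?_⟩
  · rw [fderiv_fun_add (hf.contDiff.differentiable (by simp) x)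
      (hg.contDiff.differentiable (by simp) x)]
    simp [hf.flow, hg.flow]
  · rw [indHess_add hf.contDiff hg.contDiff, indHess_add hf.contDiff hg.contDiff]
    linear_combination hf.wave x + hg.wave x

theorem isSol_comp_phaseFun {p : Params} {F : ℝ → ℝ} (hF : ContDiff ℝ ∞ F) {r s : ℝ}
    (h : r ^ 2 + p.m * (p.m - p.d ^ 2) * s ^ 2 = 0) : IsSol p (fun x => F (phaseFun p r s x)) := by
  refine ⟨hF.comp (phaseFun p r s).contDiff, fun x => ?_, fun x => ?_⟩
  · rw [fderiv_comp_functional hF, phaseFun_apply p r s (flowDir p)]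
    simp [flowDir]
    right
    right
    ring
  · rw [indHess_comp_functional hF, indHess_comp_functional hF, phaseFun_apply p r s (Pi.single _ _),
      phaseFun_apply p r s (Pi.single _ _)]
    simp
    linear_combination p.m * deriv (deriv F) (phaseFun p r s x) * h

theorem isSol_iff_of_lt {p : Params} (hm : 0 < p.m) (h : p.m < p.d ^ 2) (K : (Fin 3 → ℝ) → ℝ) :
    IsSol p K ↔ ∃ F G : ℝ → ℝ, ContDiff ℝ ∞ F ∧ ContDiff ℝ ∞ G ∧ K = fun x =>
      F (phaseFun p (√(p.m * (p.d ^ 2 - p.m))) (-1) x)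
        + G (phaseFun p (√(p.m * (p.d ^ 2 - p.m))) 1 x) := by
  have hpos : 0 < p.m * (p.d ^ 2 - p.m) := mul_pos hm (by linarith)
  have hα : √(p.m * (p.d ^ 2 - p.m)) ^ 2 = p.m * (p.d ^ 2 - p.m) := Real.sq_sqrt hpos.le
  have hα0 : √(p.m * (p.d ^ 2 - p.m)) ≠ 0 := (Real.sqrt_pos.2 hpos).ne'
  set α := √(p.m * (p.d ^ 2 - p.m))
  have hm0 := hm.ne'
  constructor
  · intro hK
    have cK := hK.contDiff
    -- Null directions: the mixed derivative along `d₁, d₂` is `m² K_xx - α² K_yy`, which is `m`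
    -- times the equation. Each of the two phases kills one direction and takes the value `2 m α` on
    -- the other; this explains the divisor in the profiles.
    set d₁ : Fin 3 → ℝ := p.m • Pi.single 0 1 - α • Pi.single 1 1 with hd₁
    set d₂ : Fin 3 → ℝ := p.m • Pi.single 0 1 + α • Pi.single 1 1 with hd₂
    refine ⟨fun s => K ((s / (2 * p.m * α)) • d₁), fun s => K ((s / (2 * p.m * α)) • d₂) - K 0,
      by fun_prop, by fun_prop, ?_⟩
    funext x
    have hmix : ∀ x, fderiv ℝ (fderiv ℝ K) x d₂ d₁ = 0 := by
      intro x
      have h1 := hK.wave x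
      have h2 := indHess_comm cK x (Pi.single 0 1) (Pi.single 1 1)
      simp only [indHess] at h1 h2
      simp only [hd₁, hd₂, map_add, map_sub, map_smul, add_apply, smul_apply, smul_eq_mul]
      linear_combination p.m * h1 - p.m * α * h2
        - hα * fderiv ℝ (fderiv ℝ K) x (Pi.single 1 1) (Pi.single 1 1)
    have hsplit := apply_add_of_mixed_eq_zero cK
      (d₁ := (phaseFun p α (-1) x / (2 * p.m * α)) • d₁)
      (d₂ := (phaseFun p α 1 x / (2 * p.m * α)) • d₂)
      (fun x => by simp [hmix])
    -- The null directions and `flowDir` form a basis, and `K` ignores the last component.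
    have e : x = ((phaseFun p α (-1) x / (2 * p.m * α)) • d₁
        + (phaseFun p α 1 x / (2 * p.m * α)) • d₂) + (x 2 / p.m) • flowDir p := by
      simp only [phaseFun_apply]
      ext i
      fin_cases i
      · simp [hd₁, hd₂, flowDir]
        field_simp
        ring
      · simp [hd₁, hd₂, flowDir]
        field_simp
        ring
      · simp [hd₁, hd₂, flowDir]
        field_simp
    rw [hK.apply_eq _ e, hsplit]
    ring
  · rintro ⟨F, G, hF, hG, rfl⟩
    refine (isSol_comp_phaseFun hF ?_).add (isSol_comp_phaseFun hG ?_)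
    · rw [hα]; ring
    · rw [hα]; ring

/-- The map `(x, y, t) ↦ x + i s (m y - (m c - d) t)`. -/
def toPlane (p : Params) (s : ℝ) : (Fin 3 → ℝ) →L[ℝ] ℂ :=
  (Complex.equivRealProdCLM.symm : ℝ × ℝ →L[ℝ] ℂ).comp ((coord 0).prod (phaseFun p 0 s))

theorem toPlane_apply (p : Params) (s : ℝ) (x : Fin 3 → ℝ) :
    toPlane p s x = ⟨x 0, s * (p.m * x 1 - (p.m * p.c - p.d) * x 2)⟩ := by
  apply Complex.ext <;> simp [toPlane, phaseFun_apply]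

theorem isSol_iff_of_gt {p : Params} (hm : 0 < p.m) (h : p.d ^ 2 < p.m) (K : (Fin 3 → ℝ) → ℝ) :
    IsSol p K ↔ ∃ H, IsHarmonic H ∧ K = fun x =>
      H (toPlane p (√(p.m * (p.m - p.d ^ 2)))⁻¹ x) := by
  have hpos : 0 < p.m * (p.m - p.d ^ 2) := mul_pos hm (by linarith)
  have hα : √(p.m * (p.m - p.d ^ 2)) ^ 2 = p.m * (p.m - p.d ^ 2) := Real.sq_sqrt hpos.le
  have hα0 : √(p.m * (p.m - p.d ^ 2)) ≠ 0 := (Real.sqrt_pos.2 hpos).ne'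
  set α := √(p.m * (p.m - p.d ^ 2))
  have hm0 := hm.ne'
  constructor
  · intro hK
    have cK := hK.contDiff
    -- `M` is a right inverse of `toPlane`, so it restricts `K` to the slice `t = 0` in the
    -- normalised coordinates.
    set M : ℂ →L[ℝ] (Fin 3 → ℝ) := Complex.reCLM.smulRight (Pi.single 0 1)
      + Complex.imCLM.smulRight ((α / p.m) • Pi.single 1 1) with hM
    refine ⟨fun z => K (M z), (isHarmonic_iff _).2 ⟨cK.comp M.contDiff, fun z => ?_⟩, ?_⟩
    · rw [fderiv_fderiv_comp_clm cK, fderiv_fderiv_comp_clm cK]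
      have h1 := hK.wave (M z)
      simp only [indHess] at h1
      simp [hM] at h1 ⊢
      generalize fderiv ℝ (fderiv ℝ K) _ (Pi.single 0 1) (Pi.single 0 1) = A at h1 ⊢
      generalize fderiv ℝ (fderiv ℝ K) _ (Pi.single 1 1) (Pi.single 1 1) = B at h1 ⊢
      field_simp
      linear_combination p.m * h1 + B * hα
    · funext x
      refine hK.apply_eq (x 2 / p.m) ?_
      rw [toPlane_apply]
      ext i
      fin_cases i
      · simp [hM, flowDir]
      · simp [hM, flowDir]
        field_simp
        ring
      · simp [hM, flowDir]
        field_simp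
  · rintro ⟨H, hH, rfl⟩
    obtain ⟨cH, hH⟩ := (isHarmonic_iff H).1 hH
    refine ⟨cH.comp (toPlane p _).contDiff, fun x => ?_, fun x => ?_⟩
    · rw [fderiv_comp_clm (cH.differentiable (by simp)), toPlane_apply p _ (flowDir p)]
      have : (⟨flowDir p 0, α⁻¹ * (p.m * flowDir p 1 - (p.m * p.c - p.d) * flowDir p 2)⟩ : ℂ)
          = 0 := by
        apply Complex.ext
        · simp [flowDir]
        · simp [flowDir]
          right
          ring
      rw [this, map_zero]
    · rw [indHess, indHess, fderiv_fderiv_comp_clm cH, fderiv_fderiv_comp_clm cH]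
      have e0 : toPlane p α⁻¹ (Pi.single 0 1) = 1 := by
        rw [toPlane_apply]
        apply Complex.ext <;> simp
      have e1 : toPlane p α⁻¹ (Pi.single 1 1) = (α⁻¹ * p.m) • Complex.I := by
        rw [toPlane_apply]
        apply Complex.ext <;> simp
      rw [e0, e1]
      have h1 := hH (toPlane p α⁻¹ x)
      simp only [map_smul, smul_apply, smul_eq_mul]
      generalize fderiv ℝ (fderiv ℝ H) _ 1 1 = A at h1 ⊢
      generalize fderiv ℝ (fderiv ℝ H) _ Complex.I Complex.I = B at h1 ⊢
      field_simp
      linear_combination p.m * α ^ 2 * h1 - p.m * B * hα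

theorem isSol_iff_of_eq {p : Params} (hd : 0 < p.d) (h : p.m = p.d ^ 2) (K : (Fin 3 → ℝ) → ℝ) :
    IsSol p K ↔ ∃ R S : ℝ → ℝ, ContDiff ℝ ∞ R ∧ ContDiff ℝ ∞ S ∧ K = fun x =>
      x 0 * R (phaseFun p 0 p.d⁻¹ x) + S (phaseFun p 0 p.d⁻¹ x) := by
  have hd0 := hd.ne'
  have hm0 : p.m ≠ 0 := by rw [h]; positivity
  constructor
  · intro hK
    have cK := hK.contDiff
    have hfd : ContDiff ℝ ∞ (fun x => fderiv ℝ K x (Pi.single 0 1)) :=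
      (cK.fderiv_right (m := ∞) (by simp)).clm_apply contDiff_const
    -- `R` and `S` are `K_x` and `K` on the `y`-axis, where the phase is `d y`. As `m = d²`, the
    -- equation becomes `K_xx = 0`, so `K` is affine in `x`.
    refine ⟨fun s => fderiv ℝ K ((s / p.d) • Pi.single 1 1) (Pi.single 0 1),
      fun s => K ((s / p.d) • Pi.single 1 1), hfd.comp (by fun_prop), by fun_prop, ?_⟩
    funext x
    set y : Fin 3 → ℝ := (phaseFun p 0 p.d⁻¹ x / p.d) • Pi.single 1 1 with hy
    have e : x = (y + x 0 • Pi.single 0 1) + (x 2 / p.m) • flowDir p := by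
      rw [hy]
      ext i
      fin_cases i
      · simp [flowDir]
      · simp [flowDir, phaseFun_apply, h]
        field_simp
        ring
      · simp [flowDir]
        field_simp
    have h00 : ∀ x, fderiv ℝ (fun x => fderiv ℝ K x (Pi.single 0 1)) x (Pi.single 0 1) = 0 := by
      intro x
      have := hK.wave x
      rw [← h, sub_self, zero_mul, add_zero] at this
      rw [fderiv_fderiv_apply cK]
      simpa [hm0, indHess] using this
    have hconst : ∀ (s : ℝ), fderiv ℝ K (y + s • Pi.single 0 1) (Pi.single 0 1)
        = fderiv ℝ K y (Pi.single 0 1) := fun s =>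
      apply_add_of_fderiv_eq_zero (hfd.differentiable (by simp))
        (fun x => by rw [map_smul, h00, smul_zero]) y
    have hz : ∀ s : ℝ, HasDerivAt
        (fun s : ℝ => K (y + s • Pi.single 0 1) - s * fderiv ℝ K y (Pi.single 0 1)) 0 s := by
      intro s
      have hl : HasDerivAt (fun s : ℝ => y + s • (Pi.single 0 1 : Fin 3 → ℝ)) (Pi.single 0 1) s := by
        simpa using ((hasDerivAt_id s).smul_const (Pi.single 0 1 : Fin 3 → ℝ)).const_add y
      have h1 := (cK.differentiable (by simp) _).hasFDerivAt.comp_hasDerivAt s hl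
      rw [hconst] at h1
      simpa using h1.fun_sub ((hasDerivAt_id' s).mul_const (fderiv ℝ K y (Pi.single 0 1)))
    have := is_const_of_deriv_eq_zero (fun s => (hz s).differentiableAt) (fun s => (hz s).deriv)
      (x 0) 0
    simp only [zero_smul, add_zero, zero_mul, sub_zero] at this
    rw [hK.apply_eq _ e]
    linarith
  · rintro ⟨R, S, hR, hS, rfl⟩
    refine IsSol.add ?_ (isSol_comp_phaseFun hS (by rw [h]; ring))
    have hR' := isSol_comp_phaseFun (p := p) (r := 0) (s := p.d⁻¹) hR (by rw [h]; ring)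
    have dR := hR'.contDiff.differentiable (by simp)
    have h0 : ∀ x v, fderiv ℝ (fun x : Fin 3 → ℝ => x 0 * R (phaseFun p 0 p.d⁻¹ x)) x v
        = x 0 * fderiv ℝ (fun x => R (phaseFun p 0 p.d⁻¹ x)) x v
          + v 0 * R (phaseFun p 0 p.d⁻¹ x) := by
      intro x v
      have := ((coord 0).hasFDerivAt (x := x)).fun_mul (dR x).hasFDerivAt
      simp only [ContinuousLinearMap.proj_apply] at this
      rw [this.fderiv]
      simp
      ring
    have cxR : ContDiff ℝ ∞ (fun x : Fin 3 → ℝ => x 0 * R (phaseFun p 0 p.d⁻¹ x)) :=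
      (contDiff_apply ℝ ℝ 0).mul hR'.contDiff
    have hx : ∀ x, fderiv ℝ (fun x => R (phaseFun p 0 p.d⁻¹ x)) x (Pi.single 0 1) = 0 := by
      intro x
      rw [fderiv_comp_functional hR, phaseFun_apply p 0 _ (Pi.single 0 1)]
      simp
    refine ⟨cxR, fun x => ?_, fun x => ?_⟩
    · rw [h0, hR'.flow]
      simp [flowDir]
    · rw [← h, sub_self, zero_mul, add_zero, indHess, ← fderiv_fderiv_apply cxR]
      simp only [h0, hx]
      simp [hx]

/-! ### Lie brackets, closure and infinite dimension. -/

theorem vert_add (f g : Jet0 → ℝ) : vert f + vert g = vert (fun q => f q + g q) := by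
  funext q
  refine Prod.ext (by simp [vert]) ?_
  ext i
  fin_cases i <;> simp [vert]

theorem smul_vert (r : ℝ) (f : Jet0 → ℝ) : r • vert f = vert (fun q => r * f q) := by
  funext q
  refine Prod.ext (by simp [vert]) ?_
  ext i
  fin_cases i <;> simp [vert]

theorem vert_zero : vert (fun _ => 0) = 0 := by
  funext q
  refine Prod.ext (by simp [vert]) ?_
  ext i
  fin_cases i <;> simp [vert]

theorem vert_eq_gaugeField (K : (Fin 3 → ℝ) → ℝ) :
    vert (fun q => K q.1) = gaugeField 0 0 0 K := by
  funext q
  refine Prod.ext (by simp [vert, gaugeField]) ?_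
  ext i
  fin_cases i <;> simp [vert, gaugeField]

theorem fderiv_gaugeField (ξ : Fin 3 → ℝ) {θ : ℝ → ℝ} {h : (Fin 3 → ℝ) → ℝ}
    (hθ : ContDiff ℝ ∞ θ) (hh : ContDiff ℝ ∞ h) (q v : Jet0) :
    fderiv ℝ (gaugeField ξ 0 θ h) q v =
      (0, ![-(v.1 2 * deriv θ (q.1 2) * q.2 1 + θ (q.1 2) * v.2 1),
        v.1 2 * deriv θ (q.1 2) * q.2 0 + θ (q.1 2) * v.2 0, fderiv ℝ h q.1 v.1]) := by
  have dθ := hθ.differentiable (by simp)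
  have hd : DifferentiableAt ℝ (gaugeField ξ 0 θ h) q :=
    (contDiff_gaugeField ξ contDiff_const hθ hh).differentiable (by simp) q
  refine Prod.ext ?_ ?_
  · have := (((ContinuousLinearMap.fst ℝ (Fin 3 → ℝ) (Fin 3 → ℝ)).hasFDerivAt).comp q
      hd.hasFDerivAt).fderiv
    have e := DFunLike.congr_fun this v
    refine e.symm.trans ?_
    have hc : (⇑(ContinuousLinearMap.fst ℝ (Fin 3 → ℝ) (Fin 3 → ℝ)) ∘ gaugeField ξ 0 θ h)
        = fun _ => ξ := rfl
    rw [hc]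
    simp
  · have key : ∀ α, (fderiv ℝ (gaugeField ξ 0 θ h) q v).2 α
        = fderiv ℝ (fun q => (gaugeField ξ 0 θ h q).2 α) q v := by
      intro α
      have := (((ContinuousLinearMap.proj (R := ℝ) (φ := fun _ : Fin 3 => ℝ) α).comp
        (ContinuousLinearMap.snd ℝ (Fin 3 → ℝ) (Fin 3 → ℝ))).hasFDerivAt.comp q
          hd.hasFDerivAt).fderiv
      exact (DFunLike.congr_fun this v).symm
    ext α
    rw [key]
    fin_cases α
    · simp only [gaugeField]
      simp [fderiv_mul_dep dθ]
    · simp only [gaugeField]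
      simp [fderiv_mul_dep dθ]
    · have := fderiv_comp_clm (hh.differentiable (by simp))
        (ContinuousLinearMap.fst ℝ (Fin 3 → ℝ) (Fin 3 → ℝ)) q v
      simpa [gaugeField] using this

theorem lieBracket_gaugeField (ξ ξ' : Fin 3 → ℝ) {θ θ' : ℝ → ℝ} {h h' : (Fin 3 → ℝ) → ℝ}
    (hθ : ContDiff ℝ ∞ θ) (hh : ContDiff ℝ ∞ h) (hθ' : ContDiff ℝ ∞ θ') (hh' : ContDiff ℝ ∞ h') :
    lieBracket ℝ (gaugeField ξ 0 θ h) (gaugeField ξ' 0 θ' h') =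
      gaugeField 0 0 (fun t => ξ 2 * deriv θ' t - ξ' 2 * deriv θ t)
        (fun x => fderiv ℝ h' x ξ - fderiv ℝ h x ξ') := by
  funext q
  rw [lieBracket, fderiv_gaugeField ξ hθ hh, fderiv_gaugeField ξ' hθ' hh']
  refine Prod.ext (by simp [gaugeField]) ?_
  ext α
  fin_cases α
  · simp [gaugeField]
    ring
  · simp [gaugeField]
    ring
  · simp [gaugeField]

theorem contDiff_fderiv_apply {h : (Fin 3 → ℝ) → ℝ} (hh : ContDiff ℝ ∞ h) (v : Fin 3 → ℝ) :
    ContDiff ℝ ∞ (fun x => fderiv ℝ h x v) :=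
  (hh.fderiv_right (m := ∞) (by simp)).clm_apply contDiff_const

theorem fderiv_fderiv_comm {h : (Fin 3 → ℝ) → ℝ} (hh : ContDiff ℝ ∞ h) (x v w : Fin 3 → ℝ) :
    fderiv ℝ (fun x => fderiv ℝ h x w) x v = fderiv ℝ (fun x => fderiv ℝ h x v) x w := by
  rw [fderiv_fderiv_apply hh, fderiv_fderiv_apply hh]
  exact indHess_comm hh x v w

theorem transport_fderiv (p : Params) {h : (Fin 3 → ℝ) → ℝ} (hh : ContDiff ℝ ∞ h)
    (ξ x : Fin 3 → ℝ) : transport p (fun x => fderiv ℝ h x ξ) x = fderiv ℝ (transport p h) x ξ := by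
  have : transport p h = fun x => fderiv ℝ h x (flowDir p) := funext (transport_eq p h)
  rw [transport_eq, this, fderiv_fderiv_comm hh]

theorem indHess_fderiv {h : (Fin 3 → ℝ) → ℝ} (hh : ContDiff ℝ ∞ h) (ξ x v w : Fin 3 → ℝ) :
    indHess (fun x => fderiv ℝ h x ξ) x v w = fderiv ℝ (fun x => indHess h x v w) x ξ := by
  have e : (fun x => fderiv ℝ (fun x => fderiv ℝ h x ξ) x w)
      = fun x => fderiv ℝ (fun x => fderiv ℝ h x w) x ξ :=
    funext fun x => fderiv_fderiv_comm hh x w ξ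
  have e2 : (fun x => indHess h x v w) = fun x => fderiv ℝ (fun x => fderiv ℝ h x w) x v :=
    funext fun x => (fderiv_fderiv_apply hh x v w).symm
  rw [indHess, ← fderiv_fderiv_apply (contDiff_fderiv_apply hh ξ), e,
    fderiv_fderiv_comm (contDiff_fderiv_apply hh w), e2]

theorem wave_fderiv (p : Params) {h : (Fin 3 → ℝ) → ℝ} (hh : ContDiff ℝ ∞ h)
    (ξ x : Fin 3 → ℝ) : wave p (fun x => fderiv ℝ h x ξ) x = fderiv ℝ (wave p h) x ξ := by
  have hd : ∀ v w, DifferentiableAt ℝ (fun x => indHess h x v w) x := by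
    intro v w
    have e2 : (fun x => indHess h x v w) = fun x => fderiv ℝ (fun x => fderiv ℝ h x w) x v :=
      funext fun x => (fderiv_fderiv_apply hh x v w).symm
    rw [e2]
    exact (contDiff_fderiv_apply (contDiff_fderiv_apply hh w) v).differentiable (by simp) x
  have e : wave p h = fun x => indHess h x (Pi.single 0 1) (Pi.single 0 1)
      + (1 - p.m * p.c ^ 2) * indHess h x (Pi.single 1 1) (Pi.single 1 1)
      - p.m * indHess h x (Pi.single 2 1) (Pi.single 2 1)
      - 2 * p.m * p.c * indHess h x (Pi.single 1 1) (Pi.single 2 1) := rfl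
  have hf := (((hd (Pi.single 0 1) (Pi.single 0 1)).hasFDerivAt.fun_add
    ((hd (Pi.single 1 1) (Pi.single 1 1)).hasFDerivAt.const_mul (1 - p.m * p.c ^ 2))).fun_sub
    ((hd (Pi.single 2 1) (Pi.single 2 1)).hasFDerivAt.const_mul p.m)).fun_sub
    ((hd (Pi.single 1 1) (Pi.single 2 1)).hasFDerivAt.const_mul (2 * p.m * p.c))
  rw [e, hf.fderiv]
  simp [wave, waveOp, indHess_fderiv hh]

/-- The new shift is a combination of directional derivatives of the old ones. The transport and
wave operators have constant coefficients, so they commute with these derivatives and the two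
invariance conditions are inherited. -/
theorem lieBracket_mem_symmetryAlgebra {p : Params} (ha : p.a ≠ 0) (hε : p.ε₀ ≠ 0) (hm : p.m ≠ 0)
    (hd : p.d ≠ 0) (hw : p.w ≠ 0) {V W : Jet0 → Jet0} (hV : V ∈ symmetryAlgebra p)
    (hW : W ∈ symmetryAlgebra p) : lieBracket ℝ V W ∈ symmetryAlgebra p := by
  obtain ⟨ξ, θ, h, hθ, hh, t1, w1, rfl⟩ := (isLieSymmetry_iff_gaugeField ha hε hm hd hw V).1 hV
  obtain ⟨ξ', θ', h', hθ', hh', t2, w2, rfl⟩ := (isLieSymmetry_iff_gaugeField ha hε hm hd hw W).1 hW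
  rw [lieBracket_gaugeField ξ ξ' hθ hh hθ' hh']
  -- The transport condition, differentiated in the direction `ξ`.
  have dt : ∀ {θ : ℝ → ℝ} {h : (Fin 3 → ℝ) → ℝ} (_ : ContDiff ℝ ∞ θ) (_ : ContDiff ℝ ∞ h)
      (_ : ∀ x, p.w * transport p h x = deriv θ (x 2)) (ξ x : Fin 3 → ℝ),
      p.w * fderiv ℝ (transport p h) x ξ = deriv (deriv θ) (x 2) * ξ 2 := by
    intro θ h hθ hh ht ξ x
    have e := fderiv_comp_functional (contDiff_deriv hθ) (coord 2) x ξ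
    simp only [ContinuousLinearMap.proj_apply, ← ht] at e
    rw [← e, fderiv_const_mul]
    · simp
    · have : transport p h = fun x => fderiv ℝ h x (flowDir p) := funext (transport_eq p h)
      rw [this]
      exact (contDiff_fderiv_apply hh _).differentiable (by simp) x
  have c1 := contDiff_fderiv_apply hh ξ'
  have c2 := contDiff_fderiv_apply hh' ξ
  refine isLieSymmetry_gaugeField ?_ (c2.sub c1) (fun x => ?_) (fun x => ?_)
  · exact (contDiff_const.mul (contDiff_deriv hθ')).sub (contDiff_const.mul (contDiff_deriv hθ))
  · rw [transport_sub p c2 c1, transport_fderiv p hh, transport_fderiv p hh', mul_sub,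
      dt hθ hh t1, dt hθ' hh' t2]
    have d1 : DifferentiableAt ℝ (deriv θ) (x 2) := (contDiff_deriv hθ).differentiable (by simp) _
    have d2 : DifferentiableAt ℝ (deriv θ') (x 2) := (contDiff_deriv hθ').differentiable (by simp) _
    rw [deriv_fun_sub (d2.const_mul _) (d1.const_mul _), deriv_const_mul _ d2,
      deriv_const_mul _ d1]
    ring
  · rw [wave_sub p c2 c1, wave_fderiv p hh, wave_fderiv p hh', show wave p h = 0 from funext w1,
      show wave p h' = 0 from funext w2]
    simp

theorem not_finiteDimensional_of_injective {p : Params} (ha : p.a ≠ 0) (hε : p.ε₀ ≠ 0)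
    (hm : p.m ≠ 0) (hd : p.d ≠ 0) (hw : p.w ≠ 0)
    (T : Polynomial ℝ →ₗ[ℝ] ((Fin 3 → ℝ) → ℝ)) (hT : ∀ P, IsSol p (T P))
    (hinj : Function.Injective T) : ¬ FiniteDimensional ℝ (symmetryAlgebra p) := by
  intro hfin
  let Φ : Polynomial ℝ →ₗ[ℝ] (Jet0 → Jet0) :=
    { toFun := fun P => vert (fun q => T P q.1)
      map_add' := fun P Q => by rw [vert_add, map_add]; rfl
      map_smul' := fun r P => by rw [RingHom.id_apply, smul_vert, map_smul]; rfl }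
  have hΦ : ∀ P, Φ P ∈ symmetryAlgebra p := fun P =>
    (mem_symmetryAlgebra_iff ha hε hm hd hw _).2 ⟨0, T P, hT P, by simp [Φ]⟩
  have hΦinj : Function.Injective (Φ.codRestrict _ hΦ) := by
    intro P Q hPQ
    apply hinj
    funext x
    have h1 : Φ P (x, 0) = Φ Q (x, 0) := congrFun (congrArg Subtype.val hPQ) (x, 0)
    have h2 := congrFun (congrArg Prod.snd h1) 2
    simpa [Φ, vert] using h2
  have : Module.Finite ℝ (Polynomial ℝ) := Module.Finite.of_injective _ hΦinj
  exact Polynomial.not_finite this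

theorem not_finiteDimensional {p : Params} (ha : p.a ≠ 0) (hε : p.ε₀ ≠ 0) (hm : 0 < p.m)
    (hd : p.d ≠ 0) (hw : p.w ≠ 0) : ¬ FiniteDimensional ℝ (symmetryAlgebra p) := by
  -- For `m ≤ d²` a polynomial in `α x + ζ` works; when `m = d²` the root `α` is zero and this is a
  -- function of `ζ`. For `m > d²` real parts of complex polynomials are harmonic.
  rcases le_or_gt p.m (p.d ^ 2) with h | h
  · have hα : √(p.m * (p.d ^ 2 - p.m)) ^ 2 = p.m * (p.d ^ 2 - p.m) :=
      Real.sq_sqrt (mul_nonneg hm.le (by linarith))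
    set α := √(p.m * (p.d ^ 2 - p.m))
    refine not_finiteDimensional_of_injective ha hε hm.ne' hd hw
      { toFun := fun P x => P.eval (phaseFun p α 1 x)
        map_add' := fun P Q => by funext x; simp
        map_smul' := fun r P => by funext x; simp } (fun P => ?_) (fun P Q hPQ => ?_)
    · have hP : ContDiff ℝ ∞ (fun s => P.eval s) := by simpa using P.contDiff_aeval (𝕜 := ℝ) ∞
      exact isSol_comp_phaseFun (r := α) (s := 1) hP (by rw [hα]; ring)
    · refine Polynomial.funext fun s => ?_
      have := congrFun hPQ (Pi.single 1 (s / p.m))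
      simpa [phaseFun_apply, mul_div_cancel₀ s hm.ne'] using this
  · refine not_finiteDimensional_of_injective ha hε hm.ne' hd hw
      { toFun := fun P x => ((P.map (algebraMap ℝ ℂ)).eval
          (toPlane p (√(p.m * (p.m - p.d ^ 2)))⁻¹ x)).re
        map_add' := fun P Q => by funext x; simp
        map_smul' := fun r P => by funext x; simp } (fun P => ?_) (fun P Q hPQ => ?_)
    · refine (isSol_iff_of_gt hm h _).2 ⟨fun z => ((P.map (algebraMap ℝ ℂ)).eval z).re, ?_, rfl⟩
      intro z _
      exact AnalyticAt.harmonicAt_re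
        ((P.map (algebraMap ℝ ℂ)).differentiable.analyticAt z)
    · refine Polynomial.funext fun s => ?_
      -- On the `x`-axis the argument is real and the real part is the original polynomial.
      have := congrFun hPQ (Pi.single 0 s)
      have e : toPlane p (√(p.m * (p.m - p.d ^ 2)))⁻¹ (Pi.single 0 s) = (s : ℂ) := by
        rw [toPlane_apply]
        apply Complex.ext <;> simp
      simp only [LinearMap.coe_mk, AddHom.coe_mk, e] at this
      have ev : ∀ P : Polynomial ℝ, ((P.map (algebraMap ℝ ℂ)).eval (s : ℂ)).re = P.eval s := by
        intro P
        have := Polynomial.eval_map_algebraMap (R := ℝ) (B := ℂ) P (s : ℂ)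
        rw [this]
        have h2 := Polynomial.aeval_algebraMap_apply ℂ s P
        simp only [Complex.coe_algebraMap] at h2
        rw [h2]
        simp
      rwa [ev, ev] at this

/-! ### Commutators of the six generators and uniqueness of the decomposition. -/

/-- The components of `Xᵢ` in the directions of the independent variables. -/
def baseDir : Fin 6 → Fin 3 → ℝ := ![Pi.single 2 1, Pi.single 0 1, Pi.single 1 1, 0, 0, 0]

theorem X_eq_gaugeField (p : Params) (i : Fin 6) : X p i =
    gaugeField (baseDir i) 0 (phase (Pi.single i 1)) (shift p (Pi.single i 1)) := by
  have h := sum_X_add_vert p (Pi.single i 1) 0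
  have h0 : vert (fun q => (0 : (Fin 3 → ℝ) → ℝ) q.1) = 0 := vert_zero
  have hs : ∑ j, (Pi.single i 1 : Fin 6 → ℝ) j • X p j = X p i := by
    rw [Finset.sum_eq_single i]
    · simp
    · intro j _ hj
      simp [hj]
    · simp
  rw [hs, h0, add_zero] at h
  rw [h]
  have : (![(Pi.single i 1 : Fin 6 → ℝ) 1, (Pi.single i 1 : Fin 6 → ℝ) 2,
      (Pi.single i 1 : Fin 6 → ℝ) 0] : Fin 3 → ℝ) = baseDir i := by
    ext k
    fin_cases i <;> fin_cases k <;> simp [baseDir]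
  rw [this]
  simp

theorem fderiv_shift (p : Params) (k : Fin 6 → ℝ) (x v : Fin 3 → ℝ) :
    fderiv ℝ (shift p k) x v
      = (k 4 + 2 * k 5 * x 2) / (p.m * p.w) * v 2 + 2 * (k 5 / p.w) * x 0 * v 0 := by
  have h1 : ContDiff ℝ ∞ (fun t => phase k t / (p.m * p.w)) := (contDiff_phase k).div_const _
  have h2 : ContDiff ℝ ∞ (fun s => k 5 / p.w * s ^ 2) := by fun_prop
  have e1 := fderiv_comp_functional h1 (coord 2) x v
  have e2 := fderiv_comp_functional h2 (coord 0) x v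
  have d1 : DifferentiableAt ℝ (fun x => phase k (coord 2 x) / (p.m * p.w)) x :=
    (h1.comp (coord 2).contDiff).differentiable (by simp) x
  have d2 : DifferentiableAt ℝ (fun x => k 5 / p.w * (coord 0 x) ^ 2) x :=
    (h2.comp (coord 0).contDiff).differentiable (by simp) x
  rw [deriv_div_const, deriv_phase] at e1
  rw [deriv_mul_sq] at e2
  have e3 := congrArg (fun L : (Fin 3 → ℝ) →L[ℝ] ℝ => L v) (fderiv_fun_add d1 d2)
  simp only [add_apply, e1, e2] at e3
  rw [shift_eq]
  exact e3

theorem lieBracket_X (p : Params) (i j : Fin 6) : lieBracket ℝ (X p i) (X p j) =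
    gaugeField 0 0
      (fun t => baseDir i 2 * deriv (phase (Pi.single j 1)) t
        - baseDir j 2 * deriv (phase (Pi.single i 1)) t)
      (fun x => fderiv ℝ (shift p (Pi.single j 1)) x (baseDir i)
        - fderiv ℝ (shift p (Pi.single i 1)) x (baseDir j)) := by
  rw [X_eq_gaugeField, X_eq_gaugeField]
  exact lieBracket_gaugeField _ _ (contDiff_phase _) (contDiff_shift p _) (contDiff_phase _)
    (contDiff_shift p _)

theorem lieBracket_X_vert (p : Params) (i : Fin 6) {K : (Fin 3 → ℝ) → ℝ} (hK : ContDiff ℝ ∞ K) :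
    lieBracket ℝ (X p i) (vert fun q => K q.1) = vert (fun q => fderiv ℝ K q.1 (baseDir i)) := by
  have h0 : ContDiff ℝ ∞ (0 : ℝ → ℝ) := contDiff_const
  rw [X_eq_gaugeField, vert_eq_gaugeField, lieBracket_gaugeField _ _ (contDiff_phase _)
    (contDiff_shift p _) h0 hK, vert_eq_gaugeField (fun x => fderiv ℝ K x (baseDir i))]
  congr 1
  · funext t
    simp
  · funext x
    simp

theorem lieBracket_X_vert_eq_zero (p : Params) {i : Fin 6} (hi : 3 ≤ i) {K : (Fin 3 → ℝ) → ℝ}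
    (hK : ContDiff ℝ ∞ K) : lieBracket ℝ (X p i) (vert fun q => K q.1) = 0 := by
  rw [lieBracket_X_vert p i hK, ← vert_zero]
  have : baseDir i = 0 := by
    fin_cases i <;> first | rfl | exact absurd hi (by decide)
  simp [this]

theorem lieBracket_vert_vert {K K' : (Fin 3 → ℝ) → ℝ} (hK : ContDiff ℝ ∞ K)
    (hK' : ContDiff ℝ ∞ K') :
    lieBracket ℝ (vert fun q => K q.1) (vert fun q => K' q.1) = 0 := by
  have h0 : ContDiff ℝ ∞ (0 : ℝ → ℝ) := contDiff_const
  rw [vert_eq_gaugeField, vert_eq_gaugeField, lieBracket_gaugeField _ _ h0 hK h0 hK', ← vert_zero]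
  refine Eq.trans ?_ (vert_eq_gaugeField fun _ => 0).symm
  congr 1
  · funext t
    simp
  · funext x
    simp

theorem lieBracket_X₁_X₅ (p : Params) : lieBracket ℝ X₁ (X₅ p) = X₄ p := by
  refine (lieBracket_X p 0 4).trans (Eq.trans ?_ (X_eq_gaugeField p 3).symm)
  congr 1
  · funext t
    simp [deriv_phase, baseDir, phase]
  · funext x
    simp [fderiv_shift, baseDir, phase, shift]

theorem lieBracket_X₁_X₆ (p : Params) : lieBracket ℝ X₁ (X₆ p) = (2 : ℝ) • X₅ p := by
  refine (lieBracket_X p 0 5).trans ?_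
  refine Eq.trans ?_ (congrArg _ (X_eq_gaugeField p 4).symm)
  funext q
  refine Prod.ext (by simp [gaugeField, baseDir]) ?_
  ext α
  fin_cases α
  · simp [gaugeField, baseDir, deriv_phase, phase]
    ring
  · simp [gaugeField, baseDir, deriv_phase, phase]
    ring
  · simp [gaugeField, baseDir, fderiv_shift, phase, shift]
    ring

theorem lieBracket_X₂_X₆ (p : Params) :
    lieBracket ℝ X₂ (X₆ p) = vert fun q => 2 * q.1 0 / p.w := by
  refine (lieBracket_X p 1 5).trans (Eq.trans ?_ (vert_eq_gaugeField fun x => 2 * x 0 / p.w).symm)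
  congr 1
  · funext t
    simp [baseDir]
  · funext x
    simp [fderiv_shift, baseDir]
    ring

theorem lieBracket_X_eq_zero (p : Params) (i j : Fin 6) (hij : i < j) (h1 : (i, j) ≠ (0, 4))
    (h2 : (i, j) ≠ (0, 5)) (h3 : (i, j) ≠ (1, 5)) : lieBracket ℝ (X p i) (X p j) = 0 := by
  rw [lieBracket_X, ← vert_zero]
  refine Eq.trans ?_ (vert_eq_gaugeField fun _ => 0).symm
  congr 1
  · funext t
    fin_cases i <;> fin_cases j <;> simp [baseDir, deriv_phase] at hij h1 h2 h3 ⊢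
  · funext x
    fin_cases i <;> fin_cases j <;> simp [baseDir, fderiv_shift] at hij h1 h2 h3 ⊢

theorem sum_X_add_vert_eq_zero_iff (p : Params) (k : Fin 6 → ℝ) (K : (Fin 3 → ℝ) → ℝ) :
    (∑ i, k i • X p i) + vert (fun q => K q.1) = 0 ↔ k = 0 ∧ K = 0 := by
  constructor
  · intro h
    rw [sum_X_add_vert] at h
    have hξ : ∀ i : Fin 3, (![k 1, k 2, k 0] : Fin 3 → ℝ) i = 0 := fun i =>
      congrFun (congrArg Prod.fst (congrFun h 0)) i
    have hθ : ∀ t : ℝ, phase k t = 0 := by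
      intro t
      have := congrFun (congrArg Prod.snd (congrFun h (fun _ => t, fun _ => 1))) 1
      simpa [gaugeField] using this
    -- Three values of the quadratic phase determine its coefficients.
    have t0 := hθ 0
    have t1 := hθ 1
    have t2 := hθ (-1)
    simp only [phase] at t0 t1 t2
    have hk : k = 0 := by
      ext i
      fin_cases i
      · exact hξ 2
      · exact hξ 0
      · exact hξ 1
      · simp only [Pi.zero_apply]; change k 3 = 0; linarith
      · simp only [Pi.zero_apply]; change k 4 = 0; linarith
      · simp only [Pi.zero_apply]; change k 5 = 0; linarith
    refine ⟨hk, funext fun x => ?_⟩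
    have := congrFun (congrArg Prod.snd (congrFun h (x, 0))) 2
    simpa [gaugeField, shift, phase, hk] using this
  · rintro ⟨rfl, rfl⟩
    simpa using vert_zero

/-! ### The three families: membership, uniqueness and commutators. -/

theorem PA_eq (p : Params) (F : ℝ → ℝ) :
    PA p F = vert fun q => F (phaseFun p (√(p.m * (p.d ^ 2 - p.m))) (-1) q.1) := by
  unfold PA
  congr 1
  funext q
  rw [phaseFun_apply]
  congr 1
  ring

theorem QA_eq (p : Params) (G : ℝ → ℝ) :
    QA p G = vert fun q => G (phaseFun p (√(p.m * (p.d ^ 2 - p.m))) 1 q.1) := by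
  unfold QA
  congr 1
  funext q
  rw [phaseFun_apply]
  congr 1
  ring

theorem PB_eq (p : Params) (H : ℂ → ℝ) :
    PB p H = vert fun q => H (toPlane p (√(p.m * (p.m - p.d ^ 2)))⁻¹ q.1) := by
  unfold PB
  congr 1
  funext q
  rw [toPlane_apply]
  congr 2
  ring

theorem phaseFun_of_eq {p : Params} (hd : p.d ≠ 0) (h : p.m = p.d ^ 2) (x : Fin 3 → ℝ) :
    phaseFun p 0 p.d⁻¹ x = p.d * x 1 - (p.c * p.d - 1) * x 2 := by
  rw [phaseFun_apply, h]
  field_simp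
  ring

theorem PC_eq {p : Params} (hd : p.d ≠ 0) (h : p.m = p.d ^ 2) (R : ℝ → ℝ) :
    PC p R = vert fun q => q.1 0 * R (phaseFun p 0 p.d⁻¹ q.1) := by
  unfold PC
  congr 1
  funext q
  rw [phaseFun_of_eq hd h]

theorem QC_eq {p : Params} (hd : p.d ≠ 0) (h : p.m = p.d ^ 2) (S : ℝ → ℝ) :
    QC p S = vert fun q => S (phaseFun p 0 p.d⁻¹ q.1) := by
  unfold QC
  congr 1
  funext q
  rw [phaseFun_of_eq hd h]

theorem lieBracket_X_comp_phaseFun (p : Params) (i : Fin 6) {F : ℝ → ℝ} (hF : ContDiff ℝ ∞ F)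
    (r s : ℝ) : lieBracket ℝ (X p i) (vert fun q => F (phaseFun p r s q.1))
      = phaseFun p r s (baseDir i) • vert (fun q => deriv F (phaseFun p r s q.1)) := by
  have h := lieBracket_X_vert p i (K := fun x => F (phaseFun p r s x))
    (hF.comp (phaseFun p r s).contDiff)
  simp only [fderiv_comp_functional hF] at h
  rw [h, smul_vert]
  congr 1
  funext q
  ring

theorem derivX_eq {H : ℂ → ℝ} (hH : Differentiable ℝ H) (z : ℂ) : derivX H z = fderiv ℝ H z 1 := by
  have hl : HasDerivAt (fun s : ℝ => (⟨s, z.im⟩ : ℂ)) 1 z.re := by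
    have e : (fun s : ℝ => (⟨s, z.im⟩ : ℂ)) = fun s : ℝ => (s : ℂ) + z.im * Complex.I := by
      funext s
      apply Complex.ext <;> simp
    rw [e]
    exact (Complex.ofRealCLM.hasDerivAt (x := z.re)).add_const _
  have := (hH ⟨z.re, z.im⟩).hasFDerivAt.comp_hasDerivAt z.re hl
  exact this.deriv

theorem derivσ_eq {H : ℂ → ℝ} (hH : Differentiable ℝ H) (z : ℂ) :
    derivσ H z = fderiv ℝ H z Complex.I := by
  have hl : HasDerivAt (fun s : ℝ => (⟨z.re, s⟩ : ℂ)) Complex.I z.im := by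
    have e : (fun s : ℝ => (⟨z.re, s⟩ : ℂ)) = fun s : ℝ => (z.re : ℂ) + s * Complex.I := by
      funext s
      apply Complex.ext <;> simp
    rw [e]
    simpa using ((Complex.ofRealCLM.hasDerivAt (x := z.im)).mul_const Complex.I).const_add
      (z.re : ℂ)
  have := (hH ⟨z.re, z.im⟩).hasFDerivAt.comp_hasDerivAt z.im hl
  exact this.deriv

theorem PA_add_QA (p : Params) (F G : ℝ → ℝ) : PA p F + QA p G = vert fun q =>
    (fun x => F (phaseFun p (√(p.m * (p.d ^ 2 - p.m))) (-1) x)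
      + G (phaseFun p (√(p.m * (p.d ^ 2 - p.m))) 1 x)) q.1 := by
  rw [PA_eq, QA_eq, vert_add]

theorem sum_X_add_PA_add_QA_eq_zero_iff {p : Params} (hm : 0 < p.m) (h : p.m < p.d ^ 2)
    (k : Fin 6 → ℝ) (F G : ℝ → ℝ) : (∑ i, k i • X p i) + PA p F + QA p G = 0 ↔
      k = 0 ∧ ∃ r : ℝ, (∀ s, F s = r) ∧ ∀ s, G s = -r := by
  have hα0 : √(p.m * (p.d ^ 2 - p.m)) ≠ 0 :=
    (Real.sqrt_pos.2 (mul_pos hm (by linarith))).ne'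
  rw [add_assoc, PA_add_QA]
  refine (sum_X_add_vert_eq_zero_iff p k fun x => F (phaseFun p _ _ x)
    + G (phaseFun p _ _ x)).trans ?_
  refine and_congr_right fun _ => ⟨fun hK => ?_, ?_⟩
  · have key : ∀ s s' : ℝ, F s + G s' = 0 := by
      intro s s'
      -- At this point with `t = 0` the two phases take the independent values `s` and `s'`, so the
      -- variables of `F` and `G` separate.
      have := congrFun hK ![(s + s') / (2 * √(p.m * (p.d ^ 2 - p.m))), (s' - s) / (2 * p.m), 0]
      simp only [phaseFun_apply] at this
      convert this using 3
      · simp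
        field_simp
        ring
      · simp
        field_simp
        ring
      · rfl
    refine ⟨F 0, fun s => ?_, fun s => ?_⟩
    · linarith [key s 0, key 0 0]
    · linarith [key 0 s]
  · rintro ⟨r, hF, hG⟩
    funext x
    simp [hF, hG]

theorem mem_symmetryAlgebra_iff_of_lt {p : Params} (ha : p.a ≠ 0) (hε : p.ε₀ ≠ 0) (hm : 0 < p.m)
    (hd : p.d ≠ 0) (hw : p.w ≠ 0) (h : p.m < p.d ^ 2) (V : Jet0 → Jet0) :
    V ∈ symmetryAlgebra p ↔ ∃ (k : Fin 6 → ℝ) (F G : ℝ → ℝ), ContDiff ℝ ∞ F ∧ ContDiff ℝ ∞ G ∧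
      V = (∑ i, k i • X p i) + PA p F + QA p G := by
  simp only [mem_symmetryAlgebra_iff ha hε hm.ne' hd hw, isSol_iff_of_lt hm h, add_assoc, PA_add_QA]
  constructor
  · rintro ⟨k, K, ⟨F, G, hF, hG, rfl⟩, rfl⟩
    exact ⟨k, F, G, hF, hG, rfl⟩
  · rintro ⟨k, F, G, hF, hG, rfl⟩
    exact ⟨k, _, ⟨F, G, hF, hG, rfl⟩, rfl⟩

theorem lieBracket_X₂_X₆_of_lt {p : Params} (hm : 0 < p.m) (hw : p.w ≠ 0) (h : p.m < p.d ^ 2) :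
    lieBracket ℝ X₂ (X₆ p) =
      (1 / (p.w * √(p.m * (p.d ^ 2 - p.m)))) • (PA p (fun s => s) + QA p (fun s => s)) := by
  have hα0 : √(p.m * (p.d ^ 2 - p.m)) ≠ 0 :=
    (Real.sqrt_pos.2 (mul_pos hm (by linarith))).ne'
  rw [lieBracket_X₂_X₆, PA_add_QA, smul_vert]
  congr 1
  funext q
  simp only [phaseFun_apply]
  field_simp
  ring

theorem lieBracket_PA (p : Params) {F : ℝ → ℝ} (hF : ContDiff ℝ ∞ F) :
    lieBracket ℝ X₁ (PA p F) = (p.m * p.c - p.d) • PA p (deriv F) ∧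
    lieBracket ℝ X₂ (PA p F) = √(p.m * (p.d ^ 2 - p.m)) • PA p (deriv F) ∧
    lieBracket ℝ X₃ (PA p F) = (-p.m) • PA p (deriv F) ∧
    ∀ i : Fin 6, 3 ≤ i → lieBracket ℝ (X p i) (PA p F) = 0 := by
  simp only [PA_eq]
  refine ⟨?_, ?_, ?_, fun i hi => lieBracket_X_vert_eq_zero p hi
    (hF.comp (phaseFun p _ _).contDiff)⟩
  · refine (lieBracket_X_comp_phaseFun p 0 hF _ _).trans ?_
    congr 1
    simp [phaseFun_apply, baseDir]
  · refine (lieBracket_X_comp_phaseFun p 1 hF _ _).trans ?_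
    congr 1
    simp [phaseFun_apply, baseDir]
  · refine (lieBracket_X_comp_phaseFun p 2 hF _ _).trans ?_
    congr 1
    simp [phaseFun_apply, baseDir]

theorem lieBracket_QA (p : Params) {G : ℝ → ℝ} (hG : ContDiff ℝ ∞ G) :
    lieBracket ℝ X₁ (QA p G) = (p.d - p.m * p.c) • QA p (deriv G) ∧
    lieBracket ℝ X₂ (QA p G) = √(p.m * (p.d ^ 2 - p.m)) • QA p (deriv G) ∧
    lieBracket ℝ X₃ (QA p G) = p.m • QA p (deriv G) ∧
    ∀ i : Fin 6, 3 ≤ i → lieBracket ℝ (X p i) (QA p G) = 0 := by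
  simp only [QA_eq]
  refine ⟨?_, ?_, ?_, fun i hi => lieBracket_X_vert_eq_zero p hi
    (hG.comp (phaseFun p _ _).contDiff)⟩
  · refine (lieBracket_X_comp_phaseFun p 0 hG _ _).trans ?_
    congr 1
    simp [phaseFun_apply, baseDir]
  · refine (lieBracket_X_comp_phaseFun p 1 hG _ _).trans ?_
    congr 1
    simp [phaseFun_apply, baseDir]
  · refine (lieBracket_X_comp_phaseFun p 2 hG _ _).trans ?_
    congr 1
    simp [phaseFun_apply, baseDir]

theorem lieBracket_PA_QA (p : Params) {F G : ℝ → ℝ} (hF : ContDiff ℝ ∞ F) (hG : ContDiff ℝ ∞ G) :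
    lieBracket ℝ (PA p F) (PA p G) = 0 ∧ lieBracket ℝ (PA p F) (QA p G) = 0 ∧
      lieBracket ℝ (QA p F) (QA p G) = 0 := by
  simp only [PA_eq, QA_eq]
  exact ⟨lieBracket_vert_vert (hF.comp (phaseFun p _ _).contDiff)
      (hG.comp (phaseFun p _ _).contDiff),
    lieBracket_vert_vert (hF.comp (phaseFun p _ _).contDiff) (hG.comp (phaseFun p _ _).contDiff),
    lieBracket_vert_vert (hF.comp (phaseFun p _ _).contDiff) (hG.comp (phaseFun p _ _).contDiff)⟩

theorem mem_symmetryAlgebra_iff_of_gt {p : Params} (ha : p.a ≠ 0) (hε : p.ε₀ ≠ 0) (hm : 0 < p.m)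
    (hd : p.d ≠ 0) (hw : p.w ≠ 0) (h : p.d ^ 2 < p.m) (V : Jet0 → Jet0) :
    V ∈ symmetryAlgebra p ↔ ∃ (k : Fin 6 → ℝ) (H : ℂ → ℝ), IsHarmonic H ∧
      V = (∑ i, k i • X p i) + PB p H := by
  simp only [mem_symmetryAlgebra_iff ha hε hm.ne' hd hw, isSol_iff_of_gt hm h, PB_eq]
  constructor
  · rintro ⟨k, K, ⟨H, hH, rfl⟩, rfl⟩
    exact ⟨k, H, hH, rfl⟩
  · rintro ⟨k, H, hH, rfl⟩
    exact ⟨k, _, ⟨H, hH, rfl⟩, rfl⟩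

theorem sum_X_add_PB_eq_zero_iff {p : Params} (hm : 0 < p.m) (h : p.d ^ 2 < p.m)
    (k : Fin 6 → ℝ) (H : ℂ → ℝ) : (∑ i, k i • X p i) + PB p H = 0 ↔ k = 0 ∧ H = 0 := by
  have hα0 : √(p.m * (p.m - p.d ^ 2)) ≠ 0 :=
    (Real.sqrt_pos.2 (mul_pos hm (by linarith))).ne'
  have hm0 := hm.ne'
  rw [PB_eq]
  refine (sum_X_add_vert_eq_zero_iff p k fun x => H (toPlane p _ x)).trans ?_
  refine and_congr_right fun _ => ⟨fun hK => ?_, ?_⟩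
  · funext z
    -- A preimage of `z` under `toPlane` in the slice `t = 0`.
    have := congrFun hK ![z.re, √(p.m * (p.m - p.d ^ 2)) * z.im / p.m, 0]
    rw [toPlane_apply] at this
    refine Eq.trans (congrArg H ?_) this
    apply Complex.ext
    · simp
    · simp
      field_simp
  · rintro rfl
    rfl

theorem lieBracket_X₂_X₆_of_gt (p : Params) :
    lieBracket ℝ X₂ (X₆ p) = PB p (fun z => 2 * z.re / p.w) := by
  rw [lieBracket_X₂_X₆, PB]

theorem lieBracket_X_comp_toPlane (p : Params) (i : Fin 6) {H : ℂ → ℝ} (hH : ContDiff ℝ ∞ H)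
    (s : ℝ) : lieBracket ℝ (X p i) (vert fun q => H (toPlane p s q.1))
      = vert (fun q => fderiv ℝ H (toPlane p s q.1) (toPlane p s (baseDir i))) := by
  have h := lieBracket_X_vert p i (K := fun x => H (toPlane p s x))
    (hH.comp (toPlane p s).contDiff)
  simpa only [fderiv_comp_clm (hH.differentiable (by simp))] using h

theorem lieBracket_PB {p : Params} (hm : 0 < p.m) (h : p.d ^ 2 < p.m) {H : ℂ → ℝ}
    (hH : IsHarmonic H) :
    lieBracket ℝ X₁ (PB p H) =
      ((p.d - p.m * p.c) / √(p.m * (p.m - p.d ^ 2))) • PB p (derivσ H) ∧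
    lieBracket ℝ X₂ (PB p H) = PB p (derivX H) ∧
    lieBracket ℝ X₃ (PB p H) = √(p.m / (p.m - p.d ^ 2)) • PB p (derivσ H) ∧
    ∀ i : Fin 6, 3 ≤ i → lieBracket ℝ (X p i) (PB p H) = 0 := by
  have cH := ((isHarmonic_iff H).1 hH).1
  have dH := cH.differentiable (by simp)
  have hpos : 0 < p.m - p.d ^ 2 := by linarith
  have hroot : √(p.m / (p.m - p.d ^ 2)) = (√(p.m * (p.m - p.d ^ 2)))⁻¹ * p.m := by
    rw [Real.sqrt_eq_iff_mul_self_eq (by positivity) (by positivity)]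
    have := Real.sq_sqrt (mul_pos hm hpos).le
    have h0 : √(p.m * (p.m - p.d ^ 2)) ≠ 0 := (Real.sqrt_pos.2 (mul_pos hm hpos)).ne'
    have h1 := hpos.ne'
    field_simp
    rw [this]
  simp only [PB_eq, smul_vert, derivX_eq dH, derivσ_eq dH]
  refine ⟨?_, ?_, ?_, fun i hi => lieBracket_X_vert_eq_zero p hi
    (cH.comp (toPlane p _).contDiff)⟩
  · refine (lieBracket_X_comp_toPlane p 0 cH _).trans ?_
    have e : toPlane p (√(p.m * (p.m - p.d ^ 2)))⁻¹ (baseDir 0)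
        = ((p.d - p.m * p.c) / √(p.m * (p.m - p.d ^ 2))) • Complex.I := by
      rw [toPlane_apply]
      apply Complex.ext
      · simp [baseDir]
      · simp [baseDir]
        ring
    simp only [e, map_smul, smul_eq_mul]
  · refine (lieBracket_X_comp_toPlane p 1 cH _).trans ?_
    have e : toPlane p (√(p.m * (p.m - p.d ^ 2)))⁻¹ (baseDir 1) = 1 := by
      rw [toPlane_apply]
      apply Complex.ext <;> simp [baseDir]
    simp only [e]
  · refine (lieBracket_X_comp_toPlane p 2 cH _).trans ?_
    have e : toPlane p (√(p.m * (p.m - p.d ^ 2)))⁻¹ (baseDir 2)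
        = √(p.m / (p.m - p.d ^ 2)) • Complex.I := by
      rw [toPlane_apply, hroot]
      apply Complex.ext <;> simp [baseDir]
    simp only [e, map_smul, smul_eq_mul]

theorem lieBracket_PB_PB (p : Params) {H K : ℂ → ℝ} (hH : IsHarmonic H) (hK : IsHarmonic K) :
    lieBracket ℝ (PB p H) (PB p K) = 0 := by
  rw [PB_eq, PB_eq]
  exact lieBracket_vert_vert (((isHarmonic_iff H).1 hH).1.comp (toPlane p _).contDiff)
    (((isHarmonic_iff K).1 hK).1.comp (toPlane p _).contDiff)

theorem PC_add_QC {p : Params} (hd : p.d ≠ 0) (h : p.m = p.d ^ 2) (R S : ℝ → ℝ) :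
    PC p R + QC p S = vert fun q =>
      (fun x => x 0 * R (phaseFun p 0 p.d⁻¹ x) + S (phaseFun p 0 p.d⁻¹ x)) q.1 := by
  rw [PC_eq hd h, QC_eq hd h, vert_add]

theorem mem_symmetryAlgebra_iff_of_eq {p : Params} (ha : p.a ≠ 0) (hε : p.ε₀ ≠ 0) (hm : 0 < p.m)
    (hd : 0 < p.d) (hw : p.w ≠ 0) (h : p.m = p.d ^ 2) (V : Jet0 → Jet0) :
    V ∈ symmetryAlgebra p ↔ ∃ (k : Fin 6 → ℝ) (R S : ℝ → ℝ), ContDiff ℝ ∞ R ∧ ContDiff ℝ ∞ S ∧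
      V = (∑ i, k i • X p i) + PC p R + QC p S := by
  simp only [mem_symmetryAlgebra_iff ha hε hm.ne' hd.ne' hw, isSol_iff_of_eq hd h, add_assoc,
    PC_add_QC hd.ne' h]
  constructor
  · rintro ⟨k, K, ⟨R, S, hR, hS, rfl⟩, rfl⟩
    exact ⟨k, R, S, hR, hS, rfl⟩
  · rintro ⟨k, R, S, hR, hS, rfl⟩
    exact ⟨k, _, ⟨R, S, hR, hS, rfl⟩, rfl⟩

theorem sum_X_add_PC_add_QC_eq_zero_iff {p : Params} (hd : p.d ≠ 0) (h : p.m = p.d ^ 2)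
    (k : Fin 6 → ℝ) (R S : ℝ → ℝ) : (∑ i, k i • X p i) + PC p R + QC p S = 0 ↔
      k = 0 ∧ R = 0 ∧ S = 0 := by
  rw [add_assoc, PC_add_QC hd h]
  refine (sum_X_add_vert_eq_zero_iff p k fun x => x 0 * R (phaseFun p _ _ x)
    + S (phaseFun p _ _ x)).trans ?_
  refine and_congr_right fun _ => ⟨fun hK => ?_, ?_⟩
  · have key : ∀ r s : ℝ, r * R s + S s = 0 := by
      intro r s
      have := congrFun hK ![r, s / p.d, 0]
      simp only [phaseFun_of_eq hd h] at this
      simpa [mul_div_cancel₀ s hd] using this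
    have hS : ∀ s, S s = 0 := fun s => by linarith [key 0 s]
    exact ⟨funext fun s => by simpa [hS] using key 1 s, funext hS⟩
  · rintro ⟨rfl, rfl⟩
    funext x
    simp

theorem lieBracket_X₂_X₆_of_eq (p : Params) :
    lieBracket ℝ X₂ (X₆ p) = PC p (fun _ => 2 / p.w) := by
  rw [lieBracket_X₂_X₆, PC]
  congr 1
  funext q
  ring

theorem contDiff_mul_comp_phaseFun (p : Params) {R : ℝ → ℝ} (hR : ContDiff ℝ ∞ R) (r s : ℝ) :
    ContDiff ℝ ∞ (fun x : Fin 3 → ℝ => x 0 * R (phaseFun p r s x)) :=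
  (contDiff_apply ℝ ℝ 0).mul (hR.comp (phaseFun p r s).contDiff)

theorem fderiv_mul_comp_phaseFun (p : Params) {R : ℝ → ℝ} (hR : ContDiff ℝ ∞ R) (r s : ℝ)
    (x v : Fin 3 → ℝ) : fderiv ℝ (fun x : Fin 3 → ℝ => x 0 * R (phaseFun p r s x)) x v
      = phaseFun p r s v * (x 0 * deriv R (phaseFun p r s x)) + v 0 * R (phaseFun p r s x) := by
  have dR : DifferentiableAt ℝ (fun x => R (phaseFun p r s x)) x :=
    (hR.comp (phaseFun p r s).contDiff).differentiable (by simp) x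
  have := ((coord 0).hasFDerivAt (x := x)).fun_mul dR.hasFDerivAt
  simp only [ContinuousLinearMap.proj_apply] at this
  rw [this.fderiv]
  simp [fderiv_comp_functional hR]
  ring

/-- The factor `x` contributes a second term by the product rule; this is how `∂_x` maps the first
family into the second. -/
theorem lieBracket_X_PC {p : Params} (hd : p.d ≠ 0) (h : p.m = p.d ^ 2) (i : Fin 6) {R : ℝ → ℝ}
    (hR : ContDiff ℝ ∞ R) : lieBracket ℝ (X p i) (PC p R)
      = phaseFun p 0 p.d⁻¹ (baseDir i) • PC p (deriv R) + baseDir i 0 • QC p R := by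
  rw [PC_eq hd h, PC_eq hd h, QC_eq hd h, smul_vert, smul_vert, vert_add]
  refine (lieBracket_X_vert p i (contDiff_mul_comp_phaseFun p hR 0 p.d⁻¹)).trans ?_
  simp only [fderiv_mul_comp_phaseFun p hR]

theorem lieBracket_PC {p : Params} (hd : p.d ≠ 0) (h : p.m = p.d ^ 2) {R : ℝ → ℝ}
    (hR : ContDiff ℝ ∞ R) :
    lieBracket ℝ X₁ (PC p R) = (1 - p.c * p.d) • PC p (deriv R) ∧
    lieBracket ℝ X₂ (PC p R) = QC p R ∧
    lieBracket ℝ X₃ (PC p R) = p.d • PC p (deriv R) ∧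
    ∀ i : Fin 6, 3 ≤ i → lieBracket ℝ (X p i) (PC p R) = 0 := by
  refine ⟨?_, ?_, ?_, fun i hi => ?_⟩
  · refine (lieBracket_X_PC hd h 0 hR).trans ?_
    simp [phaseFun_of_eq hd h, baseDir]
  · refine (lieBracket_X_PC hd h 1 hR).trans ?_
    simp [phaseFun_of_eq hd h, baseDir]
  · refine (lieBracket_X_PC hd h 2 hR).trans ?_
    simp [phaseFun_of_eq hd h, baseDir]
  · rw [PC_eq hd h]
    exact lieBracket_X_vert_eq_zero p hi (contDiff_mul_comp_phaseFun p hR 0 p.d⁻¹)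

theorem lieBracket_QC {p : Params} (hd : p.d ≠ 0) (h : p.m = p.d ^ 2) {S : ℝ → ℝ}
    (hS : ContDiff ℝ ∞ S) :
    lieBracket ℝ X₁ (QC p S) = (1 - p.c * p.d) • QC p (deriv S) ∧
    lieBracket ℝ X₂ (QC p S) = 0 ∧
    lieBracket ℝ X₃ (QC p S) = p.d • QC p (deriv S) ∧
    ∀ i : Fin 6, 3 ≤ i → lieBracket ℝ (X p i) (QC p S) = 0 := by
  simp only [QC_eq hd h]
  refine ⟨?_, ?_, ?_, fun i hi => lieBracket_X_vert_eq_zero p hi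
    (hS.comp (phaseFun p _ _).contDiff)⟩
  · refine (lieBracket_X_comp_phaseFun p 0 hS _ _).trans ?_
    congr 1
    simp [phaseFun_of_eq hd h, baseDir]
  · refine (lieBracket_X_comp_phaseFun p 1 hS _ _).trans ?_
    simp [phaseFun_of_eq hd h, baseDir]
  · refine (lieBracket_X_comp_phaseFun p 2 hS _ _).trans ?_
    congr 1
    simp [phaseFun_of_eq hd h, baseDir]

theorem lieBracket_PC_QC {p : Params} (hd : p.d ≠ 0) (h : p.m = p.d ^ 2) {R S : ℝ → ℝ}
    (hR : ContDiff ℝ ∞ R) (hS : ContDiff ℝ ∞ S) :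
    lieBracket ℝ (PC p R) (PC p S) = 0 ∧ lieBracket ℝ (PC p R) (QC p S) = 0 ∧
      lieBracket ℝ (QC p R) (QC p S) = 0 := by
  simp only [PC_eq hd h, QC_eq hd h]
  exact ⟨lieBracket_vert_vert (contDiff_mul_comp_phaseFun p hR 0 p.d⁻¹)
      (contDiff_mul_comp_phaseFun p hS 0 p.d⁻¹),
    lieBracket_vert_vert (contDiff_mul_comp_phaseFun p hR 0 p.d⁻¹)
      (hS.comp (phaseFun p _ _).contDiff),
    lieBracket_vert_vert (hR.comp (phaseFun p _ _).contDiff) (hS.comp (phaseFun p _ _).contDiff)⟩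

end

end BRZR

open VectorField in
theorem mainTheorem1 (p : BRZR.Params)
    (ha : p.a ≠ 0) (hb : p.b ≠ 0) (hc : p.c ≠ 0)
    (hε : 0 < p.ε₀) (hd : 0 < p.d) (hm : 0 < p.m) (hw : 0 < p.w) :
    -- the symmetries form an infinite-dimensional Lie algebra
    (∀ V ∈ BRZR.symmetryAlgebra p, ∀ W ∈ BRZR.symmetryAlgebra p,
      lieBracket ℝ V W ∈ BRZR.symmetryAlgebra p) ∧
    ¬ FiniteDimensional ℝ (BRZR.symmetryAlgebra p) ∧
    -- commutators of `X₁, …, X₆`, except for `[X₂, X₆]`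
    lieBracket ℝ BRZR.X₁ (BRZR.X₅ p) = BRZR.X₄ p ∧
    lieBracket ℝ BRZR.X₁ (BRZR.X₆ p) = (2 : ℝ) • BRZR.X₅ p ∧
    (∀ i j : Fin 6, i < j → (i, j) ≠ (0, 4) → (i, j) ≠ (0, 5) → (i, j) ≠ (1, 5) →
      lieBracket ℝ (BRZR.X p i) (BRZR.X p j) = 0) ∧
    -- the case `m < d²`
    (p.m < p.d ^ 2 →
      (∀ V, V ∈ BRZR.symmetryAlgebra p ↔
        ∃ (k : Fin 6 → ℝ) (F G : ℝ → ℝ), ContDiff ℝ ∞ F ∧ ContDiff ℝ ∞ G ∧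
          V = (∑ i, k i • BRZR.X p i) + BRZR.PA p F + BRZR.QA p G) ∧
      (∀ (k : Fin 6 → ℝ) (F G : ℝ → ℝ), ContDiff ℝ ∞ F → ContDiff ℝ ∞ G →
        ((∑ i, k i • BRZR.X p i) + BRZR.PA p F + BRZR.QA p G = 0 ↔
          k = 0 ∧ ∃ r : ℝ, (∀ s, F s = r) ∧ ∀ s, G s = -r)) ∧
      lieBracket ℝ BRZR.X₂ (BRZR.X₆ p) =
        (1 / (p.w * √(p.m * (p.d ^ 2 - p.m)))) • (BRZR.PA p (fun s => s) + BRZR.QA p (fun s => s)) ∧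
      (∀ F : ℝ → ℝ, ContDiff ℝ ∞ F →
        lieBracket ℝ BRZR.X₁ (BRZR.PA p F) = (p.m * p.c - p.d) • BRZR.PA p (deriv F) ∧
        lieBracket ℝ BRZR.X₂ (BRZR.PA p F) =
          √(p.m * (p.d ^ 2 - p.m)) • BRZR.PA p (deriv F) ∧
        lieBracket ℝ BRZR.X₃ (BRZR.PA p F) = (-p.m) • BRZR.PA p (deriv F) ∧
        ∀ i : Fin 6, 3 ≤ i → lieBracket ℝ (BRZR.X p i) (BRZR.PA p F) = 0) ∧
      (∀ G : ℝ → ℝ, ContDiff ℝ ∞ G →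
        lieBracket ℝ BRZR.X₁ (BRZR.QA p G) = (p.d - p.m * p.c) • BRZR.QA p (deriv G) ∧
        lieBracket ℝ BRZR.X₂ (BRZR.QA p G) =
          √(p.m * (p.d ^ 2 - p.m)) • BRZR.QA p (deriv G) ∧
        lieBracket ℝ BRZR.X₃ (BRZR.QA p G) = p.m • BRZR.QA p (deriv G) ∧
        ∀ i : Fin 6, 3 ≤ i → lieBracket ℝ (BRZR.X p i) (BRZR.QA p G) = 0) ∧
      (∀ F G : ℝ → ℝ, ContDiff ℝ ∞ F → ContDiff ℝ ∞ G →
        lieBracket ℝ (BRZR.PA p F) (BRZR.PA p G) = 0 ∧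
        lieBracket ℝ (BRZR.PA p F) (BRZR.QA p G) = 0 ∧
        lieBracket ℝ (BRZR.QA p F) (BRZR.QA p G) = 0)) ∧
    -- the case `m > d²`
    (p.d ^ 2 < p.m →
      (∀ V, V ∈ BRZR.symmetryAlgebra p ↔
        ∃ (k : Fin 6 → ℝ) (H : ℂ → ℝ), BRZR.IsHarmonic H ∧
          V = (∑ i, k i • BRZR.X p i) + BRZR.PB p H) ∧
      (∀ (k : Fin 6 → ℝ) (H : ℂ → ℝ), BRZR.IsHarmonic H →
        ((∑ i, k i • BRZR.X p i) + BRZR.PB p H = 0 ↔ k = 0 ∧ H = 0)) ∧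
      lieBracket ℝ BRZR.X₂ (BRZR.X₆ p) = BRZR.PB p (fun z => 2 * z.re / p.w) ∧
      (∀ H : ℂ → ℝ, BRZR.IsHarmonic H →
        lieBracket ℝ BRZR.X₁ (BRZR.PB p H) =
          ((p.d - p.m * p.c) / √(p.m * (p.m - p.d ^ 2))) • BRZR.PB p (BRZR.derivσ H) ∧
        lieBracket ℝ BRZR.X₂ (BRZR.PB p H) = BRZR.PB p (BRZR.derivX H) ∧
        lieBracket ℝ BRZR.X₃ (BRZR.PB p H) =
          √(p.m / (p.m - p.d ^ 2)) • BRZR.PB p (BRZR.derivσ H) ∧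
        ∀ i : Fin 6, 3 ≤ i → lieBracket ℝ (BRZR.X p i) (BRZR.PB p H) = 0) ∧
      (∀ H K : ℂ → ℝ, BRZR.IsHarmonic H → BRZR.IsHarmonic K →
        lieBracket ℝ (BRZR.PB p H) (BRZR.PB p K) = 0)) ∧
    -- the case `m = d²`
    (p.m = p.d ^ 2 →
      (∀ V, V ∈ BRZR.symmetryAlgebra p ↔
        ∃ (k : Fin 6 → ℝ) (R S : ℝ → ℝ), ContDiff ℝ ∞ R ∧ ContDiff ℝ ∞ S ∧
          V = (∑ i, k i • BRZR.X p i) + BRZR.PC p R + BRZR.QC p S) ∧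
      (∀ (k : Fin 6 → ℝ) (R S : ℝ → ℝ), ContDiff ℝ ∞ R → ContDiff ℝ ∞ S →
        ((∑ i, k i • BRZR.X p i) + BRZR.PC p R + BRZR.QC p S = 0 ↔ k = 0 ∧ R = 0 ∧ S = 0)) ∧
      lieBracket ℝ BRZR.X₂ (BRZR.X₆ p) = BRZR.PC p (fun _ => 2 / p.w) ∧
      (∀ R : ℝ → ℝ, ContDiff ℝ ∞ R →
        lieBracket ℝ BRZR.X₁ (BRZR.PC p R) = (1 - p.c * p.d) • BRZR.PC p (deriv R) ∧
        lieBracket ℝ BRZR.X₂ (BRZR.PC p R) = BRZR.QC p R ∧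
        lieBracket ℝ BRZR.X₃ (BRZR.PC p R) = p.d • BRZR.PC p (deriv R) ∧
        ∀ i : Fin 6, 3 ≤ i → lieBracket ℝ (BRZR.X p i) (BRZR.PC p R) = 0) ∧
      (∀ S : ℝ → ℝ, ContDiff ℝ ∞ S →
        lieBracket ℝ BRZR.X₁ (BRZR.QC p S) = (1 - p.c * p.d) • BRZR.QC p (deriv S) ∧
        lieBracket ℝ BRZR.X₂ (BRZR.QC p S) = 0 ∧
        lieBracket ℝ BRZR.X₃ (BRZR.QC p S) = p.d • BRZR.QC p (deriv S) ∧
        ∀ i : Fin 6, 3 ≤ i → lieBracket ℝ (BRZR.X p i) (BRZR.QC p S) = 0) ∧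
      (∀ R S : ℝ → ℝ, ContDiff ℝ ∞ R → ContDiff ℝ ∞ S →
        lieBracket ℝ (BRZR.PC p R) (BRZR.PC p S) = 0 ∧
        lieBracket ℝ (BRZR.PC p R) (BRZR.QC p S) = 0 ∧
        lieBracket ℝ (BRZR.QC p R) (BRZR.QC p S) = 0)) := by
  have hε' := hε.ne'
  have hd' := hd.ne'
  have hm' := hm.ne'
  have hw' := hw.ne'
  refine ⟨fun V hV W hW => BRZR.lieBracket_mem_symmetryAlgebra ha hε' hm' hd' hw' hV hW,
    BRZR.not_finiteDimensional ha hε' hm hd' hw', BRZR.lieBracket_X₁_X₅ p,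
    BRZR.lieBracket_X₁_X₆ p, BRZR.lieBracket_X_eq_zero p, fun h => ?_, fun h => ?_, fun h => ?_⟩
  · exact ⟨BRZR.mem_symmetryAlgebra_iff_of_lt ha hε' hm hd' hw' h,
      fun k F G _ _ => BRZR.sum_X_add_PA_add_QA_eq_zero_iff hm h k F G,
      BRZR.lieBracket_X₂_X₆_of_lt hm hw' h, fun F hF => BRZR.lieBracket_PA p hF,
      fun G hG => BRZR.lieBracket_QA p hG, fun F G hF hG => BRZR.lieBracket_PA_QA p hF hG⟩
  · exact ⟨BRZR.mem_symmetryAlgebra_iff_of_gt ha hε' hm hd' hw' h,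
      fun k H _ => BRZR.sum_X_add_PB_eq_zero_iff hm h k H,
      BRZR.lieBracket_X₂_X₆_of_gt p, fun H hH => BRZR.lieBracket_PB hm h hH,
      fun H K hH hK => BRZR.lieBracket_PB_PB p hH hK⟩
  · exact ⟨BRZR.mem_symmetryAlgebra_iff_of_eq ha hε' hm hd hw' h,
      fun k R S _ _ => BRZR.sum_X_add_PC_add_QC_eq_zero_iff hd' h k R S,
      BRZR.lieBracket_X₂_X₆_of_eq p, fun R hR => BRZR.lieBracket_PC hd' h hR,
      fun S hS => BRZR.lieBracket_QC hd' h hS,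
      fun R S hR hS => BRZR.lieBracket_PC_QC hd' h hR hS⟩
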